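/- A unit disk is a closed disk of radius $1$ in the plane. In the problem $k$-CDUDC one is given a set $P$ of $n\ge 1$ points, a set $D$ of $m$ unit disks, both in the plane, and an integer $k\ge 1$. A $c$-colorable cover is a set $D'\subseteq D$ covering all points of $P$ together with a coloring of $D'$ by at most $c$ colors in which any two distinct disks that intersect receive different colors. A $\rho$-approximation algorithm for $k$-CDUDC returns, on every input that admits a $k$-colorable cover, a $\rho k$-colorable cover (the set and its coloring). For a grid width $1\le\tau\le 5$ let $$\rho=\begin{cases}4&\text{if }\tau\ge 2,\\ 6&\text{if }\tfrac85\le\tau<2,\\ 7&\text{if }\sqrt2\le\tau<\tfrac85,\\ 9&\text{if }1\le\tau<\sqrt2,\end{cases}\qquad \alpha=\begin{cases}4&\text{if }\tau=1,\\ 5&\text{if }\sqrt2\le\tau\le\tfrac85,\\ 7&\text{if }\tau=2,\\ 10&\text{if }\tau=3,\\ 14&\text{if }\tau=4,\\ 17&\text{if }\tau=5,\end{cases}$$ and at the remaining values of $\tau$ let $\alpha$ be the largest number of pairwise disjoint unit disks that can all intersect a $\tau\times\tau$ square. Then there is an algorithm on the real RAM (unit-cost arithmetic and comparisons on reals; unit-cost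 addition, subtraction, comparison and indirect addressing on integers; no rounding) that, given $\tau$ together with $P$, $D$ and $k$, is a $\rho$-approximation algorithm for $k$-CDUDC and runs in $O(m^{\alpha k}\,n\log(k+1))$ time, with an absolute constant in the $O$. -/

import Mathlib

noncomputable section

namespace CDUDC

/-! ### Unit disks, colourable covers -/

abbrev Plane : Type := EuclideanSpace ℝ (Fin 2)

/-- The closed disk of radius `1` around `c`. -/
def unitDisk (c : Plane) : Set Plane := Metric.closedBall c 1

/-- An input of the problem: a set of `n` points, a set of `m` unit disks (given by their centres),
both enumerated without repetition, and the parameter `k`. -/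
structure Input where
  n : ℕ
  m : ℕ
  k : ℕ
  point : Fin n → Plane
  center : Fin m → Plane
  point_injective : Function.Injective point
  center_injective : Function.Injective center

/-- The disks with index in `S` cover all points, and `χ` colours them with colours from
`{1, …, c}` so that distinct disks of the same colour are disjoint. -/
def Input.IsColoredCover (I : Input) (c : ℕ) (S : Set (Fin I.m)) (χ : Fin I.m → ℕ) : Prop :=
  (∀ i : Fin I.n, ∃ j ∈ S, I.point i ∈ unitDisk (I.center j)) ∧
  (∀ j ∈ S, 1 ≤ χ j ∧ χ j ≤ c) ∧
  (∀ j ∈ S, ∀ j' ∈ S, j ≠ j' → χ j = χ j' →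
    Disjoint (unitDisk (I.center j)) (unitDisk (I.center j')))

/-- Some subset of the given disks is a `c`-colourable cover of the given points. -/
def Input.HasColorableCover (I : Input) (c : ℕ) : Prop :=
  ∃ (S : Set (Fin I.m)) (χ : Fin I.m → ℕ), I.IsColoredCover c S χ

/-! ### The parameters attached to a grid width -/

/-- The approximation factor for grid width `τ` (used for `1 ≤ τ ≤ 5` only). -/
def rho (τ : ℝ) : ℕ :=
  if 2 ≤ τ then 4 else if 8 / 5 ≤ τ then 6 else if √2 ≤ τ then 7 else 9

/-- The closed grid cell `[0, τ] × [0, τ]`. -/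
def cell (τ : ℝ) : Set Plane := {z | ∀ i, 0 ≤ z i ∧ z i ≤ τ}

/-- `a` is the largest number of pairwise disjoint unit disks that all meet a `τ × τ` cell. -/
def IsPackingNumber (τ : ℝ) (a : ℕ) : Prop :=
  IsGreatest {c : ℕ | ∃ S : Finset Plane, S.card = c ∧ (S : Set Plane).PairwiseDisjoint unitDisk ∧
    ∀ z ∈ S, (unitDisk z ∩ cell τ).Nonempty} a

/-- The grid widths at which the exponent has a tabulated value. -/
def Tabulated (τ : ℝ) : Prop :=
  τ = 1 ∨ (√2 ≤ τ ∧ τ ≤ 8 / 5) ∨ τ = 2 ∨ τ = 3 ∨ τ = 4 ∨ τ = 5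

/-- `a` is the exponent for grid width `τ`: the tabulated value where there is one, and the packing
number of the `τ × τ` cell at the remaining widths. -/
def IsExponent (τ : ℝ) (a : ℕ) : Prop :=
  (τ = 1 ∧ a = 4) ∨ (√2 ≤ τ ∧ τ ≤ 8 / 5 ∧ a = 5) ∨ (τ = 2 ∧ a = 7) ∨ (τ = 3 ∧ a = 10) ∨
  (τ = 4 ∧ a = 14) ∨ (τ = 5 ∧ a = 17) ∨ (¬ Tabulated τ ∧ IsPackingNumber τ a)

/-! ### The real RAM

Programs work on integer and real variables and on integer and real arrays with random access; a
program is a finite object and so mentions finitely many of them. Every instruction and every test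
takes one unit of time. The integers (natural numbers) can be added, subtracted and compared; the
reals can be added, subtracted, multiplied, divided and compared. There are no roots, no rounding,
and no other passage from reals to integers than a comparison. -/

/-- The contents of the memory: variables, and arrays `name ↦ index ↦ entry`. -/
structure Store where
  intVar : ℕ → ℕ
  realVar : ℕ → ℝ
  intArr : ℕ → ℕ → ℕ
  realArr : ℕ → ℕ → ℝ

/-- Elementary instructions; the first argument is the target, except in the two `Store`
instructions. -/
inductive Instr
  | intConst (x c : ℕ)
  | intAdd (x y z : ℕ)
  | intSub (x y z : ℕ)
  | intLoad (x a i : ℕ)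
  | intStore (a i y : ℕ)
  | realConst (x : ℕ) (c : ℚ)
  | realAdd (x y z : ℕ)
  | realSub (x y z : ℕ)
  | realMul (x y z : ℕ)
  | realDiv (x y z : ℕ)
  | realLoad (x a i : ℕ)
  | realStore (a i y : ℕ)

/-- Overwrite the entry of array `a` at index `i`. -/
def setEntry {β : Type} (A : ℕ → ℕ → β) (a i : ℕ) (v : β) : ℕ → ℕ → β :=
  Function.update A a (Function.update (A a) i v)

/-- The effect of an instruction. Subtraction of integers is truncated at `0`; division by `0`
gives `0`. -/
def Instr.exec (σ : Store) : Instr → Store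
  | .intConst x c => { σ with intVar := Function.update σ.intVar x c }
  | .intAdd x y z => { σ with intVar := Function.update σ.intVar x (σ.intVar y + σ.intVar z) }
  | .intSub x y z => { σ with intVar := Function.update σ.intVar x (σ.intVar y - σ.intVar z) }
  | .intLoad x a i => { σ with intVar := Function.update σ.intVar x (σ.intArr a (σ.intVar i)) }
  | .intStore a i y => { σ with intArr := setEntry σ.intArr a (σ.intVar i) (σ.intVar y) }
  | .realConst x c => { σ with realVar := Function.update σ.realVar x (c : ℝ) }
  | .realAdd x y z => { σ with realVar := Function.update σ.realVar x (σ.realVar y + σ.realVar z) }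
  | .realSub x y z => { σ with realVar := Function.update σ.realVar x (σ.realVar y - σ.realVar z) }
  | .realMul x y z => { σ with realVar := Function.update σ.realVar x (σ.realVar y * σ.realVar z) }
  | .realDiv x y z => { σ with realVar := Function.update σ.realVar x (σ.realVar y / σ.realVar z) }
  | .realLoad x a i => { σ with realVar := Function.update σ.realVar x (σ.realArr a (σ.intVar i)) }
  | .realStore a i y => { σ with realArr := setEntry σ.realArr a (σ.intVar i) (σ.realVar y) }

/-- Tests on variables. -/
inductive Test
  | intLe (x y : ℕ)
  | realLe (x y : ℕ)

def Test.Holds (σ : Store) : Test → Prop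
  | .intLe x y => σ.intVar x ≤ σ.intVar y
  | .realLe x y => σ.realVar x ≤ σ.realVar y

/-- Programs. -/
inductive Prog
  | instr (i : Instr)
  | seq (p q : Prog)
  | ite (b : Test) (p q : Prog)
  | loop (b : Test) (p : Prog)

/-- `Runs p σ t σ'`: started in `σ`, the program `p` halts in `σ'` after exactly `t` steps.
`loop b p` repeats `p` while `b` holds. -/
inductive Runs : Prog → Store → ℕ → Store → Prop
  | instr (i : Instr) (σ : Store) : Runs (.instr i) σ 1 (i.exec σ)
  | seq {p q : Prog} {σ σ₁ σ₂ : Store} {t u : ℕ} :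
      Runs p σ t σ₁ → Runs q σ₁ u σ₂ → Runs (.seq p q) σ (t + u) σ₂
  | iteTrue {b : Test} {p q : Prog} {σ σ₁ : Store} {t : ℕ} :
      b.Holds σ → Runs p σ t σ₁ → Runs (.ite b p q) σ (t + 1) σ₁
  | iteFalse {b : Test} {p q : Prog} {σ σ₁ : Store} {t : ℕ} :
      ¬ b.Holds σ → Runs q σ t σ₁ → Runs (.ite b p q) σ (t + 1) σ₁
  | loopDone {b : Test} {p : Prog} {σ : Store} :
      ¬ b.Holds σ → Runs (.loop b p) σ 1 σ
  | loopStep {b : Test} {p : Prog} {σ σ₁ σ₂ : Store} {t u : ℕ} :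
      b.Holds σ → Runs p σ t σ₁ → Runs (.loop b p) σ₁ u σ₂ → Runs (.loop b p) σ (t + u + 1) σ₂

/-- Coordinate `i` of a finite sequence of points, continued by zeros. -/
def coords {r : ℕ} (f : Fin r → Plane) (i : Fin 2) (j : ℕ) : ℝ :=
  if h : j < r then f ⟨j, h⟩ i else 0

/-- The initial store on grid width `τ` and input `I`: integer variables `0, 1, 2` hold `n, m, k`,
real variable `0` holds `τ`, real arrays `0, 1` hold the coordinates of the points, and real arrays
`2, 3` those of the centres. Everything else is `0`. -/
def initStore (τ : ℝ) (I : Input) : Store where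
  intVar x := if x = 0 then I.n else if x = 1 then I.m else if x = 2 then I.k else 0
  realVar x := if x = 0 then τ else 0
  intArr _ _ := 0
  realArr a :=
    if a = 0 then coords I.point 0 else if a = 1 then coords I.point 1
    else if a = 2 then coords I.center 0 else if a = 3 then coords I.center 1 else fun _ => 0

/-- The colour of disk `j` as read off integer array `0` of the final store. -/
def outColor (I : Input) (σ : Store) (j : Fin I.m) : ℕ := σ.intArr 0 j

/-- The disks selected in the final store: those with a nonzero colour. -/
def outDisks (I : Input) (σ : Store) : Set (Fin I.m) := {j | outColor I σ j ≠ 0}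

end CDUDC

end

/-!
For the factors `4` and `9` the plane is cut into horizontal strips of height `4 / 3` and `1 / 2`,
respectively, each starting at the lowest point above the previous one. The strips use `4` or `9`
classes of `k` colours cyclically, so that disks of the same class which serve different strips are
too far apart to intersect. A cover of all points restricts to a cover of the points in any one
strip, so each strip can be covered with `k` colours.

To find such a cover, the strip is swept from left to right. Pairwise disjoint unit disks that meet
the strip are so spread out that, once the sweep has passed a point, only the latest four (in the
lower strips three) disks of a colour can still contain it. Hence a partial solution may be
forgotten up to its latest disks of each colour, and a search through a queue that discards states
met before treats at most `(m + 1) ^ (4 k)`, respectively `(m + 1) ^ (3 k)`, states; a state is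
looked up in a table by reading it as a number. Trying all `m k` extensions of a state takes time
`O(m k ^ 2)` per point. If `m ≤ k`, every disk gets a colour of its own; otherwise
`m k ^ 2 ≤ 2 m ^ k` and `(1 + 1 / m) ^ k < 3`, which leaves the exponents `5 k` and `4 k`, and these
are at most `α k`. Each strip uses up a constant part of the vertical extent of a disk that contains
its lowest point, so there are only `O(m)` strips.
-/

noncomputable section

namespace CDUDC

/-! ### Points at distance more than `2` in a strip -/

/-- The squared Euclidean distance. The machine has no square roots, so all distances are compared
through their squares. -/
def sqDist (p q : ℝ × ℝ) : ℝ := (p.1 - q.1) * (p.1 - q.1) + (p.2 - q.2) * (p.2 - q.2)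

lemma sqDist_comm (p q : ℝ × ℝ) : sqDist p q = sqDist q p := by
  unfold sqDist; ring

lemma fst_sub_mul_self_le_sqDist (p q : ℝ × ℝ) : (p.1 - q.1) * (p.1 - q.1) ≤ sqDist p q :=
  le_add_of_nonneg_right (mul_self_nonneg _)

lemma snd_sub_mul_self_le_sqDist (p q : ℝ × ℝ) : (p.2 - q.2) * (p.2 - q.2) ≤ sqDist p q :=
  le_add_of_nonneg_left (mul_self_nonneg _)

lemma lt_sqDist_of_lt_fst_sub {p q : ℝ × ℝ} {c : ℝ} (hc : 0 ≤ c) (h : c < p.1 - q.1) :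
    c * c < sqDist p q :=
  (mul_self_lt_mul_self hc h).trans_le (fst_sub_mul_self_le_sqDist p q)

lemma abs_fst_sub_le_one {p q : ℝ × ℝ} (h : sqDist p q ≤ 1) : |p.1 - q.1| ≤ 1 :=
  abs_le_one_iff_mul_self_le_one.2 ((fst_sub_mul_self_le_sqDist p q).trans h)

lemma abs_snd_sub_le_one {p q : ℝ × ℝ} (h : sqDist p q ≤ 1) : |p.2 - q.2| ≤ 1 :=
  abs_le_one_iff_mul_self_le_one.2 ((snd_sub_mul_self_le_sqDist p q).trans h)

lemma lt_of_lt_mul_self_add_mul_self {a b c e r : ℝ} (h : r < a * a + b * b) (hb : |b| ≤ c)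
    (ha : 0 ≤ a) (hce : e * e + c * c ≤ r) : e < a := by
  have hbc : b * b ≤ c * c := abs_le_iff_mul_self_le.1 (hb.trans (le_abs_self c))
  by_contra! h'
  linarith [mul_self_le_mul_self ha h']

lemma abs_sub_le_of_same_half {lo w y v : ℝ} (hy : y ∈ Set.Icc lo (lo + 2 * w))
    (hv : v ∈ Set.Icc lo (lo + 2 * w)) (h : y ≤ lo + w ↔ v ≤ lo + w) : |y - v| ≤ w := by
  rw [abs_le]
  rcases le_or_gt y (lo + w) with hyw | hyw
  · constructor <;> linarith [hy.1, hv.1, h.1 hyw]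
  · constructor <;> linarith [hy.2, hv.2, not_le.1 (mt h.2 hyw.not_ge)]

lemma one_lt_fst_sub_of_same_half {lo w : ℝ} (hw : w ≤ 5 / 3) {p q : ℝ × ℝ}
    (hfar : 4 < sqDist p q) (hqp : q.1 ≤ p.1) (hp : p.2 ∈ Set.Icc lo (lo + 2 * w))
    (hq : q.2 ∈ Set.Icc lo (lo + 2 * w)) (hhalf : p.2 ≤ lo + w ↔ q.2 ≤ lo + w) :
    1 < p.1 - q.1 :=
  lt_of_lt_mul_self_add_mul_self (c := 5 / 3) hfar ((abs_sub_le_of_same_half hp hq hhalf).trans hw)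
    (sub_nonneg.2 hqp) (by norm_num)

lemma two_lt_fst_sub_of_three_same_half {lo w : ℝ} (hw : w ≤ 5 / 3) {N : ℕ} {c : Fin N → ℝ × ℝ}
    (hsorted : ∀ i j, i ≤ j → (c j).1 ≤ (c i).1)
    (hstrip : ∀ i, (c i).2 ∈ Set.Icc lo (lo + 2 * w)) {i j l : Fin N} (hij : i < j) (hjl : j < l)
    (hfarij : 4 < sqDist (c i) (c j)) (hfarjl : 4 < sqDist (c j) (c l))
    (hhalfij : (c i).2 ≤ lo + w ↔ (c j).2 ≤ lo + w)
    (hhalfjl : (c j).2 ≤ lo + w ↔ (c l).2 ≤ lo + w) : 2 < (c i).1 - (c l).1 := by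
  have hij' := one_lt_fst_sub_of_same_half hw hfarij (hsorted i j hij.le) (hstrip i) (hstrip j)
    hhalfij
  have hjl' := one_lt_fst_sub_of_same_half hw hfarjl (hsorted j l hjl.le) (hstrip j) (hstrip l)
    hhalfjl
  linarith

lemma exists_three_eq_of_five (f : Fin 5 → Bool) :
    ∃ i j l, i < j ∧ j < l ∧ f i = f j ∧ f j = f l := by
  revert f; decide

lemma exists_three_eq_or_two_and_two (f : Fin 4 → Bool) :
    (∃ i j l, i < j ∧ j < l ∧ f i = f j ∧ f j = f l) ∨
      ∃ r u v, r < 3 ∧ u < v ∧ v < 3 ∧ f r = f 3 ∧ f u ≠ f 3 ∧ f v ≠ f 3 := by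
  revert f; decide

/-- The first and the last of the points need not be far from each other: three points in the same
half of the strip give the bound, and they only involve two consecutive gaps. -/
lemma two_lt_fst_sub_of_five {lo : ℝ} {c : Fin 5 → ℝ × ℝ}
    (hsorted : ∀ i j, i ≤ j → (c j).1 ≤ (c i).1)
    (hstrip : ∀ i, (c i).2 ∈ Set.Icc lo (lo + 10 / 3))
    (hfar : ∀ i j, i < j → (i = 0 → j ≠ 4) → 4 < sqDist (c i) (c j)) : 2 < (c 0).1 - (c 4).1 := by
  obtain ⟨i, j, l, hij, hjl, hi, hj⟩ :=
    exists_three_eq_of_five fun i => decide ((c i).2 ≤ lo + 5 / 3)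
  have hstrip' : ∀ i, (c i).2 ∈ Set.Icc lo (lo + 2 * (5 / 3)) := fun i => by
    convert hstrip i using 3; norm_num
  have hgap := two_lt_fst_sub_of_three_same_half le_rfl hsorted hstrip' hij hjl
    (hfar i j hij (by omega)) (hfar j l hjl (by omega)) (decide_eq_decide.1 hi)
    (decide_eq_decide.1 hj)
  linarith [hsorted 0 i (Fin.zero_le i), hsorted l 4 (Fin.le_last l)]

/-- Bootstrapping: `q` and `r` span almost the whole width `2`, and so do `v` and `u`; hence `v` is
almost above `q`, and `u` almost above `r`, which pushes `q` and `r` down to the bottom. -/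
lemma one_lt_sqDist_of_corner {lo : ℝ} {p q r u v : ℝ × ℝ} (hp : lo ≤ p.2)
    (hq : p.1 - 1 ≤ q.1) (hqr : q.1 ≤ r.1) (hqv : q.1 ≤ v.1) (hvu : v.1 ≤ u.1)
    (hr : r.1 ≤ p.1 + 1) (hu : u.1 ≤ p.1 + 1)
    (hqy : q.2 ∈ Set.Icc (lo - 1) (lo + 1 / 4)) (hry : r.2 ∈ Set.Icc (lo - 1) (lo + 1 / 4))
    (huy : u.2 ∈ Set.Icc (lo + 1 / 4) (lo + 3 / 2)) (hvy : v.2 ∈ Set.Icc (lo + 1 / 4) (lo + 3 / 2))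
    (hfarqr : 4 < sqDist q r) (hfaruv : 4 < sqDist u v) (hfarqv : 4 < sqDist q v)
    (hfarru : 4 < sqDist r u) : 1 < sqDist q p := by
  obtain ⟨hq₁, hq₂⟩ := hqy
  obtain ⟨hr₁, hr₂⟩ := hry
  obtain ⟨hu₁, hu₂⟩ := huy
  obtain ⟨hv₁, hv₂⟩ := hvy
  rw [sqDist_comm, sqDist] at hfarqr hfarqv hfarru ⊢
  rw [sqDist] at hfaruv
  have hwide_qr : 39 / 25 < r.1 - q.1 :=
    lt_of_lt_mul_self_add_mul_self (c := 5 / 4) hfarqr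
      (abs_le.2 ⟨by linarith, by linarith⟩) (by linarith) (by norm_num)
  have hwide_uv : 39 / 25 < u.1 - v.1 :=
    lt_of_lt_mul_self_add_mul_self (c := 5 / 4) hfaruv
      (abs_le.2 ⟨by linarith, by linarith⟩) (by linarith) (by norm_num)
  have hhigh_v : 39 / 20 < v.2 - q.2 :=
    lt_of_lt_mul_self_add_mul_self (r := 4) (c := 11 / 25) (by linarith)
      (abs_le.2 ⟨by linarith, by linarith⟩ : |v.1 - q.1| ≤ _) (by linarith) (by norm_num)
  have hhigh_u : 39 / 20 < u.2 - r.2 :=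
    lt_of_lt_mul_self_add_mul_self (r := 4) (c := 11 / 25) (by linarith)
      (abs_le.2 ⟨by linarith, by linarith⟩ : |u.1 - r.1| ≤ _) (by linarith) (by norm_num)
  have hwider_qr : 48 / 25 < r.1 - q.1 :=
    lt_of_lt_mul_self_add_mul_self (c := 11 / 20) hfarqr
      (abs_le.2 ⟨by linarith, by linarith⟩) (by linarith) (by norm_num)
  have hx : (23 / 25 : ℝ) * (23 / 25) ≤ (p.1 - q.1) * (p.1 - q.1) :=
    mul_self_le_mul_self (by norm_num) (by linarith)
  have hy : (9 / 20 : ℝ) * (9 / 20) ≤ (p.2 - q.2) * (p.2 - q.2) :=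
    mul_self_le_mul_self (by norm_num) (by linarith)
  linarith

lemma sqDist_neg_snd (p q : ℝ × ℝ) : sqDist (p.1, -p.2) (q.1, -q.2) = sqDist p q := by
  simp only [sqDist]; ring

/-- Three points in the same half of the strip would be spread over a width of more than `2`. So
there are two in either half, and the leftmost point is in a corner. -/
lemma one_lt_sqDist_of_four {lo : ℝ} {p : ℝ × ℝ} {c : Fin 4 → ℝ × ℝ}
    (hsorted : ∀ i j, i ≤ j → (c j).1 ≤ (c i).1)
    (hstrip : ∀ i, (c i).2 ∈ Set.Icc (lo - 1) (lo + 3 / 2))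
    (hfar : ∀ i j, i < j → 4 < sqDist (c i) (c j)) (hx : (c 0).1 ≤ p.1 + 1)
    (hp : p.2 ∈ Set.Icc lo (lo + 1 / 2)) : 1 < sqDist (c 3) p := by
  by_contra! hcov
  refine hcov.not_gt ?_
  have hleft : p.1 - 1 ≤ (c 3).1 := by linarith [(abs_le.1 (abs_fst_sub_le_one hcov)).1]
  have hfar' : ∀ i j, i ≠ j → 4 < sqDist (c i) (c j) := fun i j hij =>
    hij.lt_or_gt.elim (hfar i j) fun h => sqDist_comm (c i) (c j) ▸ hfar j i h
  have hright : ∀ i, (c i).1 ≤ p.1 + 1 := fun i => (hsorted 0 i (Fin.zero_le i)).trans hx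
  have hstrip' : ∀ i, (c i).2 ∈ Set.Icc (lo - 1) (lo - 1 + 2 * (5 / 4)) := fun i => by
    convert hstrip i using 2; ring
  rcases exists_three_eq_or_two_and_two fun i => decide ((c i).2 ≤ lo - 1 + 5 / 4) with
    ⟨i, j, l, hij, hjl, hi, hj⟩ | ⟨r, u, v, hr, huv, hv, hr3, hu3, hv3⟩
  · have := two_lt_fst_sub_of_three_same_half (by norm_num) hsorted hstrip' hij hjl (hfar i j hij)
      (hfar j l hjl) (decide_eq_decide.1 hi) (decide_eq_decide.1 hj)
    linarith [hright i, hsorted l 3 (Fin.le_last l)]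
  · simp only [decide_eq_decide, ne_eq] at hr3 hu3 hv3
    have hne : u ≠ r := by rintro rfl; exact hu3 hr3
    by_cases h3 : (c 3).2 ≤ lo - 1 + 5 / 4
    · simp only [h3, iff_true, not_le] at hr3 hu3 hv3
      exact one_lt_sqDist_of_corner hp.1 hleft (hsorted r 3 hr.le) (hsorted v 3 hv.le)
        (hsorted u v huv.le) (hright r) (hright u) ⟨(hstrip 3).1, by linarith⟩
        ⟨(hstrip r).1, by linarith⟩ ⟨by linarith, (hstrip u).2⟩ ⟨by linarith, (hstrip v).2⟩
        (hfar' 3 r hr.ne') (hfar u v huv) (hfar' 3 v hv.ne') (hfar' r u hne.symm)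
    · simp only [h3, iff_false, not_le] at hr3 hu3 hv3
      rw [← sqDist_neg_snd]
      exact one_lt_sqDist_of_corner (lo := -(lo + 1 / 2)) (r := ((c r).1, -(c r).2))
        (u := ((c u).1, -(c u).2)) (v := ((c v).1, -(c v).2)) (neg_le_neg hp.2) hleft
        (hsorted r 3 hr.le) (hsorted v 3 hv.le) (hsorted u v huv.le) (hright r) (hright u)
        ⟨by linarith [(hstrip 3).2], by linarith⟩ ⟨by linarith [(hstrip r).2], by linarith⟩
        ⟨by linarith, by linarith [(hstrip u).1]⟩ ⟨by linarith, by linarith [(hstrip v).1]⟩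
        (by rw [sqDist_neg_snd]; exact hfar' 3 r hr.ne')
        (by rw [sqDist_neg_snd]; exact hfar u v huv)
        (by rw [sqDist_neg_snd]; exact hfar' 3 v hv.ne')
        (by rw [sqDist_neg_snd]; exact hfar' r u hne.symm)

/-! ### Sorted lists of points in a strip -/

lemma four_lt_sqDist_of_four_lt_take_three {lo : ℝ} {d : ℝ × ℝ} {l : List (ℝ × ℝ)}
    (hsorted : (d :: l).Pairwise fun a b => b.1 ≤ a.1)
    (hfar : l.Pairwise fun a b => 4 < sqDist a b)
    (hstrip : ∀ a ∈ d :: l, a.2 ∈ Set.Icc lo (lo + 10 / 3))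
    (htake : ∀ a ∈ l.take 3, 4 < sqDist d a) : ∀ a ∈ l, 4 < sqDist d a := by
  match l with
  | [] => simp
  | [_] | [_, _] => simpa using htake
  | a :: b :: c :: l =>
    simp only [List.pairwise_cons, List.mem_cons, forall_eq_or_imp, List.take_succ_cons,
      List.take_zero, List.not_mem_nil, false_imp_iff, implies_true, and_true] at *
    refine ⟨htake.1, htake.2.1, htake.2.2, fun e he => ?_⟩
    have hwide : 2 < d.1 - e.1 :=
      two_lt_fst_sub_of_five (c := ![d, a, b, c, e]) (lo := lo)
        (by simp [Fin.forall_fin_succ, hsorted, he])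
        (fun i => by
          fin_cases i
          exacts [hstrip.1, hstrip.2.1, hstrip.2.2.1, hstrip.2.2.2.1, hstrip.2.2.2.2 e he])
        (by simp [Fin.forall_fin_succ, hfar, htake, he])
    linarith [lt_sqDist_of_lt_fst_sub zero_le_two hwide]

lemma one_lt_sqDist_of_mem_drop_three {lo : ℝ} {p : ℝ × ℝ} {l : List (ℝ × ℝ)}
    (hsorted : l.Pairwise fun a b => b.1 ≤ a.1) (hfar : l.Pairwise fun a b => 4 < sqDist a b)
    (hstrip : ∀ a ∈ l, a.2 ∈ Set.Icc (lo - 1) (lo + 3 / 2)) (hx : ∀ a ∈ l, a.1 ≤ p.1 + 1)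
    (hp : p.2 ∈ Set.Icc lo (lo + 1 / 2)) : ∀ e ∈ l.drop 3, 1 < sqDist e p := by
  match l with
  | [] | [_] | [_, _] => simp
  | a :: b :: c :: l =>
    intro e he
    simp only [List.pairwise_cons, List.mem_cons, forall_eq_or_imp, List.drop_succ_cons,
      List.drop_zero] at *
    exact one_lt_sqDist_of_four (c := ![a, b, c, e]) (lo := lo)
      (by simp [Fin.forall_fin_succ, hsorted, he])
      (fun i => by
        fin_cases i
        exacts [hstrip.1, hstrip.2.1, hstrip.2.2.1, hstrip.2.2.2 e he])
      (by simp [Fin.forall_fin_succ, hfar, he]) hx.1 hp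

lemma one_lt_sqDist_of_mem_drop_four {lo : ℝ} {p : ℝ × ℝ} {l : List (ℝ × ℝ)}
    (hsorted : l.Pairwise fun a b => b.1 ≤ a.1) (hfar : l.Pairwise fun a b => 4 < sqDist a b)
    (hstrip : ∀ a ∈ l, a.2 ∈ Set.Icc lo (lo + 10 / 3)) (hx : ∀ a ∈ l, a.1 ≤ p.1 + 1) :
    ∀ e ∈ l.drop 4, 1 < sqDist e p := by
  match l with
  | [] | [_] | [_, _] | [_, _, _] => simp
  | a :: b :: c :: d :: l =>
    intro e he
    simp only [List.pairwise_cons, List.mem_cons, forall_eq_or_imp, List.drop_succ_cons,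
      List.drop_zero] at *
    have hwide : 2 < a.1 - e.1 :=
      two_lt_fst_sub_of_five (c := ![a, b, c, d, e]) (lo := lo)
        (by simp [Fin.forall_fin_succ, hsorted, he])
        (fun i => by
          fin_cases i
          exacts [hstrip.1, hstrip.2.1, hstrip.2.2.1, hstrip.2.2.2.1, hstrip.2.2.2.2 e he])
        (by simp [Fin.forall_fin_succ, hfar, he])
    rw [sqDist_comm]
    linarith [lt_sqDist_of_lt_fst_sub zero_le_one (show 1 < p.1 - e.1 by linarith [hx.1])]

/-! ### Sweeping a strip -/

/-- A partial solution of a strip: the chosen pairs (disk, colour), the latest first. The disks are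
chosen from left to right. -/
abbrev PartialSolution : Type := List (ℕ × ℕ)

/-- The problem solved by one sweep: the points in the strip `lo ≤ y ≤ lo + height` are to be
covered by disks `d < m` with centres `(X d, Y d)` and colours `j < k`, where the sweep remembers
the `depth` latest disks of each colour. The index `m` is a dummy disk far to the left. -/
structure Strip where
  k : ℕ
  m : ℕ
  depth : ℕ
  X : ℕ → ℝ
  Y : ℕ → ℝ
  lo : ℝ
  height : ℝ
  points : Set (ℝ × ℝ)

namespace Strip

/-- The disks of colour `j`, the latest first. -/
def ofColor (s : PartialSolution) (j : ℕ) : List ℕ := (s.filter fun q => q.2 = j).map Prod.fst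

variable (G : Strip)

/-- The centre of disk `d`, also where `d` is the dummy disk. -/
def center (d : ℕ) : ℝ × ℝ := (G.X d, G.Y d)

/-- The remembered disk of colour `j` at place `t`, and the dummy disk where there is none. -/
def slot (s : PartialSolution) (j t : ℕ) : ℕ :=
  if t < G.depth then (ofColor s j).getD t G.m else G.m

/-- What the sweep remembers of a partial solution, as one sequence with four slots for each
colour. -/
def memory (s : PartialSolution) (i : ℕ) : ℕ := G.slot s (i / 4) (i % 4)

/-- Two partial solutions between which the sweep does not distinguish. -/
def SameMemory (s t : PartialSolution) : Prop := ∀ i < 4 * G.k, G.memory s i = G.memory t i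

/-- The rightmost disk, which gives the position of the sweep. -/
def latest (s : PartialSolution) : ℕ := (s.map Prod.fst).headD G.m

/-- The remembered disks cover all points that are within reach of the current disk but out of
reach of any disk at or beyond abscissa `x`. -/
def CoveredBefore (s : PartialSolution) (x : ℝ) : Prop :=
  ∀ p ∈ G.points, G.X (G.latest s) ≤ p.1 + 1 → p.1 + 1 < x →
    ∃ i < 4 * G.k, sqDist (G.center (G.memory s i)) p ≤ 1

/-- The pair (disk, colour) may occur in a solution of the strip at all. -/
structure Eligible (q : ℕ × ℕ) : Prop where
  disk : q.1 < G.m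
  color : q.2 < G.k
  low : G.lo - 1 ≤ G.Y q.1
  high : G.Y q.1 ≤ G.lo + G.height + 1

/-- The sweep may extend `s` by disk `d` with colour `j`. This depends on the memory of `s` only. -/
structure Allowed (s : PartialSolution) (d j : ℕ) : Prop extends G.Eligible (d, j) where
  right : G.X (G.latest s) ≤ G.X d
  covered : G.CoveredBefore s (G.X d)
  far : ∀ t < 4, 4 < sqDist (G.center (G.slot s j t)) (G.center d)

/-- The partial solutions that the sweep can build. -/
inductive Reachable : PartialSolution → Prop
  | nil : Reachable []
  | cons {s : PartialSolution} {d j : ℕ} : Reachable s → G.Allowed s d j → Reachable ((d, j) :: s)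

/-- A family of eligible disks, listed from right to left, in which the disks of each colour are
pairwise disjoint. -/
structure IsSweep (s : PartialSolution) : Prop where
  eligible : ∀ q ∈ s, G.Eligible q
  sorted : s.Pairwise fun a b => G.X b.1 ≤ G.X a.1
  far : s.Pairwise fun a b => a.2 = b.2 → 4 < sqDist (G.center a.1) (G.center b.1)

/-- A solution of the strip, listed from right to left. -/
structure Solves (s : PartialSolution) : Prop extends G.IsSweep s where
  covers : ∀ p ∈ G.points, ∃ q ∈ s, sqDist (G.center q.1) p ≤ 1

/-- What is assumed of the parameters. The two pairs of depth and height are those for which the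
memory suffices; `B` bounds all abscissae, so that the dummy disk reaches nothing. -/
structure Admissible (B : ℝ) : Prop where
  k_pos : 1 ≤ G.k
  depth_height : (G.depth = 3 ∧ G.height = 1 / 2) ∨ (G.depth = 4 ∧ G.height = 4 / 3)
  dummy : G.X G.m = -B
  left : ∀ d < G.m, -B + 10 ≤ G.X d
  points_left : ∀ p ∈ G.points, -B + 10 ≤ p.1
  points_right : ∀ p ∈ G.points, p.1 + 10 ≤ B
  points_low : ∀ p ∈ G.points, G.lo ≤ p.2
  points_high : ∀ p ∈ G.points, p.2 ≤ G.lo + G.height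

variable {G} {B : ℝ} {s s' : PartialSolution} {p : ℝ × ℝ}

lemma Admissible.three_le_depth (hG : G.Admissible B) : 3 ≤ G.depth := by
  rcases hG.depth_height with h | h <;> omega

lemma Admissible.depth_le_four (hG : G.Admissible B) : G.depth ≤ 4 := by
  rcases hG.depth_height with h | h <;> omega

lemma Admissible.height_le (hG : G.Admissible B) : G.height ≤ 4 / 3 := by
  rcases hG.depth_height with h | h <;> norm_num [h.2]

lemma Admissible.one_lt_sqDist_dummy (hG : G.Admissible B) (hp : p ∈ G.points) :
    1 < sqDist (G.center G.m) p := by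
  rw [sqDist_comm, ← one_mul 1]
  exact lt_sqDist_of_lt_fst_sub zero_le_one
    (by simp only [center, hG.dummy]; linarith [hG.points_left p hp])

lemma Admissible.four_lt_sqDist_dummy (hG : G.Admissible B) {d : ℕ} (hd : d < G.m) :
    4 < sqDist (G.center G.m) (G.center d) := by
  rw [sqDist_comm, show (4 : ℝ) = 2 * 2 by norm_num]
  exact lt_sqDist_of_lt_fst_sub zero_le_two
    (by simp only [center, hG.dummy]; linarith [hG.left d hd])

lemma mem_ofColor {j d : ℕ} : d ∈ ofColor s j ↔ (d, j) ∈ s := by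
  simp [ofColor]

lemma ofColor_cons (s : PartialSolution) (d j i : ℕ) :
    ofColor ((d, j) :: s) i = if i = j then d :: ofColor s i else ofColor s i := by
  by_cases h : i = j
  · simp [ofColor, h]
  · simp [ofColor, h, Ne.symm h]

lemma ofColor_pairwise {R : ℕ → ℕ → Prop} {j : ℕ}
    (h : s.Pairwise fun a b => a.2 = j → b.2 = j → R a.1 b.1) : (ofColor s j).Pairwise R := by
  unfold ofColor
  rw [List.pairwise_map, List.pairwise_filter]
  simpa using h

lemma slot_nil (j t : ℕ) : G.slot [] j t = G.m := by
  simp [slot, ofColor]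

lemma slot_of_lt_depth {j t : ℕ} (ht : t < G.depth) (hl : t < (ofColor s j).length) :
    G.slot s j t = (ofColor s j)[t] := by
  rw [slot, if_pos ht, List.getD_eq_getElem _ _ hl]

lemma slot_cons (s : PartialSolution) (d j i t : ℕ) :
    G.slot ((d, j) :: s) i t = if i = j then
      (if t < G.depth then (if t = 0 then d else G.slot s j (t - 1)) else G.m)
      else G.slot s i t := by
  unfold slot
  rw [ofColor_cons]
  by_cases h : i = j
  · subst h
    by_cases ht : t < G.depth
    · cases t with
      | zero => simp [ht]
      | succ t => simp [ht, show t < G.depth by omega]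
    · simp [ht]
  · simp [h]

lemma slot_mem {j t : ℕ} (h : G.slot s j t ≠ G.m) : (G.slot s j t, j) ∈ s := by
  rw [← mem_ofColor]
  unfold slot at h ⊢
  split_ifs at h ⊢ with ht
  · by_cases hl : t < (ofColor s j).length
    · rw [List.getD_eq_getElem _ _ hl]
      exact List.getElem_mem hl
    · exact absurd (List.getD_eq_default _ _ (not_lt.1 hl)) h
  · exact absurd rfl h

lemma memory_mul_add {j t : ℕ} (ht : t < 4) : G.memory s (4 * j + t) = G.slot s j t := by
  unfold memory
  rw [show (4 * j + t) / 4 = j by omega, show (4 * j + t) % 4 = t by omega]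

namespace IsSweep

lemma ofColor_sorted (hs : G.IsSweep s) (j : ℕ) :
    ((ofColor s j).map G.center).Pairwise fun a b => b.1 ≤ a.1 :=
  List.pairwise_map.2 (ofColor_pairwise (hs.sorted.imp fun h _ _ => h))

lemma ofColor_far (hs : G.IsSweep s) (j : ℕ) :
    ((ofColor s j).map G.center).Pairwise fun a b => 4 < sqDist a b :=
  List.pairwise_map.2 (ofColor_pairwise (hs.far.imp fun h ha hb => h (ha.trans hb.symm)))

lemma fst_le_latest (hs : G.IsSweep s) : ∀ q ∈ s, G.X q.1 ≤ G.X (G.latest s) := by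
  cases s with
  | nil => simp
  | cons a s =>
    intro q hq
    rcases List.mem_cons.1 hq with rfl | hq
    · exact le_rfl
    · exact (List.pairwise_cons.1 hs.sorted).1 q hq

lemma of_append {pre : PartialSolution} (hs : G.IsSweep (pre ++ s)) : G.IsSweep s where
  eligible q hq := hs.eligible q (List.mem_append_right _ hq)
  sorted := (List.pairwise_append.1 hs.sorted).2.1
  far := (List.pairwise_append.1 hs.far).2.1

/-- By then every later disk of the same colour lies near the vertical line through `p`, too, and
only few disjoint disks do. -/
lemma lt_depth_of_covers (hG : G.Admissible B) (hs : G.IsSweep s) (hp : p ∈ G.points)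
    (hx : ∀ q ∈ s, G.X q.1 ≤ p.1 + 1) {j i : ℕ} (hi : i < (ofColor s j).length)
    (hcover : sqDist (G.center (ofColor s j)[i]) p ≤ 1) : i < G.depth := by
  have hstrip : ∀ a ∈ (ofColor s j).map G.center,
      a.2 ∈ Set.Icc (G.lo - 1) (G.lo + G.height + 1) := by
    intro a ha
    obtain ⟨d, hd, rfl⟩ := List.mem_map.1 ha
    exact ⟨(hs.eligible _ (mem_ofColor.1 hd)).low, (hs.eligible _ (mem_ofColor.1 hd)).high⟩
  have hx' : ∀ a ∈ (ofColor s j).map G.center, a.1 ≤ p.1 + 1 := by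
    intro a ha
    obtain ⟨d, hd, rfl⟩ := List.mem_map.1 ha
    exact hx _ (mem_ofColor.1 hd)
  by_contra! hdepth
  have hdrop : G.center (ofColor s j)[i] ∈ ((ofColor s j).map G.center).drop G.depth := by
    rw [List.mem_drop_iff_getElem]
    exact ⟨i - G.depth, by simp; omega, by simp [Nat.add_sub_cancel' hdepth]⟩
  refine hcover.not_gt ?_
  rcases hG.depth_height with ⟨hd, hh⟩ | ⟨hd, hh⟩ <;> rw [hd] at hdrop <;> rw [hh] at hstrip
  · exact one_lt_sqDist_of_mem_drop_three (lo := G.lo) (hs.ofColor_sorted j) (hs.ofColor_far j)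
      (by convert hstrip using 4; ring) hx'
      ⟨hG.points_low p hp, hh ▸ hG.points_high p hp⟩ _ hdrop
  · exact one_lt_sqDist_of_mem_drop_four (lo := G.lo - 1) (hs.ofColor_sorted j) (hs.ofColor_far j)
      (by convert hstrip using 4; ring) hx' _ hdrop

lemma exists_memory_eq (hG : G.Admissible B) (hs : G.IsSweep s) (hp : p ∈ G.points)
    (hx : ∀ q ∈ s, G.X q.1 ≤ p.1 + 1) {q : ℕ × ℕ} (hq : q ∈ s)
    (hcover : sqDist (G.center q.1) p ≤ 1) : ∃ i < 4 * G.k, G.memory s i = q.1 := by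
  obtain ⟨d, j⟩ := q
  obtain ⟨t, ht, rfl⟩ := List.getElem_of_mem (mem_ofColor.2 hq)
  have htd := hs.lt_depth_of_covers hG hp hx ht hcover
  have ht4 := htd.trans_le hG.depth_le_four
  have hj : j < G.k := (hs.eligible _ hq).color
  exact ⟨4 * j + t, by omega, by rw [memory_mul_add ht4, slot_of_lt_depth htd ht]⟩

lemma cons {d j : ℕ} (hG : G.Admissible B) (hs : G.IsSweep s) (ha : G.Allowed s d j) :
    G.IsSweep ((d, j) :: s) where
  eligible q hq := by
    rcases List.mem_cons.1 hq with rfl | hq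
    exacts [ha.toEligible, hs.eligible q hq]
  sorted := List.pairwise_cons.2 ⟨fun q hq => (hs.fst_le_latest q hq).trans ha.right, hs.sorted⟩
  far := by
    refine List.pairwise_cons.2 ⟨?_, hs.far⟩
    rintro ⟨a, i⟩ hq (rfl : j = i)
    have hmem : ∀ c ∈ (d :: ofColor s j).map G.center, ∃ e,
        G.Eligible (e, j) ∧ G.X e ≤ G.X d ∧ G.center e = c := by
      simp only [List.map_cons, List.forall_mem_cons, List.forall_mem_map]
      exact ⟨⟨d, ha.toEligible, le_rfl, rfl⟩, fun e he => ⟨e, hs.eligible _ (mem_ofColor.1 he),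
        (hs.fst_le_latest _ (mem_ofColor.1 he)).trans ha.right, rfl⟩⟩
    refine four_lt_sqDist_of_four_lt_take_three (lo := G.lo - 1) (d := G.center d)
      (List.pairwise_cons.2 ⟨fun c hc => ?_, hs.ofColor_sorted j⟩) (hs.ofColor_far j)
      (fun c hc => ?_) (fun c hc => ?_) _ (List.mem_map_of_mem (mem_ofColor.2 hq))
    · obtain ⟨e, -, hx, rfl⟩ := hmem c (List.mem_cons_of_mem _ hc)
      exact hx
    · obtain ⟨e, he, -, rfl⟩ := hmem c hc
      exact ⟨he.low, he.high.trans (by linarith [hG.height_le])⟩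
    · obtain ⟨t, ht, rfl⟩ := List.mem_take_iff_getElem.1 hc
      simp only [List.length_map, lt_min_iff] at ht
      rw [List.getElem_map, sqDist_comm, ← slot_of_lt_depth (ht.1.trans_le hG.three_le_depth) ht.2]
      exact ha.far t (ht.1.trans_le (by norm_num))

end IsSweep

lemma Reachable.isSweep (hG : G.Admissible B) (h : G.Reachable s) : G.IsSweep s := by
  induction h with
  | nil => exact ⟨by simp, by simp, by simp⟩
  | cons _ ha ih => exact ih.cons hG ha

lemma Reachable.slot_le (hG : G.Admissible B) (h : G.Reachable s) (j t : ℕ) :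
    G.slot s j t ≤ G.m := by
  by_cases hs : G.slot s j t = G.m
  · exact hs.le
  · exact ((h.isSweep hG).eligible _ (slot_mem hs)).disk.le

lemma CoveredBefore.exists_mem (hG : G.Admissible B) {x : ℝ} (h : G.CoveredBefore s x)
    (hp : p ∈ G.points) (hle : G.X (G.latest s) ≤ p.1 + 1) (hlt : p.1 + 1 < x) :
    ∃ q ∈ s, sqDist (G.center q.1) p ≤ 1 := by
  obtain ⟨i, -, hi⟩ := h p hp hle hlt
  refine ⟨_, slot_mem (t := i % 4) (j := i / 4) fun hm => ?_, hi⟩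
  unfold memory at hi
  rw [hm] at hi
  exact hi.not_gt (hG.one_lt_sqDist_dummy hp)

lemma Reachable.covers_of_lt_latest (hG : G.Admissible B) (h : G.Reachable s) (hp : p ∈ G.points)
    (hx : p.1 + 1 < G.X (G.latest s)) : ∃ q ∈ s, sqDist (G.center q.1) p ≤ 1 := by
  induction h with
  | nil =>
    simp only [latest, List.map_nil, List.headD_nil, hG.dummy] at hx
    linarith [hG.points_left p hp]
  | @cons s d j _ ha ih =>
    obtain ⟨q, hq, hc⟩ := (lt_or_ge (p.1 + 1) (G.X (G.latest s))).elim ih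
      fun h => ha.covered.exists_mem hG hp h hx
    exact ⟨q, List.mem_cons_of_mem _ hq, hc⟩

lemma Reachable.covers (hG : G.Admissible B) (h : G.Reachable s) (hB : G.CoveredBefore s B)
    (hp : p ∈ G.points) : ∃ q ∈ s, sqDist (G.center q.1) p ≤ 1 :=
  (lt_or_ge (p.1 + 1) (G.X (G.latest s))).elim (h.covers_of_lt_latest hG hp)
    fun h' => hB.exists_mem hG hp h' (by linarith [hG.points_right p hp])

namespace Solves

variable {pre : PartialSolution}

lemma coveredBefore (hG : G.Admissible B) {x : ℝ} (h : G.Solves (pre ++ s))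
    (hpre : ∀ q ∈ pre, x ≤ G.X q.1) : G.CoveredBefore s x := by
  intro p hp hle hlt
  obtain ⟨q, hq, hc⟩ := h.covers p hp
  have hqx : G.X q.1 - p.1 ≤ 1 := (abs_le.1 (abs_fst_sub_le_one hc)).2
  have hqs : q ∈ s := by
    rcases List.mem_append.1 hq with hq | hq
    · linarith [hpre q hq]
    · exact hq
  obtain ⟨i, hi, hiq⟩ := h.toIsSweep.of_append.exists_memory_eq hG hp
    (fun q hq => (h.toIsSweep.of_append.fst_le_latest q hq).trans hle) hqs hc
  exact ⟨i, hi, by rwa [hiq]⟩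

lemma allowed (hG : G.Admissible B) {d j : ℕ} (h : G.Solves (pre ++ (d, j) :: s)) :
    G.Allowed s d j := by
  have hsweep := h.toIsSweep.of_append
  have heligible := hsweep.eligible (d, j) (by simp)
  refine ⟨heligible, ?_, coveredBefore (pre := pre ++ [(d, j)]) hG (by simpa using h) ?_, ?_⟩
  · cases s with
    | nil =>
      simp only [latest, List.map_nil, List.headD_nil, hG.dummy]
      linarith [hG.left d heligible.disk]
    | cons a s => exact hsweep.fst_le_latest a (by simp)
  · intro q hq
    rcases List.mem_append.1 hq with hq | hq
    · exact (List.pairwise_append.1 h.sorted).2.2 q hq (d, j) (by simp)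
    · rw [List.mem_singleton.1 hq]
  · intro t _
    by_cases hm : G.slot s j t = G.m
    · rw [hm]
      exact hG.four_lt_sqDist_dummy heligible.disk
    · rw [sqDist_comm]
      exact (List.pairwise_cons.1 hsweep.far).1 _ (slot_mem hm) rfl

lemma reachable_of_append (hG : G.Admissible B) (h : G.Solves (pre ++ s)) : G.Reachable s := by
  induction s generalizing pre with
  | nil => exact .nil
  | cons q s ih => exact .cons (ih (pre := pre ++ [q]) (by simpa using h)) (h.allowed hG)

lemma reachable (hG : G.Admissible B) (h : G.Solves s) : G.Reachable s :=
  h.reachable_of_append (pre := []) hG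

end Solves

lemma Reachable.latest_isGreatest (hG : G.Admissible B) (h : G.Reachable s) :
    IsGreatest ((fun j => G.X (G.slot s j 0)) '' Set.Iio G.k) (G.X (G.latest s)) := by
  induction h with
  | nil =>
    refine ⟨⟨0, hG.k_pos, by simp [slot_nil, latest]⟩, ?_⟩
    rintro _ ⟨j, -, rfl⟩
    simp [slot_nil, latest]
  | @cons s d j _ ha ih =>
    have hdepth := hG.three_le_depth
    refine ⟨⟨j, ha.color, ?_⟩, ?_⟩
    · simp only [slot_cons, if_pos, show 0 < G.depth by omega]
      rfl
    · rintro _ ⟨i, hi, rfl⟩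
      simp only [slot_cons, if_pos, show 0 < G.depth by omega]
      split_ifs
      · rfl
      · exact (ih.2 ⟨i, hi, rfl⟩).trans ha.right

namespace SameMemory

lemma symm (h : G.SameMemory s s') : G.SameMemory s' s := fun i hi => (h i hi).symm

lemma trans {s'' : PartialSolution} (h : G.SameMemory s s') (h' : G.SameMemory s' s'') :
    G.SameMemory s s'' := fun i hi => (h i hi).trans (h' i hi)

lemma slot_eq (hG : G.Admissible B) (h : G.SameMemory s s') {j : ℕ} (hj : j < G.k) (t : ℕ) :
    G.slot s j t = G.slot s' j t := by
  by_cases ht : t < 4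
  · rw [← memory_mul_add ht, ← memory_mul_add ht]
    exact h _ (by omega)
  · have := hG.depth_le_four
    simp [slot, show ¬ t < G.depth by omega]

lemma latest_eq (hG : G.Admissible B) (h : G.SameMemory s s') (hs : G.Reachable s)
    (hs' : G.Reachable s') : G.X (G.latest s) = G.X (G.latest s') := by
  have himage : (fun j => G.X (G.slot s j 0)) '' Set.Iio G.k =
      (fun j => G.X (G.slot s' j 0)) '' Set.Iio G.k :=
    Set.image_congr fun j hj => by rw [h.slot_eq hG hj]
  exact (himage ▸ hs.latest_isGreatest hG).unique (hs'.latest_isGreatest hG)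

lemma coveredBefore (hG : G.Admissible B) (h : G.SameMemory s s') (hs : G.Reachable s)
    (hs' : G.Reachable s') {x : ℝ} (hc : G.CoveredBefore s x) : G.CoveredBefore s' x := by
  intro p hp hle hlt
  rw [← h.latest_eq hG hs hs'] at hle
  obtain ⟨i, hi, hip⟩ := hc p hp hle hlt
  exact ⟨i, hi, by rwa [← h i hi]⟩

lemma allowed (hG : G.Admissible B) (h : G.SameMemory s s') (hs : G.Reachable s)
    (hs' : G.Reachable s') {d j : ℕ} (ha : G.Allowed s d j) : G.Allowed s' d j where
  toEligible := ha.toEligible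
  right := by rw [← h.latest_eq hG hs hs']; exact ha.right
  covered := h.coveredBefore hG hs hs' ha.covered
  far t ht := by rw [← h.slot_eq hG ha.color]; exact ha.far t ht

lemma cons (hG : G.Admissible B) (h : G.SameMemory s s') (d j : ℕ) :
    G.SameMemory ((d, j) :: s) ((d, j) :: s') := by
  intro i hi
  unfold memory
  rw [slot_cons, slot_cons]
  split_ifs with hij
  · rfl
  · exact h.slot_eq hG (by omega) _
  · rfl
  · exact h.slot_eq hG (by omega) _

end SameMemory

lemma Reachable.exists_sameMemory (hG : G.Admissible B) {T : List PartialSolution}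
    (hreachable : ∀ t ∈ T, G.Reachable t) (hnil : [] ∈ T)
    (hclosed : ∀ t ∈ T, ∀ d j, G.Allowed t d j → ∃ t' ∈ T, G.SameMemory t' ((d, j) :: t))
    (hs : G.Reachable s) : ∃ t ∈ T, G.SameMemory s t := by
  induction hs with
  | nil => exact ⟨[], hnil, fun _ _ => rfl⟩
  | @cons s d j hs ha ih =>
    obtain ⟨t, ht, hst⟩ := ih
    obtain ⟨t', ht', htt'⟩ := hclosed t ht d j (hst.allowed hG hs (hreachable t ht) ha)
    exact ⟨t', ht', (hst.cons hG d j).trans htt'.symm⟩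

lemma Solves.exists_coveredBefore (hG : G.Admissible B) {T : List PartialSolution}
    (hs : G.Solves s) (hreachable : ∀ t ∈ T, G.Reachable t) (hnil : [] ∈ T)
    (hclosed : ∀ t ∈ T, ∀ d j, G.Allowed t d j → ∃ t' ∈ T, G.SameMemory t' ((d, j) :: t)) :
    ∃ t ∈ T, G.CoveredBefore t B := by
  obtain ⟨t, ht, hst⟩ := (hs.reachable hG).exists_sameMemory hG hreachable hnil hclosed
  exact ⟨t, ht, hst.coveredBefore hG (hs.reachable hG) (hreachable t ht)
    (hs.coveredBefore (pre := []) hG (by simp))⟩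

end Strip

/-! ### Reasoning about programs -/

notation:60 p:61 ";;" q:60 => Prog.seq p q

/-- Straight-line code. The empty code overwrites the otherwise unused integer variable `99`. -/
def block : List Instr → Prog
  | [] => .instr (.intConst 99 0)
  | [i] => .instr i
  | i :: j :: l => .instr i ;; block (j :: l)

/-- Repeat `p` as often as the integer variable `c` says, counting it down. Throughout, the integer
variable `3` holds the constant `1`. -/
def repeatN (c : ℕ) (p : Prog) : Prog := .loop (.intLe 3 c) (p ;; .instr (.intSub c c 3))

/-- The pieces of memory by which the effect of a program is delimited. -/
inductive Cell
  | intVar (x : ℕ)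
  | realVar (x : ℕ)
  | intArr (a : ℕ)
  | realArr (a : ℕ)
  deriving DecidableEq

/-- The piece of memory that an instruction writes to. -/
def Instr.target : Instr → Cell
  | .intConst x _ | .intAdd x _ _ | .intSub x _ _ | .intLoad x _ _ => .intVar x
  | .intStore a _ _ => .intArr a
  | .realConst x _ | .realAdd x _ _ | .realSub x _ _ | .realMul x _ _ | .realDiv x _ _
  | .realLoad x _ _ => .realVar x
  | .realStore a _ _ => .realArr a

/-- Whether some instruction of the program writes to `c`. As a Boolean function this is evaluated
by the kernel, which settles all side conditions of the frame rules. -/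
def Prog.writes (c : Cell) : Prog → Bool
  | .instr i => i.target = c
  | .seq p q => p.writes c || q.writes c
  | .ite _ p q => p.writes c || q.writes c
  | .loop _ p => p.writes c

/-- The two stores agree in all pieces of memory that `p` does not write to. -/
structure EqOff (p : Prog) (σ σ' : Store) : Prop where
  int : ∀ x, p.writes (.intVar x) = false → σ'.intVar x = σ.intVar x
  real : ∀ x, p.writes (.realVar x) = false → σ'.realVar x = σ.realVar x
  intArr : ∀ a, p.writes (.intArr a) = false → σ'.intArr a = σ.intArr a
  realArr : ∀ a, p.writes (.realArr a) = false → σ'.realArr a = σ.realArr a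

/-- Started in `σ`, the program `p` halts after at most `T` steps in a store satisfying `Q`. -/
def HaltsWithin (p : Prog) (σ : Store) (T : ℕ) (Q : Store → Prop) : Prop :=
  ∃ t σ', t ≤ T ∧ Runs p σ t σ' ∧ Q σ'

section

variable {p q : Prog} {σ σ₁ σ₂ : Store}

lemma EqOff.refl (p : Prog) (σ : Store) : EqOff p σ σ :=
  ⟨fun _ _ => rfl, fun _ _ => rfl, fun _ _ => rfl, fun _ _ => rfl⟩

lemma EqOff.trans (h : EqOff p σ σ₁) (h' : EqOff p σ₁ σ₂) : EqOff p σ σ₂ where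
  int x hx := (h'.int x hx).trans (h.int x hx)
  real x hx := (h'.real x hx).trans (h.real x hx)
  intArr a ha := (h'.intArr a ha).trans (h.intArr a ha)
  realArr a ha := (h'.realArr a ha).trans (h.realArr a ha)

lemma EqOff.mono (h : EqOff p σ σ₁) (hpq : ∀ c, q.writes c = false → p.writes c = false) :
    EqOff q σ σ₁ where
  int x hx := h.int x (hpq _ hx)
  real x hx := h.real x (hpq _ hx)
  intArr a ha := h.intArr a (hpq _ ha)
  realArr a ha := h.realArr a (hpq _ ha)

lemma Instr.eqOff_exec (i : Instr) (σ : Store) : EqOff (.instr i) σ (i.exec σ) := by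
  cases i <;> constructor <;> intro x hx <;>
    simp_all [Instr.exec, Instr.target, Prog.writes, setEntry, Function.update_of_ne, eq_comm]

lemma Runs.eqOff {t : ℕ} (h : Runs p σ t σ₁) : EqOff p σ σ₁ := by
  induction h with
  | instr i σ => exact i.eqOff_exec σ
  | @seq p q _ _ _ _ _ _ _ ih₁ ih₂ =>
    exact (ih₁.mono (q := p ;; q) fun _ hc => (Bool.or_eq_false_iff.1 hc).1).trans
      (ih₂.mono fun _ hc => (Bool.or_eq_false_iff.1 hc).2)
  | @iteTrue b p q _ _ _ _ _ ih =>
    exact ih.mono (q := .ite b p q) fun _ hc => (Bool.or_eq_false_iff.1 hc).1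
  | @iteFalse b p q _ _ _ _ _ ih =>
    exact ih.mono (q := .ite b p q) fun _ hc => (Bool.or_eq_false_iff.1 hc).2
  | loopDone _ => exact .refl _ _
  | @loopStep b p _ _ _ _ _ _ _ _ ih₁ ih₂ =>
    exact (ih₁.mono (q := .loop b p) fun _ hc => hc).trans ih₂

end

namespace HaltsWithin

variable {p q : Prog} {σ : Store} {T T₁ T₂ : ℕ} {P Q : Store → Prop} {b : Test}

lemma mono (h : HaltsWithin p σ T₁ P) (hT : T₁ ≤ T)
    (hQ : ∀ σ', EqOff p σ σ' → P σ' → Q σ') : HaltsWithin p σ T Q := by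
  obtain ⟨t, σ', ht, hrun, hp⟩ := h
  exact ⟨t, σ', ht.trans hT, hrun, hQ σ' hrun.eqOff hp⟩

lemma bind (h : HaltsWithin p σ T₁ P)
    (hq : ∀ σ', EqOff p σ σ' → P σ' → HaltsWithin q σ' T₂ Q) (hT : T₁ + T₂ ≤ T) :
    HaltsWithin (p ;; q) σ T Q := by
  obtain ⟨t, σ', ht, hrun, hp⟩ := h
  obtain ⟨u, σ'', hu, hrun', hq'⟩ := hq σ' hrun.eqOff hp
  exact ⟨t + u, σ'', by omega, .seq hrun hrun', hq'⟩

lemma instr {i : Instr} (hT : 1 ≤ T) (h : Q (i.exec σ)) : HaltsWithin (.instr i) σ T Q :=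
  ⟨1, _, hT, .instr i σ, h⟩

lemma block {l : List Instr} (hl : l ≠ []) (hT : l.length ≤ T) (h : Q (l.foldl Instr.exec σ)) :
    HaltsWithin (block l) σ T Q := by
  induction l generalizing σ T with
  | nil => exact absurd rfl hl
  | cons i l ih =>
    cases l with
    | nil => exact instr hT h
    | cons j l =>
      rw [List.length_cons] at hT
      refine bind (T₁ := 1) (T₂ := T - 1) (P := fun σ' => σ' = i.exec σ) (instr le_rfl rfl) ?_
        (by omega)
      rintro _ - rfl
      exact ih (by simp) (by omega) h

lemma ite (hp : b.Holds σ → HaltsWithin p σ T₁ Q) (hq : ¬ b.Holds σ → HaltsWithin q σ T₁ Q)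
    (hT : T₁ + 1 ≤ T) : HaltsWithin (.ite b p q) σ T Q := by
  by_cases h : b.Holds σ
  · obtain ⟨t, σ', ht, hrun, hp⟩ := hp h
    exact ⟨t + 1, σ', by omega, .iteTrue h hrun, hp⟩
  · obtain ⟨t, σ', ht, hrun, hq⟩ := hq h
    exact ⟨t + 1, σ', by omega, .iteFalse h hrun, hq⟩

/-- The first argument of the invariant is a bound for the time left. -/
lemma loop (Inv : ℕ → Store → Prop) (hinit : Inv T σ)
    (hdone : ∀ r σ, Inv r σ → ¬ b.Holds σ → 1 ≤ r ∧ Q σ)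
    (hstep : ∀ r σ, Inv r σ → b.Holds σ →
      ∃ T r', T + r' + 1 ≤ r ∧ HaltsWithin p σ T (Inv r')) : HaltsWithin (.loop b p) σ T Q := by
  induction T using Nat.strong_induction_on generalizing σ with
  | _ T ih =>
    by_cases h : b.Holds σ
    · obtain ⟨T', r', hr, t, σ', ht, hrun, hinv⟩ := hstep T σ hinit h
      obtain ⟨u, σ'', hu, hrun', hQ⟩ := ih r' (by omega) hinv
      exact ⟨t + u + 1, σ'', by omega, .loopStep h hrun hrun', hQ⟩
    · exact ⟨1, σ, (hdone T σ hinit h).1, .loopDone h, (hdone T σ hinit h).2⟩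

lemma repeatN {c N : ℕ} (Inv : ℕ → Store → Prop) (hone : σ.intVar 3 = 1) (hc : σ.intVar c = N)
    (hp : p.writes (.intVar c) = false) (hone' : (repeatN c p).writes (.intVar 3) = false)
    (hinit : Inv 0 σ)
    (hcounter : ∀ i σ v, Inv i σ → Inv i { σ with intVar := Function.update σ.intVar c v })
    (hstep : ∀ i < N, ∀ σ', EqOff (repeatN c p) σ σ' → Inv i σ' →
      HaltsWithin p σ' T₁ (Inv (i + 1)))
    (hT : N * (T₁ + 2) + 1 ≤ T) : HaltsWithin (repeatN c p) σ T (Inv N) := by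
  refine mono (T₁ := N * (T₁ + 2) + 1) (P := Inv N) ?_ hT fun _ _ h => h
  refine loop (fun r σ' => ∃ i ≤ N, r = (N - i) * (T₁ + 2) + 1 ∧ EqOff (CDUDC.repeatN c p) σ σ' ∧
    Inv i σ' ∧ σ'.intVar c = N - i) ⟨0, N.zero_le, rfl, .refl _ _, hinit, hc⟩ ?_ ?_
  · rintro r σ' ⟨i, hi, rfl, hframe, hinv, hci⟩ hb
    simp only [Test.Holds, hframe.int 3 hone', hone, hci] at hb
    exact ⟨by omega, by rwa [show N = i by omega]⟩
  · rintro r σ' ⟨i, hi, rfl, hframe, hinv, hci⟩ hb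
    simp only [Test.Holds, hframe.int 3 hone', hone, hci] at hb
    have htime : (N - i) * (T₁ + 2) = (N - (i + 1)) * (T₁ + 2) + (T₁ + 2) := by
      rw [← Nat.succ_mul]
      congr 1
      omega
    refine ⟨T₁ + 1, (N - (i + 1)) * (T₁ + 2) + 1, by omega, ?_⟩
    have hbody := hstep i (by omega) σ' hframe hinv
    refine bind (T₂ := 1) (Q := fun σ'' => EqOff (CDUDC.repeatN c p) σ' σ'' →
      ∃ i' ≤ N, (N - (i + 1)) * (T₁ + 2) + 1 = (N - i') * (T₁ + 2) + 1 ∧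
        EqOff (CDUDC.repeatN c p) σ σ'' ∧ Inv i' σ'' ∧ σ''.intVar c = N - i') hbody ?_ le_rfl
      |>.mono le_rfl fun σ'' h hQ => hQ (h.mono fun _ hc => hc)
    refine fun σ'' hp' hinv' => instr le_rfl fun h => ⟨i + 1, by omega, rfl, hframe.trans h,
      hcounter _ _ _ hinv', ?_⟩
    have hthree : p.writes (.intVar 3) = false := (Bool.or_eq_false_iff.1 hone').1
    simp only [Instr.exec, Function.update_self, hp'.int c hp, hp'.int 3 hthree,
      hframe.int 3 hone', hone, hci]
    omega

end HaltsWithin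

lemma setEntry_apply {β : Type} (A : ℕ → ℕ → β) (a i : ℕ) (v : β) (a' i' : ℕ) :
    setEntry A a i v a' i' = if a' = a ∧ i' = i then v else A a' i' := by
  unfold setEntry
  by_cases h : a' = a
  · subst h
    by_cases h' : i' = i <;> simp [h']
  · simp [h]

/-- The empty program. -/
def skip : Prog := block []

lemma HaltsWithin.skip {σ : Store} {T : ℕ} {Q : Store → Prop} (hT : 1 ≤ T)
    (h : Q { σ with intVar := Function.update σ.intVar 99 0 }) : HaltsWithin skip σ T Q :=
  .instr hT h

/-! ### Registers

The prefixes `vi` and `vr` stand for integer and real variables, `ai` and `ar` for integer and real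
arrays. -/

notation "viN" => (0 : ℕ)
notation "viM" => (1 : ℕ)
notation "viK" => (2 : ℕ)
notation "viOne" => (3 : ℕ)
notation "viBase" => (4 : ℕ)
notation "viDigits" => (5 : ℕ)
notation "viFour" => (6 : ℕ)
notation "viClasses" => (7 : ℕ)
notation "viLong" => (8 : ℕ)
notation "viZero" => (9 : ℕ)
notation "viNearCount" => (10 : ℕ)
notation "viNearIdx" => (11 : ℕ)
notation "viFlag" => (12 : ℕ)
notation "viTmp" => (13 : ℕ)
notation "viPtCount" => (14 : ℕ)
notation "viPtIdx" => (15 : ℕ)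
notation "viOk" => (16 : ℕ)
notation "viPt" => (17 : ℕ)
notation "viDiskCount" => (18 : ℕ)
notation "viDisk" => (19 : ℕ)
notation "viColCount" => (20 : ℕ)
notation "viCol" => (21 : ℕ)
notation "viColFour" => (22 : ℕ)
notation "viCopyCount" => (23 : ℕ)
notation "viSrc" => (24 : ℕ)
notation "viDst" => (25 : ℕ)
notation "viCode" => (27 : ℕ)
notation "viRow" => (28 : ℕ)
notation "viHead" => (29 : ℕ)
notation "viHeadPos" => (30 : ℕ)
notation "viTail" => (31 : ℕ)
notation "viTailPos" => (32 : ℕ)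
notation "viAcc" => (33 : ℕ)
notation "viStamp" => (34 : ℕ)
notation "viCount" => (35 : ℕ)
notation "viShift" => (36 : ℕ)
notation "viClass" => (37 : ℕ)
notation "viGo" => (38 : ℕ)
notation "viBack" => (39 : ℕ)
notation "viTmpA" => (40 : ℕ)
notation "viTmpB" => (41 : ℕ)
notation "viNext" => (42 : ℕ)
notation "vrTau" => (0 : ℕ)
notation "vrOne" => (1 : ℕ)
notation "vrHeight" => (3 : ℕ)
notation "vrBound" => (4 : ℕ)
notation "vrBot" => (5 : ℕ)
notation "vrLast" => (6 : ℕ)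
notation "vrTop" => (7 : ℕ)
notation "vrLow" => (8 : ℕ)
notation "vrHigh" => (9 : ℕ)
notation "vrCur" => (10 : ℕ)
notation "vrLim" => (11 : ℕ)
notation "vrUx" => (12 : ℕ)
notation "vrUy" => (13 : ℕ)
notation "vrRad" => (14 : ℕ)
notation "vrX" => (15 : ℕ)
notation "vrY" => (16 : ℕ)
notation "aiOut" => (0 : ℕ)
notation "aiList" => (1 : ℕ)
notation "aiQueue" => (2 : ℕ)
notation "aiDisk" => (3 : ℕ)
notation "aiCol" => (4 : ℕ)
notation "aiParent" => (5 : ℕ)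
notation "aiSeen" => (6 : ℕ)
notation "aiPow" => (7 : ℕ)
notation "arPx" => (0 : ℕ)
notation "arPy" => (1 : ℕ)
notation "arCx" => (2 : ℕ)
notation "arCy" => (3 : ℕ)

/-- The centre of disk `d`, as stored. -/
def Store.center (σ : Store) (d : ℕ) : ℝ × ℝ := (σ.realArr arCx d, σ.realArr arCy d)

/-- The point with index `i`, as stored. -/
def Store.point (σ : Store) (i : ℕ) : ℝ × ℝ := (σ.realArr arPx i, σ.realArr arPy i)

/-! ### The program: the points that the remembered disks have to cover -/

/-- Test the disk at place `viNearIdx` of the queue for being near to `(vrUx, vrUy)`. -/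
def nearStep : Prog :=
  block [.intLoad viTmp aiQueue viNearIdx, .realLoad vrX arCx viTmp, .realLoad vrY arCy viTmp,
    .realSub vrX vrX vrUx, .realSub vrY vrY vrUy, .realMul vrX vrX vrX, .realMul vrY vrY vrY,
    .realAdd vrX vrX vrY, .intAdd viNearIdx viNearIdx viOne] ;;
  .ite (.realLe vrX vrRad) (block [.intConst viFlag 1]) skip

/-- Decide whether one of the `viNearCount` disks in the queue from place `viNearIdx` on has squared
distance at most `vrRad` from `(vrUx, vrUy)`. -/
def near : Prog := block [.intConst viFlag 0] ;; repeatN viNearCount nearStep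

lemma nearStep_spec {σ : Store} (hone : σ.intVar viOne = 1) :
    HaltsWithin nearStep σ 11 fun σ' => σ'.intVar viNearIdx = σ.intVar viNearIdx + 1 ∧
      (1 ≤ σ'.intVar viFlag ↔ 1 ≤ σ.intVar viFlag ∨
        sqDist (σ.center (σ.intArr aiQueue (σ.intVar viNearIdx)))
          (σ.realVar vrUx, σ.realVar vrUy) ≤ σ.realVar vrRad) := by
  refine .bind (T₁ := 9) (T₂ := 2) (.block (Q := fun σ' =>
    σ'.intVar viNearIdx = σ.intVar viNearIdx + 1 ∧ σ'.intVar viFlag = σ.intVar viFlag ∧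
    σ'.realVar vrRad = σ.realVar vrRad ∧
    σ'.realVar vrX = sqDist (σ.center (σ.intArr aiQueue (σ.intVar viNearIdx)))
      (σ.realVar vrUx, σ.realVar vrUy)) (by simp) (by simp) ?_) ?_ le_rfl
  · simp [Instr.exec, hone, sqDist, Store.center]
  · rintro σ₁ - ⟨hidx, hflag, hrad, hdist⟩
    refine .ite (T₁ := 1) (fun hb => .block (by simp) (by simp) ?_)
      (fun hb => .skip le_rfl ?_) le_rfl <;>
      simp only [Test.Holds, hrad, hdist] at hb
    · simp [Instr.exec, hidx, hb]
    · simp [hidx, hflag, hb]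

lemma near_spec {σ : Store} {L a : ℕ} (hone : σ.intVar viOne = 1) (hL : σ.intVar viNearCount = L)
    (ha : σ.intVar viNearIdx = a) :
    HaltsWithin near σ (13 * L + 2) fun σ' => 1 ≤ σ'.intVar viFlag ↔
      ∃ i < L, sqDist (σ.center (σ.intArr aiQueue (a + i))) (σ.realVar vrUx, σ.realVar vrUy) ≤
        σ.realVar vrRad := by
  refine .bind (T₁ := 1) (T₂ := 13 * L + 1) (.block (Q := fun σ' => σ'.intVar viFlag = 0) (by simp)
    (by simp) (by simp [Instr.exec])) (fun σ₁ h₁ hflag => ?_) (by omega)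
  refine (HaltsWithin.repeatN (N := L) (T₁ := 11) (fun i σ' => σ'.intVar viNearIdx = a + i ∧
    (1 ≤ σ'.intVar viFlag ↔ ∃ j < i, sqDist (σ.center (σ.intArr aiQueue (a + j)))
      (σ.realVar vrUx, σ.realVar vrUy) ≤ σ.realVar vrRad)) (by rw [h₁.int _ rfl, hone])
    (by rw [h₁.int _ rfl, hL]) rfl rfl (by simp (decide := true) [h₁.int, ha, hflag])
    (fun i σ v h => by simpa using h) (fun i _ σ₂ h₂ ⟨hidx, hinv⟩ => ?_) le_rfl).mono
    (by omega) fun _ _ h => h.2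
  refine (nearStep_spec (by rw [h₂.int _ rfl, h₁.int _ rfl, hone])).mono le_rfl
    fun σ₃ _ ⟨hidx', hflag'⟩ => ⟨by rw [hidx', hidx, add_assoc], ?_⟩
  rw [hflag', hinv, hidx, Nat.exists_lt_succ_right]
  simp (decide := true) only [Store.center, h₂.real, h₁.real, h₂.intArr, h₁.intArr, h₂.realArr,
    h₁.realArr]

/-- The disks remembered at the head of the queue cover `p` if they have to, that is, if `p` lies
between the reach of the current disk and the reach of the next one. -/
def Store.HeadCovers (σ : Store) (p : ℝ × ℝ) : Prop :=
  σ.realVar vrCur ≤ p.1 + 1 → p.1 + 1 < σ.realVar vrLim →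
    ∃ i < σ.intVar viDigits, sqDist (σ.center (σ.intArr aiQueue (σ.intVar viHeadPos + i))) p ≤ 1

/-- Clear `viOk` if the remembered disks fail to cover the point at place `viPtIdx` of the list. -/
def checkPoint : Prog :=
  block [.intLoad viPt aiList viPtIdx, .intAdd viPtIdx viPtIdx viOne, .realLoad vrUx arPx viPt,
    .realLoad vrUy arPy viPt, .realAdd vrX vrUx vrOne] ;;
  .ite (.realLe vrCur vrX) (.ite (.realLe vrLim vrX) skip (
    block [.intAdd viNearIdx viHeadPos viZero, .intAdd viNearCount viDigits viZero,
      .realConst vrRad 1] ;;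
    near ;; .ite (.intLe viOne viFlag) skip (block [.intConst viOk 0]))) skip

/-- Decide whether the remembered disks cover all listed points that they have to. -/
def checkPoints : Prog :=
  block [.intConst viOk 1, .intAdd viPtCount viCount viZero, .intConst viPtIdx 0] ;;
  repeatN viPtCount checkPoint

/-- The constants on which all parts of the program rely. -/
structure Store.HasConstants (σ : Store) : Prop where
  one : σ.intVar viOne = 1
  zero : σ.intVar viZero = 0
  realOne : σ.realVar vrOne = 1

lemma Store.HasConstants.of_eqOff {p : Prog} {σ σ' : Store} (h : σ.HasConstants) (hσ : EqOff p σ σ')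
    (hone : p.writes (.intVar viOne) = false := by rfl)
    (hzero : p.writes (.intVar viZero) = false := by rfl)
    (hreal : p.writes (.realVar vrOne) = false := by rfl) : σ'.HasConstants :=
  ⟨(hσ.int _ hone).trans h.one, (hσ.int _ hzero).trans h.zero, (hσ.real _ hreal).trans h.realOne⟩

lemma checkPoint_spec {σ : Store} (hconst : σ.HasConstants) :
    HaltsWithin checkPoint σ (13 * σ.intVar viDigits + 14) fun σ' =>
      σ'.intVar viPtIdx = σ.intVar viPtIdx + 1 ∧ (1 ≤ σ'.intVar viOk ↔
        1 ≤ σ.intVar viOk ∧ σ.HeadCovers (σ.point (σ.intArr aiList (σ.intVar viPtIdx)))) := by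
  set p := σ.point (σ.intArr aiList (σ.intVar viPtIdx)) with hp
  refine .bind (T₁ := 5) (T₂ := 13 * σ.intVar viDigits + 9) (.block (Q := fun σ' =>
    σ'.intVar viPtIdx = σ.intVar viPtIdx + 1 ∧ σ'.realVar vrUx = p.1 ∧ σ'.realVar vrUy = p.2 ∧
    σ'.realVar vrX = p.1 + 1) (by simp) (by simp) ?_) ?_ (by omega)
  · simp [Instr.exec, hconst.one, hconst.realOne, hp, Store.point]
  rintro σ₁ h₁ ⟨hidx, hux, huy, hx⟩
  refine .ite (T₁ := 13 * σ.intVar viDigits + 8) (fun hcur => ?_)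
    (fun hcur => .skip (by omega) ?_) (by omega) <;>
    simp (decide := true) only [Test.Holds, hx, h₁.real] at hcur
  swap
  · simp (decide := true) [hidx, h₁.int, Store.HeadCovers, hcur]
  refine .ite (T₁ := 13 * σ.intVar viDigits + 7) (fun hlim => .skip (by omega) ?_)
    (fun hlim => ?_) (by omega) <;>
    simp (decide := true) only [Test.Holds, hx, h₁.real] at hlim
  · simp (decide := true) [hidx, h₁.int, Store.HeadCovers, hlim.not_gt]
  refine .bind (T₁ := 3) (T₂ := 13 * σ.intVar viDigits + 4) (.block (Q := fun σ' =>
    σ'.intVar viNearIdx = σ.intVar viHeadPos ∧ σ'.intVar viNearCount = σ.intVar viDigits ∧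
    σ'.realVar vrRad = 1) (by simp) (by simp) ?_) ?_ (by omega)
  · simp (decide := true) [Instr.exec, h₁.int, hconst.zero]
  rintro σ₂ h₂ ⟨hnearIdx, hnearCount, hrad⟩
  have hconst₂ := (hconst.of_eqOff h₁).of_eqOff h₂
  refine .bind (T₂ := 2) (near_spec hconst₂.one hnearCount hnearIdx) (fun σ₃ h₃ hnear => ?_)
    (by omega)
  simp (decide := true) only [h₂.real, hux, huy, hrad, Store.center, h₂.realArr, h₁.realArr,
    h₂.intArr, h₁.intArr] at hnear
  refine .ite (T₁ := 1) (fun hb => .skip le_rfl ?_)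
    (fun hb => .block (by simp) (by simp) ?_) le_rfl <;>
    rw [Test.Holds, (hconst₂.of_eqOff h₃).one, hnear] at hb
  · simp (decide := true) [h₃.int, h₂.int, h₁.int, hidx, Store.HeadCovers, Store.center, hb]
  · simp (decide := true) [Instr.exec, h₃.int, h₂.int, hidx, Store.HeadCovers, Store.center, hb,
      hcur, hlim, -not_exists]

lemma checkPoints_spec {σ : Store} (hconst : σ.HasConstants) :
    HaltsWithin checkPoints σ (σ.intVar viCount * (13 * σ.intVar viDigits + 16) + 4) fun σ' =>
      1 ≤ σ'.intVar viOk ↔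
        ∀ i < σ.intVar viCount, σ.HeadCovers (σ.point (σ.intArr aiList i)) := by
  refine .bind (T₁ := 3) (.block (Q := fun σ' => σ'.intVar viOk = 1 ∧
    σ'.intVar viPtCount = σ.intVar viCount ∧ σ'.intVar viPtIdx = 0) (by simp) (by simp)
    (by simp [Instr.exec, hconst.zero])) (fun σ₁ h₁ ⟨hok, hcount, hidx⟩ => ?_)
    (T₂ := σ.intVar viCount * (13 * σ.intVar viDigits + 16) + 1) (by omega)
  have hconst₁ := hconst.of_eqOff h₁
  refine (HaltsWithin.repeatN (T₁ := 13 * σ.intVar viDigits + 14) (fun i σ' =>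
    σ'.intVar viPtIdx = i ∧ (1 ≤ σ'.intVar viOk ↔
      ∀ i' < i, σ.HeadCovers (σ.point (σ.intArr aiList i')))) hconst₁.one hcount rfl rfl
    (by simp [hidx, hok]) (fun i σ v h => by simpa using h)
    (fun i _ σ₂ h₂ ⟨hidx, hinv⟩ => ?_) le_rfl).mono le_rfl fun _ _ h => h.2
  have hdigits : σ₂.intVar viDigits = σ.intVar viDigits := by rw [h₂.int _ rfl, h₁.int _ rfl]
  refine (checkPoint_spec (hconst₁.of_eqOff h₂)).mono (by omega)
    fun σ₃ _ ⟨hidx', hok'⟩ => ⟨by rw [hidx', hidx], ?_⟩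
  rw [hok', hinv, hidx, Nat.forall_lt_succ_right]
  simp (decide := true) only [Store.HeadCovers, Store.center, Store.point, h₂.int, h₁.int,
    h₂.real, h₁.real, h₂.intArr, h₁.intArr, h₂.realArr, h₁.realArr]

/-! ### The program: adding a state to the queue -/

/-- Copy one entry of the state at the head of the queue. -/
def copyStep : Prog :=
  block [.intLoad viTmp aiQueue viSrc, .intStore aiQueue viDst viTmp, .intAdd viSrc viSrc viOne,
    .intAdd viDst viDst viOne]

/-- Copy the state at the head of the queue to the end. -/
def copyState : Prog :=
  block [.intAdd viSrc viHeadPos viZero, .intAdd viDst viTailPos viZero,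
    .intAdd viCopyCount viDigits viZero] ;;
  repeatN viCopyCount copyStep

lemma copyState_spec {σ : Store} (hconst : σ.HasConstants)
    (hdisjoint : σ.intVar viHeadPos + σ.intVar viDigits ≤ σ.intVar viTailPos) :
    HaltsWithin copyState σ (6 * σ.intVar viDigits + 4) fun σ' =>
      (∀ i < σ.intVar viDigits, σ'.intArr aiQueue (σ.intVar viTailPos + i) =
        σ.intArr aiQueue (σ.intVar viHeadPos + i)) ∧
      ∀ x < σ.intVar viTailPos, σ'.intArr aiQueue x = σ.intArr aiQueue x := by
  refine .bind (T₁ := 3) (T₂ := 6 * σ.intVar viDigits + 1) (.block (Q := fun σ' =>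
    σ'.intVar viSrc = σ.intVar viHeadPos ∧ σ'.intVar viDst = σ.intVar viTailPos ∧
    σ'.intVar viCopyCount = σ.intVar viDigits) (by simp) (by simp)
    (by simp [Instr.exec, hconst.zero])) (fun σ₁ h₁ ⟨hsrc, hdst, hcount⟩ => ?_) (by omega)
  have hconst₁ := hconst.of_eqOff h₁
  refine (HaltsWithin.repeatN (T₁ := 4) (fun i σ' =>
    σ'.intVar viSrc = σ.intVar viHeadPos + i ∧ σ'.intVar viDst = σ.intVar viTailPos + i ∧
    (∀ i' < i, σ'.intArr aiQueue (σ.intVar viTailPos + i') =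
      σ.intArr aiQueue (σ.intVar viHeadPos + i')) ∧
    ∀ x < σ.intVar viTailPos, σ'.intArr aiQueue x = σ.intArr aiQueue x)
    hconst₁.one hcount rfl rfl (by simp (decide := true) [hsrc, hdst, h₁.intArr])
    (fun i σ v h => by simpa using h) (fun i hi σ₂ h₂ ⟨hsrc, hdst, hcopied, hold⟩ => ?_)
    le_rfl).mono (by omega) fun _ _ h => h.2.2
  have hone := (hconst₁.of_eqOff h₂).one
  refine .block (by simp) (by simp) ⟨?_, ?_, fun i' hi' => ?_, fun x hx => ?_⟩
  · simp [Instr.exec, hsrc, hone, add_assoc]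
  · simp [Instr.exec, hdst, hone, add_assoc]
  · rcases Nat.lt_succ_iff_lt_or_eq.1 hi' with hlt | rfl
    · simp [Instr.exec, setEntry_apply, hdst, hlt.ne, hcopied i' hlt]
    · simp [Instr.exec, setEntry_apply, hdst, hsrc, hold (σ.intVar viHeadPos + i') (by omega)]
  · simp [Instr.exec, setEntry_apply, hdst, (hx.trans_le (Nat.le_add_right _ i)).ne, hold x hx]

/-- Enter the current disk as the latest one of the current colour into the state at the end of the
queue. With three remembered disks for each colour, the fourth slot keeps the dummy disk. -/
def shiftState : Prog :=
  block [.intAdd viDst viTailPos viColFour, .intLoad viTmp aiQueue viDst,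
    .intStore aiQueue viDst viDisk, .intAdd viDst viDst viOne, .intLoad viTmpA aiQueue viDst,
    .intStore aiQueue viDst viTmp, .intAdd viDst viDst viOne, .intLoad viTmpB aiQueue viDst,
    .intStore aiQueue viDst viTmpA, .intAdd viDst viDst viOne] ;;
  .ite (.intLe viOne viLong) (block [.intStore aiQueue viDst viTmpB])
    (block [.intStore aiQueue viDst viM])

lemma shiftState_spec {σ : Store} {b : ℕ} (hone : σ.intVar viOne = 1)
    (hb : σ.intVar viTailPos + σ.intVar viColFour = b) :
    HaltsWithin shiftState σ 12 fun σ' => σ'.intArr aiQueue b = σ.intVar viDisk ∧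
      σ'.intArr aiQueue (b + 1) = σ.intArr aiQueue b ∧
      σ'.intArr aiQueue (b + 2) = σ.intArr aiQueue (b + 1) ∧
      σ'.intArr aiQueue (b + 3) =
        (if 1 ≤ σ.intVar viLong then σ.intArr aiQueue (b + 2) else σ.intVar viM) ∧
      ∀ x, x < b ∨ b + 4 ≤ x → σ'.intArr aiQueue x = σ.intArr aiQueue x := by
  have hne : b ≠ b + 1 + 1 := by omega
  refine .bind (T₁ := 10) (T₂ := 2) (.block (Q := fun σ' => σ'.intVar viDst = b + 3 ∧
    σ'.intVar viTmpB = σ.intArr aiQueue (b + 2) ∧ σ'.intArr aiQueue b = σ.intVar viDisk ∧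
    σ'.intArr aiQueue (b + 1) = σ.intArr aiQueue b ∧
    σ'.intArr aiQueue (b + 2) = σ.intArr aiQueue (b + 1) ∧
    ∀ x, x < b ∨ b + 4 ≤ x → σ'.intArr aiQueue x = σ.intArr aiQueue x) (by simp) (by simp) ?_)
    (fun σ₁ h₁ ⟨hdst, htmp, h₀, h₁', h₂, hold⟩ => ?_) le_rfl
  · refine ⟨by simp [Instr.exec, hb, hone], by
        simp [Instr.exec, hb, hone, setEntry_apply, hne.symm],
      by simp [Instr.exec, hb, hone, setEntry_apply, hne],
      by simp [Instr.exec, hb, hone, setEntry_apply],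
      by simp [Instr.exec, hb, hone, setEntry_apply], fun x hx => ?_⟩
    simp [Instr.exec, hb, hone, setEntry_apply, show x ≠ b by omega, show x ≠ b + 1 by omega,
      show x ≠ b + 1 + 1 by omega]
  · have hold' : ∀ x, x < b ∨ b + 4 ≤ x → x ≠ b + 3 := by omega
    refine .ite (T₁ := 1) (fun hlong => .block (by simp) (by simp) ?_)
      (fun hlong => .block (by simp) (by simp) ?_) le_rfl <;>
      simp (decide := true) only [Test.Holds, h₁.int, hone] at hlong <;>
      simp +contextual (decide := true) [Instr.exec, setEntry_apply, hdst, htmp, h₀, h₁', h₂, hlong,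
        h₁.int, hold, hold']

/-- Add one digit to the code. -/
def encodeStep : Prog :=
  block [.intLoad viTmp aiQueue viSrc, .intAdd viTmp viTmp viRow, .intLoad viTmp aiPow viTmp,
    .intAdd viCode viCode viTmp, .intAdd viRow viRow viBase, .intAdd viSrc viSrc viOne]

/-- Read the state at the end of the queue as a number. -/
def encode : Prog :=
  block [.intConst viCode 0, .intConst viRow 0, .intAdd viSrc viTailPos viZero,
    .intAdd viCopyCount viDigits viZero] ;;
  repeatN viCopyCount encodeStep

/-- The array `aiPow` holds the multiples of powers from which numbers with `L` digits in base `M`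
are put together. -/
def Store.HasPowers (σ : Store) (M L : ℕ) : Prop :=
  ∀ i < L, ∀ v < M, σ.intArr aiPow (i * M + v) = v * M ^ i

lemma encode_spec {σ : Store} {f : ℕ → ℕ} {L M : ℕ} (hconst : σ.HasConstants)
    (hbase : σ.intVar viBase = M) (hdigits : σ.intVar viDigits = L) (hpow : σ.HasPowers M L)
    (hqueue : ∀ i < L, σ.intArr aiQueue (σ.intVar viTailPos + i) = f i) (hf : ∀ i < L, f i < M) :
    HaltsWithin encode σ (8 * L + 5) fun σ' =>
      σ'.intVar viCode = Nat.ofDigits M ((List.range L).map f) := by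
  refine .bind (T₁ := 4) (T₂ := 8 * L + 1) (.block (Q := fun σ' =>
    σ'.intVar viSrc = σ.intVar viTailPos ∧ σ'.intVar viCode = 0 ∧ σ'.intVar viRow = 0 ∧
    σ'.intVar viCopyCount = L) (by simp) (by simp) (by simp [Instr.exec, hdigits, hconst.zero]))
    (fun σ₁ h₁ ⟨hsrc, hcode, hrow, hcount⟩ => ?_) (by omega)
  have hconst₁ := hconst.of_eqOff h₁
  refine (HaltsWithin.repeatN (T₁ := 6) (fun i σ' =>
    σ'.intVar viSrc = σ.intVar viTailPos + i ∧ σ'.intVar viRow = i * M ∧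
    σ'.intVar viCode = Nat.ofDigits M ((List.range i).map f)) hconst₁.one hcount rfl rfl
    (by simp [hsrc, hcode, hrow]) (fun i σ v h => by simpa using h)
    (fun i hi σ₂ h₂ ⟨hsrc, hrow, hcode⟩ => ?_) le_rfl).mono (by omega) fun _ _ h => h.2.2
  have hone := (hconst₁.of_eqOff h₂).one
  have hdigit : σ₂.intArr aiQueue (σ.intVar viTailPos + i) = f i := by
    rw [h₂.intArr _ rfl, h₁.intArr _ rfl, hqueue i hi]
  have hpow : σ₂.intArr aiPow (f i + i * M) = M ^ i * f i := by
    rw [h₂.intArr _ rfl, h₁.intArr _ rfl, add_comm, hpow i hi _ (hf i hi),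
      mul_comm]
  have hbase₂ : σ₂.intVar viBase = M := by rw [h₂.int _ rfl, h₁.int _ rfl, hbase]
  refine .block (by simp) (by simp) ⟨?_, ?_, ?_⟩
  · simp [Instr.exec, hsrc, hone, add_assoc]
  · simp [Instr.exec, hrow, hbase₂, add_one_mul]
  · simp [Instr.exec, hsrc, hrow, hcode, hdigit, hpow, List.range_succ, Nat.ofDigits_append]

/-- The memory of a partial solution as a single number. -/
def Strip.code (G : Strip) (s : PartialSolution) : ℕ :=
  Nat.ofDigits (G.m + 1) ((List.range (4 * G.k)).map (G.memory s))

lemma Strip.SameMemory.of_code_eq {G : Strip} {s s' : PartialSolution} {B : ℝ}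
    (hG : G.Admissible B) (hs : G.Reachable s) (hs' : G.Reachable s') (h : G.code s = G.code s') :
    G.SameMemory s s' := by
  rcases G.m.eq_zero_or_pos with hm | hm
  · intro i _
    have h₁ : G.memory s i ≤ G.m := hs.slot_le hG _ _
    have h₂ : G.memory s' i ≤ G.m := hs'.slot_le hG _ _
    omega
  refine fun i hi => List.map_inj_left.1 (Nat.ofDigits_inj_of_len_eq (Nat.succ_lt_succ hm) (by simp)
    ?_ ?_ h) i (List.mem_range.2 hi) <;>
    simp only [List.mem_map, forall_exists_index, and_imp, forall_apply_eq_imp_iff₂]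
  exacts [fun i _ => Nat.lt_succ_of_le (hs.slot_le hG _ _),
    fun i _ => Nat.lt_succ_of_le (hs'.slot_le hG _ _)]

lemma Strip.SameMemory.code_eq {G : Strip} {s s' : PartialSolution} (h : G.SameMemory s s') :
    G.code s = G.code s' := by
  rw [code, code, List.map_congr_left fun i hi => h i (List.mem_range.1 hi)]

/-- The part of the store that is constant while the strip `G` is searched. The strip is described
by the numbers of disks and colours, by its depth (`viLong` tells whether it is `4`), by the range
of ordinates of eligible disks, and by the list of the points in it. -/
structure Strip.Loaded (G : Strip) (σ : Store) : Prop extends σ.HasConstants where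
  admissible : G.Admissible (σ.realVar vrBound)
  numDisks : σ.intVar viM = G.m
  numColors : σ.intVar viK = G.k
  base : σ.intVar viBase = G.m + 1
  digits : σ.intVar viDigits = 4 * G.k
  four : σ.intVar viFour = 4
  long : 1 ≤ σ.intVar viLong ↔ G.depth = 4
  low : σ.realVar vrLow = G.lo - 1
  high : σ.realVar vrHigh = G.lo + G.height + 1
  abscissa : σ.realArr arCx = G.X
  ordinate : σ.realArr arCy = G.Y
  points : G.points = {p | ∃ i < σ.intVar viCount, p = σ.point (σ.intArr aiList i)}
  powers : σ.HasPowers (G.m + 1) (4 * G.k)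

/-- The pieces of memory to which `Strip.Loaded` refers. -/
def loadedCells : List Cell :=
  [.intVar viOne, .intVar viZero, .realVar vrOne, .realVar vrBound, .intVar viM, .intVar viK,
    .intVar viBase, .intVar viDigits, .intVar viFour, .intVar viLong, .realVar vrLow,
    .realVar vrHigh, .realArr arCx, .realArr arCy, .realArr arPx, .realArr arPy, .intVar viCount,
    .intArr aiList, .intArr aiPow]

lemma Strip.Loaded.of_eqOff {G : Strip} {p : Prog} {σ σ' : Store} (h : G.Loaded σ)
    (hσ : EqOff p σ σ') (hp : loadedCells.all (fun c => !p.writes c) = true := by rfl) :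
    G.Loaded σ' := by
  simp only [loadedCells, List.all_cons, List.all_nil, Bool.and_true, Bool.and_eq_true,
    Bool.not_eq_true'] at hp
  refine ⟨h.toHasConstants.of_eqOff hσ hp.1 hp.2.1 hp.2.2.1, ?_, ?_, ?_, ?_, ?_, ?_, ?_,
    ?_, ?_, ?_, ?_, ?_, ?_⟩ <;>
    simp only [hp, hσ.int, hσ.real, hσ.realArr, hσ.intArr, Store.HasPowers, Store.point]
  exacts [h.admissible, h.numDisks, h.numColors, h.base, h.digits, h.four, h.long, h.low, h.high,
    h.abscissa, h.ordinate, h.points, h.powers]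

/-- The queue holds the partial solutions `[] :: ss`. The array `aiSeen` marks the codes of `ss`
with the value of `viStamp`, and the other arrays hold the memory and the latest disk of each entry,
and the pair (disk, colour) and the entry from which it was made. -/
structure Strip.IsQueue (G : Strip) (ss : List PartialSolution) (σ : Store) : Prop where
  reachable : ∀ s ∈ ss, G.Reachable s
  tail : σ.intVar viTail = ss.length + 1
  tailPos : σ.intVar viTailPos = (ss.length + 1) * (4 * G.k)
  memory : ∀ e s, ([] :: ss)[e]? = some s → ∀ i < 4 * G.k,
    σ.intArr aiQueue (e * (4 * G.k) + i) = G.memory s i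
  latest : ∀ e s, ([] :: ss)[e]? = some s → σ.intArr aiDisk e = G.latest s
  parent : ∀ e s, ss[e]? = some s → σ.intArr aiParent (e + 1) ≤ e ∧
    ∃ s', ([] :: ss)[σ.intArr aiParent (e + 1)]? = some s' ∧
      s = (σ.intArr aiDisk (e + 1), σ.intArr aiCol (e + 1)) :: s'
  seen : ∀ c, σ.intArr aiSeen c = σ.intVar viStamp ↔ c ∈ ss.map G.code
  seen_le : ∀ c, σ.intArr aiSeen c ≤ σ.intVar viStamp
  nodup : (ss.map G.code).Nodup

/-- The partial solution `s` is at the head of the queue `[] :: ss`. -/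
structure Strip.Searching (G : Strip) (ss : List PartialSolution) (s : PartialSolution)
    (σ : Store) : Prop extends G.Loaded σ, G.IsQueue ss σ where
  head : ([] :: ss)[σ.intVar viHead]? = some s
  headPos : σ.intVar viHeadPos = σ.intVar viHead * (4 * G.k)

/-- The pieces of memory, apart from the entries of the queue, to which `Strip.IsQueue` refers. -/
def queueCells : List Cell :=
  [.intVar viTail, .intVar viTailPos, .intArr aiDisk, .intArr aiParent, .intArr aiCol,
    .intArr aiSeen, .intVar viStamp]

section

variable {α : Type} {l l' : List α} {x y : α} {e : ℕ}

lemma getElem?_concat_eq_some :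
    (l ++ [x])[e]? = some y ↔ l[e]? = some y ∨ e = l.length ∧ x = y := by
  grind

lemma getElem?_eq_some_mono (h : l <+: l') (he : l[e]? = some x) : l'[e]? = some x := by
  obtain ⟨t, rfl⟩ := h
  rw [List.getElem?_append_left (List.getElem?_eq_some_iff.1 he).1, he]

lemma take_succ_of_prefix_of_getElem? (h : l <+: l') (he : l[e]? = some x) :
    l'.take (e + 1) = l.take e ++ [x] := by
  obtain ⟨t, rfl⟩ := h
  rw [List.take_append_of_le_length (List.getElem?_eq_some_iff.1 he).1, List.take_add_one, he]
  rfl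

end

section

variable {G : Strip} {ss ss' : List PartialSolution} {s t : PartialSolution} {p : Prog}
  {σ σ' : Store}

namespace Strip

lemma IsQueue.of_eqOff_of_eqOn (h : G.IsQueue ss σ) (hσ : EqOff p σ σ')
    (hqueue : ∀ x < σ.intVar viTailPos, σ'.intArr aiQueue x = σ.intArr aiQueue x)
    (hp : queueCells.all (fun c => !p.writes c) = true := by rfl) : G.IsQueue ss σ' := by
  simp only [queueCells, List.all_cons, List.all_nil, Bool.and_true, Bool.and_eq_true,
    Bool.not_eq_true'] at hp
  refine ⟨h.reachable, ?_, ?_, fun e s hs i hi => ?_, ?_, ?_, ?_, ?_, h.nodup⟩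
  case refine_3 =>
    rw [hqueue _ ?_, h.memory e s hs i hi]
    have he : e < ss.length + 1 := (List.getElem?_eq_some_iff.1 hs).1
    calc e * (4 * G.k) + i < (e + 1) * (4 * G.k) := by rw [add_one_mul]; omega
      _ ≤ _ := by rw [h.tailPos]; gcongr; omega
  all_goals simp only [hp, hσ.int, hσ.intArr]
  exacts [h.tail, h.tailPos, h.latest, h.parent, h.seen, h.seen_le]

lemma IsQueue.of_eqOff (h : G.IsQueue ss σ) (hσ : EqOff p σ σ')
    (hqueue : p.writes (.intArr aiQueue) = false := by rfl)
    (hp : queueCells.all (fun c => !p.writes c) = true := by rfl) : G.IsQueue ss σ' :=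
  h.of_eqOff_of_eqOn hσ (fun _ _ => by rw [hσ.intArr _ hqueue]) hp

namespace Searching

lemma of_eqOff_of_eqOn (h : G.Searching ss s σ) (hσ : EqOff p σ σ')
    (hqueue : ∀ x < σ.intVar viTailPos, σ'.intArr aiQueue x = σ.intArr aiQueue x)
    (hp : (loadedCells ++ queueCells).all (fun c => !p.writes c) = true := by rfl)
    (hhead : p.writes (.intVar viHead) = false := by rfl)
    (hheadPos : p.writes (.intVar viHeadPos) = false := by rfl) : G.Searching ss s σ' := by
  rw [List.all_append, Bool.and_eq_true] at hp
  refine ⟨h.toLoaded.of_eqOff hσ hp.1, h.toIsQueue.of_eqOff_of_eqOn hσ hqueue hp.2, ?_, ?_⟩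
  · rw [hσ.int _ hhead, h.head]
  · rw [hσ.int _ hhead, hσ.int _ hheadPos, h.headPos]

lemma of_eqOff (h : G.Searching ss s σ) (hσ : EqOff p σ σ')
    (hqueue : p.writes (.intArr aiQueue) = false := by rfl)
    (hp : (loadedCells ++ queueCells).all (fun c => !p.writes c) = true := by rfl)
    (hhead : p.writes (.intVar viHead) = false := by rfl)
    (hheadPos : p.writes (.intVar viHeadPos) = false := by rfl) : G.Searching ss s σ' :=
  h.of_eqOff_of_eqOn hσ (fun _ _ => by rw [hσ.intArr _ hqueue]) hp hhead hheadPos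

lemma reachable_head (h : G.Searching ss s σ) : G.Reachable s := by
  rcases List.mem_cons.1 (List.mem_of_getElem? h.head) with rfl | hs
  exacts [.nil, h.reachable s hs]

lemma head_lt (h : G.Searching ss s σ) : σ.intVar viHead < ss.length + 1 :=
  (List.getElem?_eq_some_iff.1 h.head).1

lemma queue_headPos (h : G.Searching ss s σ) {i : ℕ} (hi : i < 4 * G.k) :
    σ.intArr aiQueue (σ.intVar viHeadPos + i) = G.memory s i := by
  rw [h.headPos, h.memory _ _ h.head i hi]

lemma headPos_add_le (h : G.Searching ss s σ) :
    σ.intVar viHeadPos + 4 * G.k ≤ σ.intVar viTailPos := by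
  rw [h.headPos, h.tailPos, ← add_one_mul]
  exact Nat.mul_le_mul_right _ h.head_lt

end Searching

end Strip

/-- Enter the new state into the queue. -/
def append : Prog :=
  block [.intStore aiSeen viCode viStamp, .intStore aiDisk viTail viDisk,
    .intStore aiCol viTail viCol, .intStore aiParent viTail viHead, .intAdd viTail viTail viOne,
    .intAdd viTailPos viTailPos viDigits]

lemma append_spec (h : G.Searching ss s σ) (ht : t = (σ.intVar viDisk, σ.intVar viCol) :: s)
    (hreachable : G.Reachable t)
    (hmemory : ∀ i < 4 * G.k, σ.intArr aiQueue (σ.intVar viTailPos + i) = G.memory t i)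
    (hcode : σ.intVar viCode = G.code t) (hnew : σ.intArr aiSeen (G.code t) ≠ σ.intVar viStamp) :
    HaltsWithin append σ 6 (G.Searching (ss ++ [t]) s) := by
  refine (HaltsWithin.block (Q := G.IsQueue (ss ++ [t])) (by simp) (by simp)
    ⟨?_, ?_, ?_, fun e u hu i hi => ?_, fun e u hu => ?_, fun e u hu => ?_, fun c => ?_,
    fun c => ?_, ?_⟩).mono le_rfl fun σ' h' hqueue => ⟨h.toLoaded.of_eqOff h', hqueue, ?_, ?_⟩
  · simpa [or_imp, forall_and, hreachable] using h.reachable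
  · simp [Instr.exec, h.tail, h.one]
  · simp [Instr.exec, h.tailPos, h.digits, add_one_mul]
  · rw [← List.cons_append, getElem?_concat_eq_some] at hu
    rcases hu with hu | ⟨rfl, rfl⟩
    · simp [Instr.exec, setEntry_apply, h.memory e u hu i hi]
    · simp [Instr.exec, setEntry_apply, ← hmemory i hi, h.tailPos]
  · rw [← List.cons_append, getElem?_concat_eq_some] at hu
    rcases hu with hu | ⟨rfl, rfl⟩
    · have he : e ≠ ss.length + 1 := (List.getElem?_eq_some_iff.1 hu).1.ne
      simp [Instr.exec, setEntry_apply, h.tail, he, h.latest e u hu]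
    · simp [Instr.exec, setEntry_apply, h.tail, ht, Strip.latest]
  · have hlift : ∀ {i v}, ([] :: ss)[i]? = some v → ([] :: (ss ++ [t]))[i]? = some v :=
      getElem?_eq_some_mono (List.prefix_append _ _)
    rcases getElem?_concat_eq_some.1 hu with hu | ⟨rfl, rfl⟩
    · have he : e ≠ ss.length := (List.getElem?_eq_some_iff.1 hu).1.ne
      obtain ⟨hle, u', hu', hcons⟩ := h.parent e u hu
      simpa [Instr.exec, setEntry_apply, h.tail, he, hle] using ⟨u', hlift hu', hcons⟩
    · have hle : σ.intVar viHead ≤ ss.length := Nat.lt_succ_iff.1 h.head_lt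
      simpa [Instr.exec, setEntry_apply, h.tail, hle] using ⟨s, hlift h.head, ht⟩
  · have hseen := h.seen c
    rw [List.mem_map] at hseen
    by_cases hc : c = G.code t <;>
      simp [Instr.exec, setEntry_apply, hcode, hc, hseen, eq_comm]
  · by_cases hc : c = G.code t <;> simp [Instr.exec, setEntry_apply, hcode, hc, h.seen_le]
  · rw [List.map_append, List.nodup_append']
    exact ⟨h.nodup, by simp, by simpa using mt (h.seen _).2 hnew⟩
  · rw [h'.int _ rfl, ← List.cons_append, getElem?_concat_eq_some]
    exact .inl h.head
  · rw [h'.int _ rfl, h'.int _ rfl, h.headPos]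

/-- Make the state obtained from the one at the head of the queue by adding the current disk with
the current colour. -/
def extendState : Prog := copyState ;; shiftState

lemma extendState_spec (h : G.Searching ss s σ) (hcol : σ.intVar viCol < G.k)
    (hfour : σ.intVar viColFour = 4 * σ.intVar viCol) :
    HaltsWithin extendState σ (24 * G.k + 16) fun σ' =>
      (∀ i < 4 * G.k, σ'.intArr aiQueue (σ.intVar viTailPos + i) =
        G.memory ((σ.intVar viDisk, σ.intVar viCol) :: s) i) ∧
      ∀ x < σ.intVar viTailPos, σ'.intArr aiQueue x = σ.intArr aiQueue x := by
  refine .bind (T₂ := 12)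
    (copyState_spec h.toHasConstants (by rw [h.digits]; exact h.headPos_add_le))
    (fun σ₁ h₁ ⟨hcopy, hold⟩ => ?_) (by rw [h.digits]; omega)
  rw [h.digits] at hcopy
  refine (shiftState_spec (b := σ.intVar viTailPos + 4 * σ.intVar viCol)
    (h.toHasConstants.of_eqOff h₁).one (by rw [h₁.int _ rfl, h₁.int _ rfl, hfour])).mono le_rfl
    fun σ₂ _ ⟨h0, h1, h2, h3, hold'⟩ => ⟨fun i hi => ?_, fun x hx => by
      rw [hold' x (.inl (by omega)), hold x hx]⟩
  have hslot : ∀ t < 4, σ₁.intArr aiQueue (σ.intVar viTailPos + 4 * σ.intVar viCol + t) =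
      G.slot s (σ.intVar viCol) t := fun t ht => by
    rw [add_assoc, hcopy _ (by omega), h.queue_headPos (by omega), Strip.memory_mul_add ht]
  rw [h₁.int _ rfl] at h0
  rw [h₁.int _ rfl, h₁.int _ rfl, hslot 2 (by norm_num), h.numDisks] at h3
  rw [hslot 1 (by norm_num)] at h2
  replace h1 := h1.trans (hslot 0 (by norm_num))
  have hdepth := h.admissible.three_le_depth
  have hdepth' := h.admissible.depth_le_four
  have hlong := h.long
  by_cases hj : i / 4 = σ.intVar viCol
  · rw [Strip.memory, Strip.slot_cons, if_pos hj]
    obtain ⟨t, ht, rfl⟩ : ∃ t < 4, i = 4 * σ.intVar viCol + t := ⟨i % 4, by omega, by omega⟩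
    rw [← add_assoc, show (4 * σ.intVar viCol + t) % 4 = t by omega]
    interval_cases t
    · simpa [show 0 < G.depth by omega] using h0
    · simpa [show 1 < G.depth by omega] using h1
    · simpa [show 2 < G.depth by omega] using h2
    · simp [h3, hlong, show 3 < G.depth ↔ G.depth = 4 by omega]
  · rw [hold' _ (by omega), hcopy i hi, h.queue_headPos hi, Strip.memory, Strip.memory,
      Strip.slot_cons, if_neg hj]

/-- Enter the state obtained by adding the current disk with the current colour, unless it has been
entered before. -/
def push : Prog :=
  extendState ;; encode ;; block [.intLoad viTmp aiSeen viCode] ;;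
    .ite (.intLe viStamp viTmp) skip append

/-- Some entry of the queue has the same memory as `t`. -/
def Strip.Found (G : Strip) (ss : List PartialSolution) (t : PartialSolution) : Prop :=
  ∃ t' ∈ [] :: ss, G.SameMemory t' t

lemma Strip.Found.mono (h : G.Found ss t) (hss : ss <+: ss') : G.Found ss' t := by
  obtain ⟨t', ht', hmem⟩ := h
  exact ⟨t', List.cons_subset_cons _ hss.subset ht', hmem⟩

lemma Strip.IsQueue.found_of_stamp_le {B : ℝ} (h : G.IsQueue ss σ) (hG : G.Admissible B)
    (ht : G.Reachable t) (hc : σ.intVar viStamp ≤ σ.intArr aiSeen (G.code t)) : G.Found ss t := by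
  obtain ⟨t', ht', hcode⟩ := List.mem_map.1 ((h.seen _).1 (le_antisymm (h.seen_le _) hc))
  exact ⟨t', List.mem_cons_of_mem _ ht', .of_code_eq hG (h.reachable t' ht') ht hcode⟩

/-- The queue `[] :: ss` has been enlarged so that it represents all extensions of the partial
solution `s` at its head by allowed pairs in `Q`. -/
def Strip.Explored (G : Strip) (ss : List PartialSolution) (s : PartialSolution)
    (Q : Set (ℕ × ℕ)) (σ : Store) : Prop :=
  ∃ ss', ss <+: ss' ∧ G.Searching ss' s σ ∧
    ∀ q ∈ Q, G.Allowed s q.1 q.2 → G.Found ss' (q :: s)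

namespace Strip

variable {Q Q' : Set (ℕ × ℕ)}

lemma Searching.explored (h : G.Searching ss s σ) (hQ : ∀ q ∈ Q, ¬ G.Allowed s q.1 q.2) :
    G.Explored ss s Q σ :=
  ⟨ss, List.prefix_rfl, h, fun q hq ha => absurd ha (hQ q hq)⟩

lemma Explored.of_eqOff (h : G.Explored ss s Q σ) (hσ : EqOff p σ σ')
    (hqueue : p.writes (.intArr aiQueue) = false := by rfl)
    (hp : (loadedCells ++ queueCells).all (fun c => !p.writes c) = true := by rfl)
    (hhead : p.writes (.intVar viHead) = false := by rfl)
    (hheadPos : p.writes (.intVar viHeadPos) = false := by rfl) : G.Explored ss s Q σ' := by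
  obtain ⟨ss', hss, hS, hfound⟩ := h
  exact ⟨ss', hss, hS.of_eqOff hσ hqueue hp hhead hheadPos, hfound⟩

lemma Searching.skip_spec (h : G.Searching ss s σ) (hQ : ∀ q ∈ Q, ¬ G.Allowed s q.1 q.2) {T : ℕ}
    (hT : 1 ≤ T) : HaltsWithin skip σ T (G.Explored ss s Q) :=
  (HaltsWithin.skip (Q := fun _ => True) hT trivial).mono le_rfl fun _ hσ _ =>
    (h.of_eqOff hσ).explored hQ

lemma Explored.union (h : G.Explored ss' s Q' σ) (hss : ss <+: ss')
    (hQ : ∀ q ∈ Q, G.Allowed s q.1 q.2 → G.Found ss' (q :: s)) : G.Explored ss s (Q ∪ Q') σ := by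
  obtain ⟨ss'', hss', hS, hfound⟩ := h
  refine ⟨ss'', hss.trans hss', hS, ?_⟩
  rintro q (hq | hq) ha
  exacts [(hQ q hq ha).mono hss', hfound q hq ha]

lemma Explored.mono (h : G.Explored ss s Q σ)
    (hQ : ∀ q ∈ Q', G.Allowed s q.1 q.2 → q ∈ Q) : G.Explored ss s Q' σ := by
  obtain ⟨ss', hss, hS, hfound⟩ := h
  exact ⟨ss', hss, hS, fun q hq ha => hfound q (hQ q hq ha) ha⟩

end Strip

lemma push_spec (h : G.Searching ss s σ) (hfour : σ.intVar viColFour = 4 * σ.intVar viCol)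
    (ha : G.Allowed s (σ.intVar viDisk) (σ.intVar viCol)) :
    HaltsWithin push σ (56 * G.k + 29)
      (G.Explored ss s {(σ.intVar viDisk, σ.intVar viCol)}) := by
  set t := (σ.intVar viDisk, σ.intVar viCol) :: s with ht
  have htr : G.Reachable t := .cons h.reachable_head ha
  refine .bind (T₂ := 32 * G.k + 13) (extendState_spec h ha.color hfour)
    (fun σ₁ h₁ ⟨hnew, hold⟩ => ?_) (by omega)
  have hS₁ := h.of_eqOff_of_eqOn h₁ hold
  rw [← h₁.int viTailPos rfl, ← ht] at hnew
  refine .bind (T₂ := 8) (encode_spec hS₁.toHasConstants hS₁.base hS₁.digits hS₁.powers hnew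
    fun i _ => Nat.lt_succ_of_le (htr.slot_le h.admissible _ _)) (fun σ₂ h₂ hcode => ?_) (by omega)
  have hS₂ := hS₁.of_eqOff h₂
  refine .bind (T₁ := 1) (T₂ := 7) (.block (Q := fun σ' =>
    σ'.intVar viTmp = σ₂.intArr aiSeen (G.code t)) (by simp) (by simp)
    (by simp [Instr.exec, hcode, Strip.code])) (fun σ₃ h₃ htmp => ?_) le_rfl
  have hS₃ := hS₂.of_eqOff h₃
  refine .ite (T₁ := 6) (fun hb => ?_) (fun hb => ?_) le_rfl <;>
    rw [Test.Holds, htmp, ← h₃.intArr _ rfl] at hb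
  · exact (HaltsWithin.skip (Q := fun _ => True) (by norm_num) trivial).mono le_rfl
      fun σ₄ h₄ _ => ⟨ss, List.prefix_rfl, hS₃.of_eqOff h₄,
        by rintro _ rfl _; exact hS₃.found_of_stamp_le h.admissible htr hb⟩
  · refine (append_spec hS₃ (t := t) ?_ htr (fun i hi => ?_) ?_ (by omega)).mono le_rfl
      fun σ₄ _ h₄ => ⟨_, List.prefix_append _ _, h₄, by
        rintro _ rfl _; exact ⟨t, by simp, fun _ _ => rfl⟩⟩
    · simp (decide := true) only [ht, h₃.int, h₂.int, h₁.int]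
    · simpa (decide := true) only [h₃.int, h₃.intArr, h₂.int, h₂.intArr] using hnew i hi
    · rw [h₃.int _ rfl, hcode, Strip.code]

/-- Decide whether a remembered disk of the current colour intersects the current disk. -/
def findConflict : Prog :=
  block [.intAdd viNearIdx viHeadPos viColFour, .intAdd viNearCount viFour viZero,
    .realConst vrRad 4, .realLoad vrUx arCx viDisk, .realLoad vrUy arCy viDisk] ;; near

lemma findConflict_spec (h : G.Searching ss s σ) (hcol : σ.intVar viCol < G.k)
    (hfour : σ.intVar viColFour = 4 * σ.intVar viCol) :
    HaltsWithin findConflict σ 59 fun σ' => 1 ≤ σ'.intVar viFlag ↔ ∃ t < 4,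
      sqDist (G.center (G.slot s (σ.intVar viCol) t)) (G.center (σ.intVar viDisk)) ≤ 4 := by
  have hcenter : ∀ d, σ.center d = G.center d := fun d => by
    rw [Store.center, h.abscissa, h.ordinate, Strip.center]
  refine .bind (T₁ := 5) (T₂ := 54) (.block (Q := fun σ' =>
    σ'.intVar viNearIdx = σ.intVar viHeadPos + 4 * σ.intVar viCol ∧ σ'.intVar viNearCount = 4 ∧
    σ'.realVar vrRad = 4 ∧ (σ'.realVar vrUx, σ'.realVar vrUy) = G.center (σ.intVar viDisk))
    (by simp) (by simp) ?_) (fun σ₁ h₁ ⟨hidx, hcount, hrad, hu⟩ => ?_) le_rfl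
  · simp [Instr.exec, hfour, h.four, h.zero, ← hcenter, Store.center]
  · refine (near_spec (h.toHasConstants.of_eqOff h₁).one hcount hidx).mono le_rfl
      fun σ₂ _ hnear => hnear.trans (exists_congr fun t => and_congr_right fun ht => ?_)
    rw [hu, hrad, h₁.intArr _ rfl, add_assoc, h.queue_headPos (by omega),
      Strip.memory_mul_add ht, ← hcenter, ← hcenter]
    simp (decide := true) only [Store.center, h₁.realArr]

/-- Try to add the current disk with the current colour. -/
def tryColor : Prog := findConflict ;; .ite (.intLe viOne viFlag) skip push

lemma tryColor_spec (h : G.Searching ss s σ)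
    (heligible : G.Eligible (σ.intVar viDisk, σ.intVar viCol))
    (hright : G.X (G.latest s) ≤ G.X (σ.intVar viDisk))
    (hcovered : G.CoveredBefore s (G.X (σ.intVar viDisk)))
    (hfour : σ.intVar viColFour = 4 * σ.intVar viCol) :
    HaltsWithin tryColor σ (56 * G.k + 89)
      (G.Explored ss s {(σ.intVar viDisk, σ.intVar viCol)}) := by
  refine .bind (T₂ := 56 * G.k + 30) (findConflict_spec h heligible.color hfour)
    (fun σ₁ h₁ hconflict => ?_) (by omega)
  have hS₁ := h.of_eqOff h₁
  refine .ite (T₁ := 56 * G.k + 29) (fun hb => ?_) (fun hb => ?_) le_rfl <;>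
    rw [Test.Holds, hS₁.one, hconflict] at hb
  · obtain ⟨t, ht, hnear⟩ := hb
    exact hS₁.skip_spec (by rintro _ rfl ha; exact (ha.far t ht).not_ge hnear) (by omega)
  · push Not at hb
    rw [← h₁.int viDisk rfl, ← h₁.int viCol rfl] at heligible hb ⊢
    rw [← h₁.int viDisk rfl] at hright hcovered
    exact push_spec hS₁ (by rw [h₁.int _ rfl, h₁.int _ rfl, hfour])
      ⟨heligible, hright, hcovered, hb⟩

end

/-! ### The program: the search through the queue -/

/-- Try to add the current disk with the current colour, and go on to the next colour. -/
def tryColorStep : Prog :=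
  tryColor ;; block [.intAdd viCol viCol viOne, .intAdd viColFour viColFour viFour]

/-- Try to add the current disk with each colour. -/
def tryColors : Prog :=
  block [.intConst viCol 0, .intConst viColFour 0, .intAdd viColCount viK viZero] ;;
  repeatN viColCount tryColorStep

/-- Try to add the current disk, which is eligible and right of the head, with each colour. -/
def tryEligible : Prog := checkPoints ;; .ite (.intLe viOne viOk) tryColors skip

/-- Try to add the current disk with each colour, and go on to the next disk. -/
def tryDisk : Prog :=
  block [.realLoad vrLim arCx viDisk, .realLoad vrY arCy viDisk] ;;
  .ite (.realLe vrLow vrY) (.ite (.realLe vrY vrHigh)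
    (.ite (.realLe vrCur vrLim) tryEligible skip) skip) skip ;;
  block [.intAdd viDisk viDisk viOne]

section

variable {G : Strip} {ss : List PartialSolution} {s : PartialSolution} {σ : Store}

lemma tryColorStep_spec (h : G.Searching ss s σ)
    (heligible : G.Eligible (σ.intVar viDisk, σ.intVar viCol))
    (hright : G.X (G.latest s) ≤ G.X (σ.intVar viDisk))
    (hcovered : G.CoveredBefore s (G.X (σ.intVar viDisk)))
    (hfour : σ.intVar viColFour = 4 * σ.intVar viCol) :
    HaltsWithin tryColorStep σ (56 * G.k + 91) fun σ' =>
      σ'.intVar viCol = σ.intVar viCol + 1 ∧ σ'.intVar viColFour = 4 * (σ.intVar viCol + 1) ∧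
      G.Explored ss s {(σ.intVar viDisk, σ.intVar viCol)} σ' := by
  refine .bind (T₂ := 2) (tryColor_spec h heligible hright hcovered hfour)
    (fun σ₁ h₁ hS₁ => ?_) le_rfl
  refine (HaltsWithin.block (Q := fun σ' => σ'.intVar viCol = σ.intVar viCol + 1 ∧
    σ'.intVar viColFour = 4 * (σ.intVar viCol + 1)) (by simp) (by simp) ?_).mono le_rfl
    fun σ₂ h₂ ⟨hcol, hfour'⟩ => ⟨hcol, hfour', hS₁.of_eqOff h₂⟩
  simp (decide := true) [Instr.exec, h₁.int, h.one, h.four, hfour, mul_add]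

lemma tryColors_spec (h : G.Searching ss s σ)
    (heligible : ∀ j < G.k, G.Eligible (σ.intVar viDisk, j))
    (hright : G.X (G.latest s) ≤ G.X (σ.intVar viDisk))
    (hcovered : G.CoveredBefore s (G.X (σ.intVar viDisk))) :
    HaltsWithin tryColors σ (G.k * (56 * G.k + 93) + 4)
      (G.Explored ss s {q | q.1 = σ.intVar viDisk}) := by
  refine .bind (T₁ := 3) (T₂ := G.k * (56 * G.k + 93) + 1) (.block (Q := fun σ' =>
    σ'.intVar viCol = 0 ∧ σ'.intVar viColFour = 0 ∧ σ'.intVar viColCount = G.k)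
    (by simp) (by simp) (by simp [Instr.exec, h.zero, h.numColors]))
    (fun σ₁ h₁ ⟨hcol, hfour, hcount⟩ => ?_) (by omega)
  have hS₁ := h.of_eqOff h₁
  refine (HaltsWithin.repeatN (T₁ := 56 * G.k + 91) (fun j σ' => σ'.intVar viCol = j ∧
    σ'.intVar viColFour = 4 * j ∧ G.Explored ss s {q | q.1 = σ.intVar viDisk ∧ q.2 < j} σ')
    hS₁.one hcount rfl rfl ⟨hcol, hfour, hS₁.explored (by simp)⟩ ?_ ?_ le_rfl).mono le_rfl
    fun σ₂ _ hS₂ => hS₂.2.2.mono fun q hq ha => ⟨hq, ha.color⟩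
  · rintro j σ' v ⟨hcol, hfour, hS⟩
    exact ⟨by simpa using hcol, by simpa using hfour,
      hS.of_eqOff (Instr.eqOff_exec (.intConst viColCount v) _)⟩
  · rintro j hj σ₂ h₂ ⟨hcol, hfour, hS₂⟩
    have hdisk : σ₂.intVar viDisk = σ.intVar viDisk := by rw [h₂.int _ rfl, h₁.int _ rfl]
    obtain ⟨ss', hss, hS', hfound⟩ := hS₂
    rw [← hdisk] at heligible hright hcovered ⊢
    refine (tryColorStep_spec hS' (hcol ▸ heligible j hj) hright hcovered (by rw [hfour, hcol]))
      |>.mono le_rfl fun σ₃ _ ⟨hcol', hfour', hS₃⟩ => ⟨by rw [hcol', hcol], by rw [hfour', hcol],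
        (hS₃.union hss (by simpa only [hdisk] using hfound)).mono ?_⟩
    rintro ⟨d, i⟩ ⟨hd, hi⟩ -
    rcases Nat.lt_succ_iff_lt_or_eq.1 hi with hi | hi
    exacts [.inl ⟨hd.trans hdisk, hi⟩, .inr (Prod.ext hd (hi.trans hcol.symm))]

lemma Strip.Searching.forall_headCovers_iff (h : G.Searching ss s σ)
    (hcur : σ.realVar vrCur = G.X (G.latest s)) :
    (∀ i < σ.intVar viCount, σ.HeadCovers (σ.point (σ.intArr aiList i))) ↔
      G.CoveredBefore s (σ.realVar vrLim) := by
  have hcenter : ∀ d, σ.center d = G.center d := fun d => by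
    rw [Store.center, h.abscissa, h.ordinate, Strip.center]
  have hcovers : ∀ p, σ.HeadCovers p ↔ (G.X (G.latest s) ≤ p.1 + 1 → p.1 + 1 < σ.realVar vrLim →
      ∃ i < 4 * G.k, sqDist (G.center (G.memory s i)) p ≤ 1) := fun p => by
    rw [Store.HeadCovers, hcur, h.digits]
    refine forall₂_congr fun _ _ => exists_congr fun i => and_congr_right fun hi => ?_
    rw [hcenter, h.queue_headPos hi]
  simp only [hcovers, Strip.CoveredBefore, h.points, Set.mem_ofPred_eq, forall_exists_index,
    and_imp]
  exact ⟨by rintro hall _ i hi rfl; exact hall i hi, fun hall i hi => hall _ i hi rfl⟩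

lemma checkPoints_head_spec (h : G.Searching ss s σ) (hcur : σ.realVar vrCur = G.X (G.latest s)) :
    HaltsWithin checkPoints σ (σ.intVar viCount * (52 * G.k + 16) + 4) fun σ' =>
      1 ≤ σ'.intVar viOk ↔ G.CoveredBefore s (σ.realVar vrLim) :=
  (checkPoints_spec h.toHasConstants).mono
    (by rw [h.digits, show 13 * (4 * G.k) = 52 * G.k by ring])
    fun _ _ hok => hok.trans (h.forall_headCovers_iff hcur)

lemma tryEligible_spec (h : G.Searching ss s σ) (hcur : σ.realVar vrCur = G.X (G.latest s))
    (hlim : σ.realVar vrLim = G.X (σ.intVar viDisk))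
    (heligible : ∀ j < G.k, G.Eligible (σ.intVar viDisk, j))
    (hright : G.X (G.latest s) ≤ G.X (σ.intVar viDisk)) :
    HaltsWithin tryEligible σ (σ.intVar viCount * (52 * G.k + 16) + G.k * (56 * G.k + 93) + 9)
      (G.Explored ss s {q | q.1 = σ.intVar viDisk}) := by
  refine .bind (T₂ := G.k * (56 * G.k + 93) + 5) (checkPoints_head_spec h hcur)
    (fun σ₁ h₁ hok => ?_) (by omega)
  have hS₁ := h.of_eqOff h₁
  refine .ite (T₁ := G.k * (56 * G.k + 93) + 4) (fun hb => ?_) (fun hb => ?_) le_rfl <;>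
    rw [Test.Holds, hS₁.one, hok, hlim, ← h₁.int viDisk rfl] at hb <;>
    rw [← h₁.int viDisk rfl] at heligible hright ⊢
  · exact tryColors_spec hS₁ heligible hright hb
  · exact hS₁.skip_spec (by rintro ⟨d, j⟩ rfl ha; exact hb ha.covered) (by omega)

/-- A bound for the time of one round of `tryDisk`, for `cnt` points in the strip. -/
def tryDiskTime (k cnt : ℕ) : ℕ := cnt * (52 * k + 16) + k * (56 * k + 93) + 15

lemma tryDisk_spec (h : G.Searching ss s σ) (hcur : σ.realVar vrCur = G.X (G.latest s))
    (hdisk : σ.intVar viDisk < G.m) :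
    HaltsWithin tryDisk σ (tryDiskTime G.k (σ.intVar viCount)) fun σ' =>
      σ'.intVar viDisk = σ.intVar viDisk + 1 ∧
      G.Explored ss s {q | q.1 = σ.intVar viDisk} σ' := by
  set T := σ.intVar viCount * (52 * G.k + 16) + G.k * (56 * G.k + 93) + 9 with hT
  refine .bind (T₁ := 2) (T₂ := T + 4) (.block (Q := fun σ' =>
    σ'.realVar vrLim = G.X (σ.intVar viDisk) ∧ σ'.realVar vrY = G.Y (σ.intVar viDisk))
    (by simp) (by simp) (by simp [Instr.exec, h.abscissa, h.ordinate]))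
    (fun σ₁ h₁ ⟨hlim, hy⟩ => ?_) (by rw [tryDiskTime]; omega)
  have hS₁ := h.of_eqOff h₁
  rw [← h₁.int viDisk rfl] at hdisk hlim hy ⊢
  rw [← h₁.real vrCur rfl] at hcur
  rw [← h₁.int viCount rfl] at hT
  refine .bind (T₁ := T + 3) (T₂ := 1) (P := G.Explored ss s {q | q.1 = σ₁.intVar viDisk}) ?_
    (fun σ₂ h₂ hS₂ => ?_) le_rfl
  · refine .ite (T₁ := T + 2) (fun hlow => ?_) (fun hlow => ?_) le_rfl <;>
      rw [Test.Holds, hS₁.low, hy] at hlow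
    swap
    · exact hS₁.skip_spec (by rintro ⟨d, j⟩ rfl ha; exact hlow ha.low) (by omega)
    refine .ite (T₁ := T + 1) (fun hhigh => ?_) (fun hhigh => ?_) le_rfl <;>
      rw [Test.Holds, hS₁.high, hy] at hhigh
    swap
    · exact hS₁.skip_spec (by rintro ⟨d, j⟩ rfl ha; exact hhigh ha.high) (by omega)
    refine .ite (T₁ := T) (fun hright => ?_) (fun hright => ?_) le_rfl <;>
      rw [Test.Holds, hcur, hlim] at hright
    swap
    · exact hS₁.skip_spec (by rintro ⟨d, j⟩ rfl ha; exact hright ha.right) (by omega)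
    exact (tryEligible_spec hS₁ hcur hlim (fun j hj => ⟨hdisk, hj, hlow, hhigh⟩) hright).mono
      hT.ge fun _ _ h => h
  · refine (HaltsWithin.block (Q := fun σ' => σ'.intVar viDisk = σ₁.intVar viDisk + 1) (by simp)
      (by simp) ?_).mono le_rfl fun σ₃ h₃ hdisk => ⟨hdisk, hS₂.of_eqOff h₃⟩
    simp (decide := true) [Instr.exec, h₂.int, hS₁.one]

lemma Strip.length_le_of_nodup_code {B : ℝ} (hG : G.Admissible B)
    (hreachable : ∀ s ∈ ss, G.Reachable s) (hnodup : (ss.map G.code).Nodup) :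
    ss.length ≤ (G.m + 1) ^ (G.depth * G.k) := by
  let F : PartialSolution → (Fin G.depth × Fin G.k → Fin (G.m + 1)) := fun s x =>
    Fin.ofNat (G.m + 1) (G.slot s x.2 x.1)
  have hF : ∀ s ∈ ss, ∀ s' ∈ ss, F s = F s' → s = s' := fun s hs s' hs' h => by
    refine List.inj_on_of_nodup_map hnodup hs hs' (SameMemory.code_eq fun i hi => ?_)
    by_cases hlt : i % 4 < G.depth
    · have hval := congrArg Fin.val (congrFun h (⟨i % 4, hlt⟩, ⟨i / 4, by omega⟩))
      simp only [F, Fin.val_ofNat, Nat.mod_eq_of_lt (Nat.lt_succ_of_le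
        ((hreachable _ hs).slot_le hG _ _)), Nat.mod_eq_of_lt (Nat.lt_succ_of_le
        ((hreachable _ hs').slot_le hG _ _))] at hval
      exact hval
    · simp only [memory, slot, if_neg hlt]
  have hcard := ((List.nodup_map_iff_inj_on hnodup.of_map).2 hF).length_le_card
  rwa [List.length_map, Fintype.card_fun, Fintype.card_prod, Fintype.card_fin, Fintype.card_fin,
    Fintype.card_fin] at hcard

/-- Entry `e` of the queue `[] :: ss` solves the strip. -/
def Strip.Accepts (G : Strip) (B : ℝ) (ss : List PartialSolution) (e : ℕ) : Prop :=
  ∃ s, ([] :: ss)[e]? = some s ∧ G.CoveredBefore s B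

/-- Let `viAcc` point to the head of the queue if it is a solution. -/
def testHead : Prog :=
  block [.intLoad viTmp aiDisk viHead, .realLoad vrCur arCx viTmp, .realMul vrLim vrBound vrOne] ;;
  checkPoints ;; .ite (.intLe viOne viOk) (block [.intAdd viAcc viHead viZero]) skip

/-- Try to add each disk to the partial solution at the head of the queue. -/
def expandHead : Prog :=
  block [.intConst viDisk 0, .intAdd viDiskCount viM viZero] ;; repeatN viDiskCount tryDisk

/-- Treat the partial solution at the head of the queue, and go on to the next one. -/
def expand : Prog :=
  testHead ;; expandHead ;; block [.intAdd viHead viHead viOne, .intAdd viNext viNext viOne,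
    .intAdd viHeadPos viHeadPos viDigits]

lemma testHead_spec (h : G.Searching ss s σ) :
    HaltsWithin testHead σ (σ.intVar viCount * (52 * G.k + 16) + 9) fun σ' =>
      σ'.realVar vrCur = G.X (G.latest s) ∧
      (G.CoveredBefore s (σ.realVar vrBound) ∧ σ'.intVar viAcc = σ.intVar viHead ∨
        ¬ G.CoveredBefore s (σ.realVar vrBound) ∧ σ'.intVar viAcc = σ.intVar viAcc) := by
  refine .bind (T₁ := 3) (T₂ := σ.intVar viCount * (52 * G.k + 16) + 6) (.block (Q := fun σ' =>
    σ'.realVar vrCur = G.X (G.latest s) ∧ σ'.realVar vrLim = σ.realVar vrBound) (by simp) (by simp)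
    (by simp [Instr.exec, h.abscissa, h.latest _ _ h.head, h.realOne]))
    (fun σ₁ h₁ ⟨hcur, hlim⟩ => ?_) (by omega)
  have hS₁ := h.of_eqOff h₁
  refine .bind (T₂ := 2) (checkPoints_head_spec hS₁ hcur) (fun σ₂ h₂ hok => ?_)
    (by rw [h₁.int _ rfl])
  have hS₂ := hS₁.of_eqOff h₂
  rw [hlim] at hok
  rw [← h₂.real _ rfl] at hcur
  refine .ite (T₁ := 1) (fun hb => .block (by simp) (by simp) ?_) (fun hb => .skip le_rfl ?_)
    le_rfl <;> rw [Test.Holds, hS₂.one, hok] at hb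
  · exact ⟨hcur, .inl ⟨hb, by simp (decide := true) [Instr.exec, hS₂.zero, h₂.int, h₁.int]⟩⟩
  · exact ⟨hcur, .inr ⟨hb, by simp (decide := true) [h₂.int, h₁.int]⟩⟩

lemma expandHead_spec (h : G.Searching ss s σ) (hcur : σ.realVar vrCur = G.X (G.latest s)) :
    HaltsWithin expandHead σ (G.m * (tryDiskTime G.k (σ.intVar viCount) + 2) + 3)
      (G.Explored ss s Set.univ) := by
  refine .bind (T₁ := 2) (T₂ := G.m * (tryDiskTime G.k (σ.intVar viCount) + 2) + 1)
    (.block (Q := fun σ' => σ'.intVar viDisk = 0 ∧ σ'.intVar viDiskCount = G.m) (by simp) (by simp)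
    (by simp [Instr.exec, h.zero, h.numDisks])) (fun σ₁ h₁ ⟨hdisk, hcount⟩ => ?_) (by omega)
  have hS₁ := h.of_eqOff h₁
  refine (HaltsWithin.repeatN (T₁ := tryDiskTime G.k (σ.intVar viCount)) (fun d σ' =>
    σ'.intVar viDisk = d ∧ G.Explored ss s {q | q.1 < d} σ') hS₁.one hcount rfl rfl
    ⟨hdisk, hS₁.explored (by simp)⟩ ?_ ?_ le_rfl).mono le_rfl
    fun σ₂ _ hS₂ => hS₂.2.mono fun q _ ha => ha.disk
  · rintro d σ' v ⟨hdisk, hS⟩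
    exact ⟨by simpa using hdisk, hS.of_eqOff (Instr.eqOff_exec (.intConst viDiskCount v) _)⟩
  · rintro d hd σ₂ h₂ ⟨rfl, ss', hss, hS', hfound⟩
    refine (tryDisk_spec hS' (by rw [h₂.real _ rfl, h₁.real _ rfl, hcur]) hd).mono
      (by rw [h₂.int _ rfl, h₁.int _ rfl]) fun σ₃ _ ⟨hdisk, hS₃⟩ => ⟨hdisk,
        (hS₃.union hss hfound).mono fun q hq _ => (Nat.lt_succ_iff_lt_or_eq.1 hq)⟩

/-- The first `e` entries of the queue `[] :: ss` have been treated. If there is a solution among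
them, then `viAcc` points to a solution. -/
structure Strip.Expanded (G : Strip) (ss : List PartialSolution) (e : ℕ) (σ : Store) : Prop
    extends G.Loaded σ, G.IsQueue ss σ where
  head : σ.intVar viHead = e
  next : σ.intVar viNext = e + 1
  headPos : σ.intVar viHeadPos = e * (4 * G.k)
  closed : ∀ s ∈ ([] :: ss).take e, ∀ q : ℕ × ℕ, G.Allowed s q.1 q.2 → G.Found ss (q :: s)
  acc : (∃ s ∈ ([] :: ss).take e, G.CoveredBefore s (σ.realVar vrBound)) →
    G.Accepts (σ.realVar vrBound) ss (σ.intVar viAcc)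

/-- A bound for the time of one round of `expand`, for `cnt` points in the strip. -/
def expandTime (m k cnt : ℕ) : ℕ := (m + 1) * (tryDiskTime k cnt + 2)

lemma expand_spec {e : ℕ} (h : G.Expanded ss e σ) (he : ([] :: ss)[e]? = some s) :
    HaltsWithin expand σ (expandTime G.m G.k (σ.intVar viCount)) fun σ' =>
      ∃ ss', ss <+: ss' ∧ G.Expanded ss' (e + 1) σ' := by
  have hS : G.Searching ss s σ := ⟨h.toLoaded, h.toIsQueue, by rw [h.head, he],
    by rw [h.headPos, h.head]⟩
  refine .bind (T₂ := G.m * (tryDiskTime G.k (σ.intVar viCount) + 2) + 6) (testHead_spec hS)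
    (fun σ₁ h₁ ⟨hcur, hacc⟩ => ?_) (by rw [expandTime, add_one_mul]; unfold tryDiskTime; omega)
  rw [← h₁.int viCount rfl]
  refine .bind (T₂ := 3) (expandHead_spec (hS.of_eqOff h₁) hcur)
    (fun σ₂ h₂ ⟨ss', hss, hS₂, hfound⟩ => ?_) le_rfl
  have hhead₂ : σ₂.intVar viHead = e := by rw [h₂.int _ rfl, h₁.int _ rfl, h.head]
  refine (HaltsWithin.block (Q := fun σ' => σ'.intVar viHead = e + 1 ∧
    σ'.intVar viNext = e + 1 + 1 ∧ σ'.intVar viHeadPos = (e + 1) * (4 * G.k)) (by simp) (by simp)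
    ?_).mono le_rfl fun σ₃ h₃ ⟨hhead, hnext, hheadPos⟩ => ⟨ss', hss, hS₂.toLoaded.of_eqOff h₃,
      hS₂.toIsQueue.of_eqOff h₃, hhead, hnext, hheadPos, ?_, ?_⟩
  · have hnext₂ : σ₂.intVar viNext = e + 1 := by rw [h₂.int _ rfl, h₁.int _ rfl, h.next]
    simp [Instr.exec, hhead₂, hnext₂, hS₂.headPos, hS₂.one, hS₂.digits, add_one_mul]
  all_goals
    have hpre : [] :: ss <+: [] :: ss' := (List.prefix_cons_inj _).2 hss
    simp only [take_succ_of_prefix_of_getElem? hpre he, List.mem_append, List.mem_singleton]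
  · rintro s' (hs' | rfl) q ha
    exacts [(h.closed s' hs' q ha).mono hss, hfound q trivial ha]
  · rw [h₃.real _ rfl, h₂.real _ rfl, h₁.real _ rfl, h₃.int _ rfl, h₂.int _ rfl]
    rintro ⟨s', hs', hc⟩
    rcases hacc with ⟨hs, hacc⟩ | ⟨hs, hacc⟩ <;> rw [hacc]
    · exact ⟨s, by rw [h.head, getElem?_eq_some_mono hpre he], hs⟩
    · rcases hs' with hs' | rfl
      · obtain ⟨t, ht, hct⟩ := h.acc ⟨s', hs', hc⟩
        exact ⟨t, getElem?_eq_some_mono hpre ht, hct⟩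
      · exact absurd hc hs

/-- Treat all partial solutions. -/
def search : Prog := .loop (.intLe viNext viTail) expand

/-- A bound for the time of `search`, where at most `N` partial solutions are added to the empty
one. -/
def searchTime (N m k cnt : ℕ) : ℕ := (N + 1) * (expandTime m k cnt + 1) + 1

lemma Strip.Expanded.accepts (h : G.Expanded ss (ss.length + 1) σ) (hs : G.Solves s) :
    G.Accepts (σ.realVar vrBound) ss (σ.intVar viAcc) := by
  have htake : ([] :: ss).take (ss.length + 1) = [] :: ss := List.take_of_length_le (by simp)
  refine h.acc ?_
  rw [htake]
  refine hs.exists_coveredBefore h.admissible (fun t ht => ?_) List.mem_cons_self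
    fun t ht d j ha => h.closed t (htake.symm ▸ ht) (d, j) ha
  rcases List.mem_cons.1 ht with rfl | ht
  exacts [.nil, h.reachable t ht]

lemma search_spec (h : G.Expanded [] 0 σ) (hs : G.Solves s) :
    HaltsWithin search σ
      (searchTime ((G.m + 1) ^ (G.depth * G.k)) G.m G.k (σ.intVar viCount)) fun σ' =>
      ∃ ss, G.IsQueue ss σ' ∧ G.Accepts (σ.realVar vrBound) ss (σ'.intVar viAcc) := by
  set N := (G.m + 1) ^ (G.depth * G.k)
  set T := expandTime G.m G.k (σ.intVar viCount)
  refine HaltsWithin.loop (fun r σ' => ∃ ss e, G.Expanded ss e σ' ∧ e ≤ ss.length + 1 ∧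
    EqOff search σ σ' ∧ r = (N + 1 - e) * (T + 1) + 1) ⟨[], 0, h, by simp, .refl _ _, rfl⟩ ?_ ?_
  · rintro r σ₁ ⟨ss, e, h₁, he, hσ₁, rfl⟩ hb
    rw [Test.Holds, h₁.next, h₁.tail] at hb
    obtain rfl : e = ss.length + 1 := by omega
    exact ⟨by omega, ss, h₁.toIsQueue, by simpa only [hσ₁.real vrBound rfl] using h₁.accepts hs⟩
  · rintro r σ₁ ⟨ss, e, h₁, -, hσ₁, rfl⟩ hb
    rw [Test.Holds, h₁.next, h₁.tail] at hb
    have hlength := Strip.length_le_of_nodup_code h₁.admissible h₁.reachable h₁.nodup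
    obtain ⟨r, hr⟩ : ∃ r, N + 1 - e = r + 1 := ⟨N - e, by omega⟩
    refine ⟨T, r * (T + 1) + 1, by rw [hr, add_one_mul]; omega,
      (expand_spec h₁ (List.getElem?_eq_getElem (by rw [List.length_cons]; omega))).mono
        (by rw [hσ₁.int viCount rfl]) ?_⟩
    exact fun σ₂ h₂ ⟨ss', hss, h₃⟩ => ⟨ss', e + 1, h₃, by have := hss.length_le; omega,
      hσ₁.trans (h₂.mono (q := search) fun _ hc => hc), by rw [show N + 1 - (e + 1) = r by omega]⟩

end

/-! ### The program: solving a strip -/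

/-- Enter the dummy disk into the next place of the queue. -/
def fillStep : Prog := block [.intStore aiQueue viDst viM, .intAdd viDst viDst viOne]

/-- Start the search with the empty partial solution. -/
def initQueue : Prog :=
  block [.intConst viDst 0, .intAdd viCopyCount viDigits viZero] ;; repeatN viCopyCount fillStep ;;
  block [.intStore aiDisk viZero viM, .intConst viTail 1, .intConst viHead 0, .intConst viNext 1,
    .intConst viHeadPos 0, .intAdd viTailPos viDigits viZero, .intConst viAcc 0]

/-- Write the colour of the disk at entry `viBack`, and go on to the entry it was made from. -/
def backtrackStep : Prog :=
  block [.intLoad viTmp aiDisk viBack, .intLoad viTmpA aiCol viBack, .intAdd viTmpA viTmpA viShift,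
    .intAdd viTmpA viTmpA viOne, .intStore aiOut viTmp viTmpA, .intLoad viBack aiParent viBack]

/-- Write the solution found to the output. -/
def backtrack : Prog :=
  block [.intAdd viBack viAcc viZero] ;; .loop (.intLe viOne viBack) backtrackStep

/-- Solve the strip problem and write the solution to the output. -/
def solveStrip : Prog := initQueue ;; search ;; backtrack

/-- The output `out'` arises from `out` by giving each disk in `s` one of its colours, shifted by
`shift + 1`. -/
def Recolors (s : PartialSolution) (shift : ℕ) (out out' : ℕ → ℕ) : Prop :=
  ∀ d, (out' d = out d ∧ ∀ j, (d, j) ∉ s) ∨ ∃ j, (d, j) ∈ s ∧ out' d = shift + j + 1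

lemma Recolors.concat {s : PartialSolution} {shift d j : ℕ} {out out' out'' : ℕ → ℕ}
    (h : Recolors s shift out out')
    (h' : ∀ x, out'' x = if x = d then shift + j + 1 else out' x) :
    Recolors (s ++ [(d, j)]) shift out out'' := by
  intro x
  rw [h']
  by_cases hx : x = d
  · exact .inr ⟨j, by simp [hx], by rw [if_pos hx]⟩
  · simpa [hx] using h x

section

variable {G : Strip} {ss : List PartialSolution} {s : PartialSolution} {σ : Store}

lemma fillQueue_spec (h : G.Loaded σ) (hdst : σ.intVar viDst = 0)
    (hcount : σ.intVar viCopyCount = 4 * G.k) :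
    HaltsWithin (repeatN viCopyCount fillStep) σ (16 * G.k + 1) fun σ' =>
      ∀ i < 4 * G.k, σ'.intArr aiQueue i = G.m := by
  refine (HaltsWithin.repeatN (T₁ := 2) (fun i σ' => σ'.intVar viDst = i ∧
    ∀ i' < i, σ'.intArr aiQueue i' = G.m) h.one hcount rfl rfl (by simpa using hdst)
    (fun i σ v h => by simpa using h) (fun i hi σ₁ h₁ ⟨hdst, hfilled⟩ => ?_) (by omega)).mono le_rfl
    fun _ _ h => h.2
  have hS₁ := h.of_eqOff h₁
  refine .block (by simp) (by simp) ⟨by simp [Instr.exec, hdst, hS₁.one], fun i' hi' => ?_⟩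
  rcases Nat.lt_succ_iff_lt_or_eq.1 hi' with hlt | rfl
  · simp [Instr.exec, setEntry_apply, hdst, hlt.ne, hfilled i' hlt]
  · simp [Instr.exec, setEntry_apply, hdst, hS₁.numDisks]

lemma Strip.isQueue_nil (hseen : ∀ c, σ.intArr aiSeen c < σ.intVar viStamp)
    (htail : σ.intVar viTail = 1) (htailPos : σ.intVar viTailPos = 4 * G.k)
    (hqueue : ∀ i < 4 * G.k, σ.intArr aiQueue i = G.m) (hdisk : σ.intArr aiDisk 0 = G.m) :
    G.IsQueue [] σ where
  reachable := by simp
  tail := htail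
  tailPos := by simpa using htailPos
  memory e s he i hi := by
    obtain ⟨rfl, rfl⟩ : e = 0 ∧ s = [] := by simpa [List.getElem?_singleton, eq_comm] using he
    rw [zero_mul, zero_add, hqueue i hi, Strip.memory, Strip.slot_nil]
  latest e s he := by
    obtain ⟨rfl, rfl⟩ : e = 0 ∧ s = [] := by simpa [List.getElem?_singleton, eq_comm] using he
    exact hdisk
  parent := by simp
  seen c := by simpa using (hseen c).ne
  seen_le c := (hseen c).le
  nodup := by simp

lemma initQueue_spec (h : G.Loaded σ) (hseen : ∀ c, σ.intArr aiSeen c < σ.intVar viStamp) :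
    HaltsWithin initQueue σ (16 * G.k + 10) (G.Expanded [] 0) := by
  refine .bind (T₁ := 2) (T₂ := 16 * G.k + 8) (.block (Q := fun σ' => σ'.intVar viDst = 0 ∧
    σ'.intVar viCopyCount = 4 * G.k) (by simp) (by simp) (by simp [Instr.exec, h.digits, h.zero]))
    (fun σ₁ h₁ ⟨hdst, hcount⟩ => ?_) (by omega)
  have hS₁ := h.of_eqOff h₁
  refine .bind (T₂ := 7) (fillQueue_spec hS₁ hdst hcount) (fun σ₂ h₂ hqueue => ?_) (by omega)
  have hS₂ := hS₁.of_eqOff h₂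
  refine (HaltsWithin.block (Q := fun σ' => σ'.intVar viTail = 1 ∧ σ'.intVar viHead = 0 ∧
    σ'.intVar viNext = 1 ∧ σ'.intVar viHeadPos = 0 ∧ σ'.intVar viTailPos = 4 * G.k ∧
    σ'.intArr aiDisk 0 = G.m) (by simp) (by simp)
    (by simp [Instr.exec, setEntry_apply, hS₂.zero, hS₂.numDisks, hS₂.digits])).mono le_rfl
    fun σ₃ h₃ ⟨htail, hhead, hnext, hheadPos, htailPos, hdisk⟩ => ?_
  refine ⟨hS₂.of_eqOff h₃, Strip.isQueue_nil (fun c => ?_) htail htailPos (fun i hi => ?_) hdisk,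
    hhead, hnext, by simpa using hheadPos, by simp, by simp⟩
  · rw [h₃.intArr _ rfl, h₂.intArr _ rfl, h₁.intArr _ rfl, h₃.int _ rfl, h₂.int _ rfl,
      h₁.int _ rfl]
    exact hseen c
  · rw [h₃.intArr _ rfl, hqueue i hi]

lemma backtrackStep_spec (hone : σ.intVar viOne = 1) :
    HaltsWithin backtrackStep σ 6 fun σ' =>
      σ'.intVar viBack = σ.intArr aiParent (σ.intVar viBack) ∧
      ∀ d, σ'.intArr aiOut d = if d = σ.intArr aiDisk (σ.intVar viBack) then
        σ.intVar viShift + σ.intArr aiCol (σ.intVar viBack) + 1 else σ.intArr aiOut d :=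
  .block (by simp) (by simp) (by simp [Instr.exec, setEntry_apply, hone, add_comm])

lemma backtrack_spec (hconst : σ.HasConstants) (h : G.IsQueue ss σ)
    (hacc : ([] :: ss)[σ.intVar viAcc]? = some s) :
    HaltsWithin backtrack σ (7 * ss.length + 2) fun σ' =>
      Recolors s (σ.intVar viShift) (σ.intArr aiOut) (σ'.intArr aiOut) := by
  refine .bind (T₁ := 1) (T₂ := 7 * ss.length + 1) (.block
    (Q := fun σ' => σ'.intVar viBack = σ.intVar viAcc) (by simp) (by simp)
    (by simp [Instr.exec, hconst.zero])) (fun σ₁ h₁ hback => ?_) (by omega)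
  refine .loop (fun r σ' => EqOff (.loop (.intLe viOne viBack) backtrackStep) σ₁ σ' ∧
    7 * σ'.intVar viBack + 1 ≤ r ∧ ∃ u t, s = u ++ t ∧
    ([] :: ss)[σ'.intVar viBack]? = some t ∧
    Recolors u (σ.intVar viShift) (σ.intArr aiOut) (σ'.intArr aiOut)) ?_ ?_ ?_
  · have hlt := (List.getElem?_eq_some_iff.1 hacc).1
    rw [List.length_cons] at hlt
    refine ⟨.refl _ _, by omega, [], s, rfl, by rw [hback, hacc], fun d => .inl ⟨?_, by simp⟩⟩
    rw [h₁.intArr _ rfl]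
  · rintro r σ₂ ⟨h₂, hr, u, t, rfl, ht, hu⟩ hb
    rw [Test.Holds, h₂.int _ rfl, h₁.int _ rfl, hconst.one] at hb
    obtain rfl : [] = t := by simpa [show σ₂.intVar viBack = 0 by omega] using ht
    exact ⟨by omega, by rwa [List.append_nil]⟩
  · rintro r σ₂ ⟨h₂, hr, u, t, rfl, ht, hu⟩ hb
    have hone₂ : σ₂.intVar viOne = 1 := by rw [h₂.int _ rfl, h₁.int _ rfl, hconst.one]
    rw [Test.Holds, hone₂] at hb
    have hQ₂ := (h.of_eqOff h₁).of_eqOff h₂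
    obtain ⟨e, he⟩ : ∃ e, σ₂.intVar viBack = e + 1 := ⟨σ₂.intVar viBack - 1, by omega⟩
    obtain ⟨hparent, t', ht', rfl⟩ := hQ₂.parent e t (by rwa [he] at ht)
    refine ⟨6, 7 * e + 1, by omega, (backtrackStep_spec hone₂).mono le_rfl
      fun σ₃ h₃ ⟨hback₃, hout⟩ => ⟨h₂.trans (h₃.mono fun _ hc => hc), ?_,
        u ++ [(σ₂.intArr aiDisk (e + 1), σ₂.intArr aiCol (e + 1))], t', by simp,
        by rw [hback₃, he, ht'], hu.concat ?_⟩⟩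
    · rw [hback₃, he]
      omega
    · simpa only [he, h₂.int viShift rfl, h₁.int viShift rfl] using hout

/-- A bound for the time to solve a strip with `cnt` points, where the queue takes at most `N`
partial solutions besides the empty one. -/
def solveTime (N m k cnt : ℕ) : ℕ := searchTime N m k cnt + 7 * N + 16 * k + 12

lemma solveStrip_spec (h : G.Loaded σ) (hseen : ∀ c, σ.intArr aiSeen c < σ.intVar viStamp)
    (hs : G.Solves s) :
    HaltsWithin solveStrip σ
      (solveTime ((G.m + 1) ^ (G.depth * G.k)) G.m G.k (σ.intVar viCount)) fun σ' =>
      (∀ c, σ'.intArr aiSeen c ≤ σ.intVar viStamp) ∧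
      ∃ t, G.Reachable t ∧ G.CoveredBefore t (σ.realVar vrBound) ∧
        Recolors t (σ.intVar viShift) (σ.intArr aiOut) (σ'.intArr aiOut) := by
  set N := (G.m + 1) ^ (G.depth * G.k)
  refine .bind (T₂ := searchTime N G.m G.k (σ.intVar viCount) + (7 * N + 2))
    (initQueue_spec h hseen)
    (fun σ₁ h₁ hE => ?_) (by rw [solveTime]; omega)
  refine .bind ((search_spec hE hs).mono (by rw [h₁.int _ rfl]) fun _ _ h => h)
    (fun σ₂ h₂ ⟨ss, hQ, t, ht, hcovered⟩ => ?_) le_rfl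
  have hlength := Strip.length_le_of_nodup_code h.admissible hQ.reachable hQ.nodup
  refine (backtrack_spec (hE.toHasConstants.of_eqOff h₂) hQ ht).mono (by omega)
    fun σ₃ h₃ hout => ⟨fun c => ?_, t, ?_, ?_, ?_⟩
  · rw [h₃.intArr _ rfl, ← h₁.int viStamp rfl, ← h₂.int viStamp rfl]
    exact hQ.seen_le c
  · rcases List.mem_cons.1 (List.mem_of_getElem? ht) with rfl | ht
    exacts [.nil, hQ.reachable t ht]
  · rwa [h₁.real _ rfl] at hcovered
  · rwa [h₂.int _ rfl, h₁.int _ rfl, h₂.intArr _ rfl, h₁.intArr _ rfl] at hout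

end

/-! ### The program: the next strip -/

/-- Lower `vrBot` to the ordinate of point `viPt` if that point is above the last strip. -/
def bottomStep : Prog :=
  block [.realLoad vrUy arPy viPt, .intAdd viPt viPt viOne] ;;
  .ite (.realLe vrUy vrLast) skip
    (.ite (.realLe vrBot vrUy) skip (block [.realMul vrBot vrUy vrOne]))

/-- Find the lowest point above the last strip. If there is none, `vrBot` becomes `vrBound`. -/
def findBottom : Prog :=
  block [.realMul vrBot vrBound vrOne, .intAdd viPtCount viN viZero, .intConst viPt 0] ;;
  repeatN viPtCount bottomStep

/-- Enter point `viPt` into the list if it is in the strip. -/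
def collectStep : Prog :=
  block [.realLoad vrUy arPy viPt] ;;
  .ite (.realLe vrBot vrUy) (.ite (.realLe vrUy vrTop)
    (block [.intStore aiList viCount viPt, .intAdd viCount viCount viOne]) skip) skip ;;
  block [.intAdd viPt viPt viOne]

/-- List the points of the strip. -/
def collect : Prog :=
  block [.realAdd vrTop vrBot vrHeight, .intConst viCount 0, .intAdd viPtCount viN viZero,
    .intConst viPt 0] ;; repeatN viPtCount collectStep

/-- The list of points in the strip, as stored. -/
def Store.listed (σ : Store) : List ℕ := (List.range (σ.intVar viCount)).map (σ.intArr aiList)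

section

variable {σ : Store}

lemma bottomStep_spec (hconst : σ.HasConstants) :
    HaltsWithin bottomStep σ 5 fun σ' => σ'.intVar viPt = σ.intVar viPt + 1 ∧
      σ'.realVar vrBot = if σ.realVar vrLast < σ.realArr arPy (σ.intVar viPt)
        then min (σ.realVar vrBot) (σ.realArr arPy (σ.intVar viPt)) else σ.realVar vrBot := by
  refine .bind (T₁ := 2) (T₂ := 3) (.block (Q := fun σ' => σ'.intVar viPt = σ.intVar viPt + 1 ∧
    σ'.realVar vrUy = σ.realArr arPy (σ.intVar viPt)) (by simp) (by simp)
    (by simp [Instr.exec, hconst.one])) (fun σ₁ h₁ ⟨hpt, hy⟩ => ?_) le_rfl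
  have hlast := h₁.real vrLast rfl
  have hbot := h₁.real vrBot rfl
  refine .ite (T₁ := 2) (fun hb => .skip (by simp) ⟨hpt, ?_⟩) (fun hb => ?_) le_rfl <;>
    rw [Test.Holds, hy, hlast] at hb
  · rw [if_neg hb.not_gt, ← hbot]
  rw [if_pos (not_le.1 hb)]
  refine .ite (T₁ := 1) (fun hb' => .skip le_rfl ⟨hpt, ?_⟩)
    (fun hb' => .block (by simp) (by simp) ⟨hpt, ?_⟩) le_rfl <;> rw [Test.Holds, hy, hbot] at hb'
  · rw [min_eq_left hb', ← hbot]
  · simp [Instr.exec, hy, (hconst.of_eqOff h₁).realOne, (not_le.1 hb').le]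

lemma findBottom_spec (hconst : σ.HasConstants) :
    HaltsWithin findBottom σ (7 * σ.intVar viN + 4) fun σ' =>
      IsLeast (insert (σ.realVar vrBound) (σ.realArr arPy ''
        {i | i < σ.intVar viN ∧ σ.realVar vrLast < σ.realArr arPy i})) (σ'.realVar vrBot) := by
  refine .bind (T₁ := 3) (T₂ := 7 * σ.intVar viN + 1) (.block (Q := fun σ' =>
    σ'.realVar vrBot = σ.realVar vrBound ∧ σ'.intVar viPtCount = σ.intVar viN ∧
    σ'.intVar viPt = 0) (by simp) (by simp) (by simp [Instr.exec, hconst.zero, hconst.realOne]))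
    (fun σ₁ h₁ ⟨hbot, hcount, hpt⟩ => ?_) (by omega)
  have hconst₁ := hconst.of_eqOff h₁
  refine (HaltsWithin.repeatN (T₁ := 5) (fun i σ' => σ'.intVar viPt = i ∧
    IsLeast (insert (σ.realVar vrBound) (σ.realArr arPy ''
      {i' | i' < i ∧ σ.realVar vrLast < σ.realArr arPy i'})) (σ'.realVar vrBot))
    hconst₁.one hcount rfl rfl (by simp [hpt, hbot]) (fun i σ v h => by simpa using h)
    (fun i _ σ₂ h₂ ⟨hpt, hleast⟩ => ?_) (by omega)).mono le_rfl fun _ _ h => h.2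
  refine (bottomStep_spec (hconst₁.of_eqOff h₂)).mono le_rfl fun σ₃ _ ⟨hpt₃, hbot₃⟩ =>
    ⟨by rw [hpt₃, hpt], ?_⟩
  rw [h₂.real vrLast rfl, h₁.real vrLast rfl, h₂.realArr _ rfl, h₁.realArr _ rfl, hpt] at hbot₃
  rw [hbot₃]
  split_ifs with hi
  · have hset : {i' | i' < i + 1 ∧ σ.realVar vrLast < σ.realArr arPy i'} =
        insert i {i' | i' < i ∧ σ.realVar vrLast < σ.realArr arPy i'} := by
      ext i'
      simp only [Set.mem_ofPred_eq, Set.mem_insert_iff]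
      grind
    rw [hset, Set.image_insert_eq, Set.insert_comm, min_comm]
    exact hleast.insert _
  · have hset : {i' | i' < i + 1 ∧ σ.realVar vrLast < σ.realArr arPy i'} =
        {i' | i' < i ∧ σ.realVar vrLast < σ.realArr arPy i'} := by
      ext i'
      simp only [Set.mem_ofPred_eq]
      grind
    rwa [hset]

lemma collectStep_spec (hone : σ.intVar viOne = 1) :
    HaltsWithin collectStep σ 6 fun σ' => σ'.intVar viPt = σ.intVar viPt + 1 ∧
      σ'.listed = σ.listed ++ [σ.intVar viPt].filter fun i =>
        σ.realArr arPy i ∈ Set.Icc (σ.realVar vrBot) (σ.realVar vrTop) := by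
  set y := σ.realArr arPy (σ.intVar viPt) with hy
  have hfilter : ([σ.intVar viPt].filter fun i =>
      σ.realArr arPy i ∈ Set.Icc (σ.realVar vrBot) (σ.realVar vrTop)) =
      if σ.realVar vrBot ≤ y ∧ y ≤ σ.realVar vrTop then [σ.intVar viPt] else [] := by
    rw [List.filter_singleton]
    simp [← hy]
  rw [hfilter]
  refine .bind (T₁ := 1) (T₂ := 5) (.block (Q := fun σ' => σ'.realVar vrUy = y) (by simp) (by simp)
    (by simp [Instr.exec, hy])) (fun σ₁ h₁ hy₁ => ?_) le_rfl
  have hbot := h₁.real vrBot rfl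
  have htop := h₁.real vrTop rfl
  have hlisted : σ₁.listed = σ.listed := by
    rw [Store.listed, Store.listed, h₁.int _ rfl, h₁.intArr _ rfl]
  refine .bind (T₁ := 4) (T₂ := 1) (P := fun σ' => σ'.listed = σ₁.listed ++
    if σ.realVar vrBot ≤ y ∧ y ≤ σ.realVar vrTop then [σ.intVar viPt] else []) ?_
    (fun σ₂ h₂ hlisted₂ => .block (by simp) (by simp) ⟨?_, ?_⟩) le_rfl
  · refine .ite (T₁ := 3) (fun hb => .ite (T₁ := 2) (fun hb' => .block (by simp) (by simp) ?_)
      (fun hb' => .skip (by simp) ?_) le_rfl) (fun hb => .skip (by simp) ?_) le_rfl <;>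
      rw [Test.Holds, hy₁, hbot] at hb
    · rw [Test.Holds, hy₁, htop] at hb'
      rw [if_pos ⟨hb, hb'⟩]
      simp (decide := true) +contextual [Store.listed, Instr.exec, List.range_succ, setEntry_apply,
        h₁.int, hone, ne_of_lt]
    · rw [Test.Holds, hy₁, htop] at hb'
      rw [if_neg (hb' ·.2)]
      simp [Store.listed]
    · rw [if_neg (hb ·.1)]
      simp [Store.listed]
  · simp (decide := true) [Instr.exec, h₂.int, h₁.int, hone]
  · rw [← hlisted, ← hlisted₂]
    simp [Store.listed, Instr.exec]

lemma collect_spec (hconst : σ.HasConstants) :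
    HaltsWithin collect σ (8 * σ.intVar viN + 5) fun σ' =>
      σ'.realVar vrTop = σ.realVar vrBot + σ.realVar vrHeight ∧
      σ'.listed = (List.range (σ.intVar viN)).filter fun i =>
        σ.realArr arPy i ∈ Set.Icc (σ.realVar vrBot) (σ.realVar vrBot + σ.realVar vrHeight) := by
  refine .bind (T₁ := 4) (T₂ := 8 * σ.intVar viN + 1) (.block (Q := fun σ' =>
    σ'.realVar vrTop = σ.realVar vrBot + σ.realVar vrHeight ∧ σ'.intVar viCount = 0 ∧
    σ'.intVar viPtCount = σ.intVar viN ∧ σ'.intVar viPt = 0) (by simp) (by simp)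
    (by simp [Instr.exec, hconst.zero])) (fun σ₁ h₁ ⟨htop, hnil, hcount, hpt⟩ => ?_) (by omega)
  have hconst₁ := hconst.of_eqOff h₁
  refine (HaltsWithin.repeatN (T₁ := 6) (fun i σ' => σ'.intVar viPt = i ∧
    σ'.listed = (List.range i).filter fun i => σ.realArr arPy i ∈
      Set.Icc (σ.realVar vrBot) (σ.realVar vrBot + σ.realVar vrHeight)) hconst₁.one hcount rfl rfl
    (by simp [hpt, hnil, Store.listed]) (fun i σ v h => by simpa [Store.listed] using h)
    (fun i _ σ₂ h₂ ⟨hpt, hlisted⟩ => ?_) (by omega)).mono le_rfl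
    fun σ₂ h₂ h => ⟨by rw [h₂.real _ rfl, htop], h.2⟩
  refine (collectStep_spec (hconst₁.of_eqOff h₂).one).mono le_rfl
    fun σ₃ _ ⟨hpt₃, hlisted₃⟩ => ⟨by rw [hpt₃, hpt], ?_⟩
  rw [hlisted₃, hlisted, hpt, List.range_succ, List.filter_append, h₂.real _ rfl, h₁.real _ rfl,
    h₂.real _ rfl, htop, h₂.realArr _ rfl, h₁.realArr _ rfl]

end

/-! ### Combining the strips -/

/-- A covering problem as the program sees it, with a choice of strips: there are points `i < n`,
disks `d < m` with a dummy disk `m`, and `k` colours for each of the `classes` classes of strips of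
the given height. A strip is swept with the given depth of memory. -/
structure Task where
  n : ℕ
  m : ℕ
  k : ℕ
  depth : ℕ
  classes : ℕ
  X : ℕ → ℝ
  Y : ℕ → ℝ
  PX : ℕ → ℝ
  PY : ℕ → ℝ
  height : ℝ
  bound : ℝ

namespace Task

variable (P : Task)

/-- The centre of disk `d`. -/
def center (d : ℕ) : ℝ × ℝ := (P.X d, P.Y d)

/-- The point with index `i`. -/
def point (i : ℕ) : ℝ × ℝ := (P.PX i, P.PY i)

/-- The indices of the points in the strip with lower boundary `lo`. -/
def inStrip (lo : ℝ) : Finset ℕ :=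
  (Finset.range P.n).filter fun i => P.PY i ∈ Set.Icc lo (lo + P.height)

/-- The strip problem for the strip with lower boundary `lo`. -/
def strip (lo : ℝ) : Strip where
  k := P.k
  m := P.m
  depth := P.depth
  X := P.X
  Y := P.Y
  lo := lo
  height := P.height
  points := {p | ∃ i ∈ P.inStrip lo, p = P.point i}

/-- What is assumed of a task. The heights are such that `classes - 1` strips keep the disks of a
strip away from those of the next strip of the same class. -/
structure Valid : Prop where
  k_pos : 1 ≤ P.k
  strips : (P.depth = 3 ∧ P.height = 1 / 2 ∧ P.classes = 9) ∨
    (P.depth = 4 ∧ P.height = 4 / 3 ∧ P.classes = 4)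
  dummy : P.X P.m = -P.bound
  left : ∀ d < P.m, -P.bound + 10 ≤ P.X d
  abscissa : ∀ i < P.n, -P.bound + 10 ≤ P.PX i ∧ P.PX i + 10 ≤ P.bound
  ordinate : ∀ i < P.n, -P.bound + 10 ≤ P.PY i ∧ P.PY i + 10 ≤ P.bound
  solvable : ∀ lo, ∃ s, (P.strip lo).Solves s

/-- The number of strips since class `c` was used last, if class `cl` comes next. -/
def gap (cl c : ℕ) : ℕ := if c < cl then cl - c else cl + P.classes - c

/-- The output `out` colours the chosen disks, with `0` for the other disks, and it is correct as
far as the points up to ordinate `last` are concerned. Class `cl` comes next. -/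
structure Colored (last : ℝ) (cl : ℕ) (out : ℕ → ℕ) : Prop where
  color : ∀ d, out d ≠ 0 → d < P.m ∧ ∃ c < P.classes, ∃ j < P.k, out d = c * P.k + j + 1 ∧
    P.Y d + P.gap cl c * P.height ≤ last + P.height + 1
  far : ∀ d d', d ≠ d' → out d ≠ 0 → out d = out d' → 4 < sqDist (P.center d) (P.center d')
  cover : ∀ i < P.n, P.PY i ≤ last → ∃ d, out d ≠ 0 ∧ sqDist (P.center d) (P.point i) ≤ 1

variable {P} {last lo : ℝ} {cl : ℕ} {out out' : ℕ → ℕ} {s : PartialSolution}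

lemma mem_inStrip {i : ℕ} : i ∈ P.inStrip lo ↔ i < P.n ∧ P.PY i ∈ Set.Icc lo (lo + P.height) := by
  simp [inStrip]

namespace Valid

lemma admissible (hP : P.Valid) (lo : ℝ) : (P.strip lo).Admissible P.bound where
  k_pos := hP.k_pos
  depth_height := hP.strips.imp (fun h => ⟨h.1, h.2.1⟩) (fun h => ⟨h.1, h.2.1⟩)
  dummy := hP.dummy
  left := hP.left
  points_left := by rintro p ⟨i, hi, rfl⟩; exact (hP.abscissa i (mem_inStrip.1 hi).1).1
  points_right := by rintro p ⟨i, hi, rfl⟩; exact (hP.abscissa i (mem_inStrip.1 hi).1).2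
  points_low := by rintro p ⟨i, hi, rfl⟩; exact (mem_inStrip.1 hi).2.1
  points_high := by rintro p ⟨i, hi, rfl⟩; exact (mem_inStrip.1 hi).2.2

lemma half_le_height (hP : P.Valid) : 1 / 2 ≤ P.height := by
  rcases hP.strips with h | h <;> norm_num [h.2.1]

lemma classes_mul_height (hP : P.Valid) : P.classes * P.height = 4 + P.height := by
  rcases hP.strips with h | h <;> norm_num [h.2.1, h.2.2]

end Valid

lemma gap_self (cl : ℕ) : P.gap cl cl = P.classes := by
  simp [gap]

lemma gap_succ_self (cl : ℕ) : P.gap (cl + 1) cl = 1 := by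
  simp [gap]

lemma gap_succ_le (cl c : ℕ) : P.gap (cl + 1) c ≤ P.gap cl c + 1 := by
  grind [gap]

lemma gap_zero_of_lt {c : ℕ} (hc : c < P.classes) : P.gap 0 c = P.gap P.classes c := by
  simp [gap, hc]

lemma Colored.wrap (h : P.Colored last P.classes out) : P.Colored last 0 out where
  color d hd := by
    obtain ⟨hm, c, hc, hcolor⟩ := h.color d hd
    exact ⟨hm, c, hc, by rwa [gap_zero_of_lt hc]⟩
  far := h.far
  cover := h.cover

lemma eq_of_mul_add_eq {k c j c' j' : ℕ} (hj : j < k) (hj' : j' < k)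
    (h : c * k + j = c' * k + j') : c = c' := by
  have hk : 0 < k := by omega
  simpa [Nat.add_div_of_dvd_right, Nat.div_eq_of_lt, hj, hj', hk] using congrArg (· / k) h

/-- A disk of the same class lies `classes` strips below or more. -/
lemma Colored.four_lt_sqDist (hP : P.Valid) (h : P.Colored last cl out) (hlo : last < lo)
    {d d' j : ℕ} (hd : (P.strip lo).Eligible (d, j)) (hd' : out d' = cl * P.k + j + 1) :
    4 < sqDist (P.center d) (P.center d') := by
  obtain ⟨-, c, -, j', hj', hcolor, hy⟩ := h.color d' (by omega)
  obtain rfl := eq_of_mul_add_eq hj' hd.color (show c * P.k + j' = cl * P.k + j by omega)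
  rw [gap_self, hP.classes_mul_height] at hy
  have hlow : lo - 1 ≤ P.Y d := hd.low
  have hbelow : 2 < P.Y d - P.Y d' := by linarith
  calc (4 : ℝ) = 2 * 2 := by norm_num
    _ < (P.Y d - P.Y d') * (P.Y d - P.Y d') := mul_self_lt_mul_self zero_le_two hbelow
    _ ≤ _ := snd_sub_mul_self_le_sqDist (P.center d) (P.center d')

lemma Colored.color_recolors (hP : P.Valid) (h : P.Colored last cl out) (hcl : cl < P.classes)
    (hlo : last < lo) (hs : (P.strip lo).IsSweep s) (hr : Recolors s (cl * P.k) out out') {d : ℕ}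
    (hd : out' d ≠ 0) : d < P.m ∧ ∃ c < P.classes, ∃ j < P.k, out' d = c * P.k + j + 1 ∧
      P.Y d + P.gap (cl + 1) c * P.height ≤ lo + P.height + P.height + 1 := by
  rcases hr d with ⟨hout, -⟩ | ⟨j, hj, hout⟩
  · obtain ⟨hm, c, hc, j, hj, hcolor, hy⟩ := h.color d (hout ▸ hd)
    refine ⟨hm, c, hc, j, hj, hout.trans hcolor, ?_⟩
    have hgap : (P.gap (cl + 1) c : ℝ) ≤ P.gap cl c + 1 := mod_cast gap_succ_le cl c
    linarith [mul_le_mul_of_nonneg_right hgap (one_half_pos.le.trans hP.half_le_height)]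
  · have hj := hs.eligible _ hj
    refine ⟨hj.disk, cl, hcl, j, hj.color, hout, ?_⟩
    have hhigh : P.Y d ≤ lo + P.height + 1 := hj.high
    rw [gap_succ_self, Nat.cast_one]
    linarith

lemma Colored.far_recolors (hP : P.Valid) (h : P.Colored last cl out) (hlo : last < lo)
    (hs : (P.strip lo).IsSweep s) (hr : Recolors s (cl * P.k) out out') {d d' : ℕ} (hne : d ≠ d')
    (hd : out' d ≠ 0) (heq : out' d = out' d') : 4 < sqDist (P.center d) (P.center d') := by
  rcases hr d with ⟨hout, -⟩ | ⟨j, hj, hout⟩ <;> rcases hr d' with ⟨hout', -⟩ | ⟨j', hj', hout'⟩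
  · exact h.far d d' hne (hout ▸ hd) (by rw [← hout, heq, hout'])
  · rw [sqDist_comm]
    exact h.four_lt_sqDist hP hlo (hs.eligible _ hj') (by rw [← hout, heq, hout'])
  · exact h.four_lt_sqDist hP hlo (hs.eligible _ hj) (by rw [← hout', ← heq, hout])
  · obtain rfl : j = j' := by omega
    have : Std.Symm fun a b : ℕ × ℕ => a.2 = b.2 →
        4 < sqDist ((P.strip lo).center a.1) ((P.strip lo).center b.1) :=
      ⟨fun a b hab hba => sqDist_comm _ _ ▸ hab hba.symm⟩
    exact List.Pairwise.forall hs.far hj hj' (by simpa using hne) rfl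

lemma Colored.recolor (hP : P.Valid) (h : P.Colored last cl out) (hcl : cl < P.classes)
    (hlo : last < lo) (hnext : ∀ i < P.n, last < P.PY i → lo ≤ P.PY i)
    (hs : (P.strip lo).Reachable s) (hcovered : (P.strip lo).CoveredBefore s P.bound)
    (hr : Recolors s (cl * P.k) out out') : P.Colored (lo + P.height) (cl + 1) out' where
  color _ hd := h.color_recolors hP hcl hlo (hs.isSweep (hP.admissible lo)) hr hd
  far _ _ hne hd heq := h.far_recolors hP hlo (hs.isSweep (hP.admissible lo)) hr hne hd heq
  cover i hi hle := by
    rcases le_or_gt (P.PY i) last with hold | hnew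
    · obtain ⟨d, hd, hcover⟩ := h.cover i hi hold
      refine ⟨d, ?_, hcover⟩
      rcases hr d with ⟨hout, -⟩ | ⟨j, -, hout⟩ <;> omega
    · obtain ⟨⟨d, j⟩, hd, hcover⟩ := hs.covers (hP.admissible lo) hcovered
        ⟨i, mem_inStrip.2 ⟨hi, hnext i hi hnew, hle⟩, rfl⟩
      refine ⟨d, ?_, hcover⟩
      rcases hr d with ⟨-, hnot⟩ | ⟨j', -, hout⟩
      · exact absurd hd (hnot j)
      · omega

/-! ### The number of strips -/

variable (P)

/-- The length of that part of the interval `[y - 1, y + 1 + height]` which is above `last`. -/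
def weight (last y : ℝ) : ℝ := min (2 + P.height) (max 0 (y + 1 + P.height - last))

/-- The total weight of all disks. It drops by `height` with each strip, because the lowest point of
the strip is in some disk. -/
def potential (last : ℝ) : ℝ := ∑ d ∈ Finset.range P.m, P.weight last (P.Y d)

/-- A bound for the number of strips above `last`. -/
def stripsLeft (last : ℝ) : ℕ := ⌊P.potential last / P.height⌋₊

/-- The number of points above `last`. -/
def remaining (last : ℝ) : ℕ := ((Finset.range P.n).filter fun i => last < P.PY i).card

/-- The lower boundary of the next strip after `last`: the ordinate of the lowest point above. -/
def IsNextBottom (last lo : ℝ) : Prop := IsLeast (P.PY '' {i | i < P.n ∧ last < P.PY i}) lo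

variable {P}

lemma weight_anti {last last' : ℝ} (h : last ≤ last') (y : ℝ) :
    P.weight last' y ≤ P.weight last y :=
  min_le_min le_rfl (max_le_max le_rfl (by linarith))

lemma weight_add_height_le (hP : P.Valid) (hlo : last < lo) {y : ℝ} (hy : |y - lo| ≤ 1) :
    P.weight (lo + P.height) y + P.height ≤ P.weight last y := by
  have hh := hP.half_le_height
  rw [abs_le] at hy
  have hle : P.weight (lo + P.height) y ≤ y + 1 - lo :=
    (min_le_right _ _).trans (max_le (by linarith) (by linarith))
  exact le_min (by linarith) (le_max_of_le_right (by linarith))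

lemma potential_nonneg (hP : P.Valid) (last : ℝ) : 0 ≤ P.potential last :=
  Finset.sum_nonneg fun _ _ => le_min (by linarith [hP.half_le_height]) (le_max_left _ _)

lemma potential_le (hP : P.Valid) (last : ℝ) : P.potential last ≤ (5 * P.m : ℕ) * P.height := by
  have hh := hP.half_le_height
  calc P.potential last ≤ (Finset.range P.m).card • (2 + P.height) :=
        Finset.sum_le_card_nsmul _ _ _ fun _ _ => min_le_left _ _
    _ = P.m • (2 + P.height) := by rw [Finset.card_range]
    _ ≤ P.m • (5 * P.height) := nsmul_le_nsmul_right (by linarith) _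
    _ = (5 * P.m : ℕ) * P.height := by push_cast [nsmul_eq_mul]; ring

lemma IsNextBottom.potential_add_height_le (hP : P.Valid) (hlo : P.IsNextBottom last lo) :
    P.potential (lo + P.height) + P.height ≤ P.potential last := by
  have hh := hP.half_le_height
  obtain ⟨⟨i, ⟨hi, hlast⟩, rfl⟩, -⟩ := hlo
  obtain ⟨s, hs⟩ := hP.solvable (P.PY i)
  obtain ⟨⟨d, j⟩, hd, hcover⟩ :=
    hs.covers (P.point i) ⟨i, mem_inStrip.2 ⟨hi, le_rfl, by linarith⟩, rfl⟩
  have hdm : d ∈ Finset.range P.m := Finset.mem_range.2 (hs.eligible _ hd).disk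
  unfold potential
  rw [← Finset.add_sum_erase _ _ hdm, ← Finset.add_sum_erase _ _ hdm]
  have hdrop := weight_add_height_le hP hlast (abs_snd_sub_le_one hcover)
  have hothers := Finset.sum_le_sum fun d' (_ : d' ∈ (Finset.range P.m).erase d) =>
    weight_anti (P := P) (show last ≤ P.PY i + P.height by linarith) (P.Y d')
  exact (add_right_comm _ _ _).trans_le (add_le_add hdrop hothers)

lemma stripsLeft_le (hP : P.Valid) (last : ℝ) : P.stripsLeft last ≤ 5 * P.m :=
  Nat.floor_le_of_le <|
    (div_le_iff₀ (by linarith [hP.half_le_height])).2 (potential_le hP last)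

lemma IsNextBottom.stripsLeft_add_one_le (hP : P.Valid) (hlo : P.IsNextBottom last lo) :
    P.stripsLeft (lo + P.height) + 1 ≤ P.stripsLeft last := by
  have hh : 0 < P.height := by linarith [hP.half_le_height]
  unfold stripsLeft
  rw [← Nat.floor_add_one (div_nonneg (potential_nonneg hP _) hh.le)]
  refine Nat.floor_le_floor ?_
  rw [← div_self hh.ne', ← add_div]
  exact div_le_div_of_nonneg_right (hlo.potential_add_height_le hP) hh.le

lemma exists_isNextBottom (h : P.remaining last ≠ 0) : ∃ lo, P.IsNextBottom last lo := by
  obtain ⟨i, hi⟩ := Finset.card_ne_zero.1 h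
  have hfinite : {i | i < P.n ∧ last < P.PY i}.Finite :=
    (Set.finite_lt_nat P.n).subset fun _ h => h.1
  exact (Set.exists_min_image _ id (hfinite.image P.PY)
    ⟨P.PY i, i, by simpa using hi, rfl⟩).imp fun _ h => h

lemma IsNextBottom.inStrip_nonempty (hP : P.Valid) (hlo : P.IsNextBottom last lo) :
    (P.inStrip lo).Nonempty := by
  obtain ⟨⟨i, ⟨hi, -⟩, rfl⟩, -⟩ := hlo
  exact ⟨i, mem_inStrip.2 ⟨hi, le_rfl, by linarith [hP.half_le_height]⟩⟩

lemma remaining_add_card_inStrip_le (hP : P.Valid) (hlo : last < lo) :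
    P.remaining (lo + P.height) + (P.inStrip lo).card ≤ P.remaining last := by
  have hh := hP.half_le_height
  unfold remaining
  rw [← Finset.card_union_of_disjoint]
  · refine Finset.card_le_card fun i hi => ?_
    rw [Finset.mem_union, Finset.mem_filter, mem_inStrip] at hi
    rw [Finset.mem_filter, Finset.mem_range]
    rcases hi with ⟨hi, h⟩ | ⟨hi, h⟩
    · exact ⟨Finset.mem_range.1 hi, by linarith⟩
    · exact ⟨hi, hlo.trans_le h.1⟩
  · refine Finset.disjoint_left.2 fun i hi hi' => ?_
    exact (Finset.mem_filter.1 hi).2.not_ge (mem_inStrip.1 hi').2.2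

end Task

/-! ### The program: all strips -/

/-- List the points of the strip with lower boundary `vrBot` and prepare its search. -/
def openStrip : Prog :=
  collect ;;
  block [.realSub vrLow vrBot vrOne, .realAdd vrHigh vrTop vrOne, .intAdd viStamp viStamp viOne]

/-- Go on to the next class, cyclically. -/
def advance : Prog :=
  block [.realMul vrLast vrTop vrOne, .intAdd viShift viShift viK, .intAdd viClass viClass viOne] ;;
  .ite (.intLe viClasses viClass) (block [.intConst viShift 0, .intConst viClass 0]) skip

/-- Colour the disks of the strip with lower boundary `vrBot`. -/
def treatStrip : Prog := openStrip ;; solveStrip ;; advance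

/-- Treat the next strip, or clear `viGo` if there is none. -/
def nextStrip : Prog :=
  findBottom ;; .ite (.realLe vrBound vrBot) (block [.intConst viGo 0]) treatStrip

/-- Treat all strips. -/
def allStrips : Prog := .loop (.intLe viOne viGo) nextStrip

namespace Task

/-- The task `P` is stored: the part of the store that is constant while the strips are treated. -/
structure Stored (P : Task) (σ : Store) : Prop extends σ.HasConstants where
  numPoints : σ.intVar viN = P.n
  numDisks : σ.intVar viM = P.m
  numColors : σ.intVar viK = P.k
  base : σ.intVar viBase = P.m + 1
  digits : σ.intVar viDigits = 4 * P.k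
  four : σ.intVar viFour = 4
  classes : σ.intVar viClasses = P.classes
  long : 1 ≤ σ.intVar viLong ↔ P.depth = 4
  height : σ.realVar vrHeight = P.height
  bound : σ.realVar vrBound = P.bound
  pointX : σ.realArr arPx = P.PX
  pointY : σ.realArr arPy = P.PY
  centerX : σ.realArr arCx = P.X
  centerY : σ.realArr arCy = P.Y
  powers : σ.HasPowers (P.m + 1) (4 * P.k)

/-- The pieces of memory to which `Task.Stored` refers. -/
def storedCells : List Cell :=
  [.intVar viOne, .intVar viZero, .realVar vrOne, .intVar viN, .intVar viM, .intVar viK,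
    .intVar viBase, .intVar viDigits, .intVar viFour, .intVar viClasses, .intVar viLong,
    .realVar vrHeight, .realVar vrBound, .realArr arPx, .realArr arPy, .realArr arCx,
    .realArr arCy, .intArr aiPow]

/-- The points with ordinates up to `last` have been treated. -/
structure Progress (P : Task) (last : ℝ) (σ : Store) : Prop extends P.Stored σ where
  seen : ∀ c, σ.intArr aiSeen c ≤ σ.intVar viStamp
  reached : σ.realVar vrLast = last
  class_lt : σ.intVar viClass < P.classes
  shift : σ.intVar viShift = σ.intVar viClass * P.k
  colored : P.Colored last (σ.intVar viClass) (σ.intArr aiOut)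

/-- A bound for the time to solve a strip with `cnt` points. -/
def stripTime (P : Task) (cnt : ℕ) : ℕ := solveTime ((P.m + 1) ^ (P.depth * P.k)) P.m P.k cnt

section

variable {P : Task} {σ : Store} {last lo : ℝ}

lemma Stored.of_eqOff {p : Prog} {σ' : Store} (h : P.Stored σ) (hσ : EqOff p σ σ')
    (hp : storedCells.all (fun c => !p.writes c) = true := by rfl) : P.Stored σ' := by
  simp only [storedCells, List.all_cons, List.all_nil, Bool.and_true, Bool.and_eq_true,
    Bool.not_eq_true'] at hp
  refine ⟨h.toHasConstants.of_eqOff hσ hp.1 hp.2.1 hp.2.2.1, ?_, ?_, ?_, ?_, ?_, ?_, ?_, ?_, ?_, ?_,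
    ?_, ?_, ?_, ?_, ?_⟩ <;>
    simp only [hp, hσ.int, hσ.real, hσ.realArr, hσ.intArr, Store.HasPowers]
  exacts [h.numPoints, h.numDisks, h.numColors, h.base, h.digits, h.four, h.classes, h.long,
    h.height, h.bound, h.pointX, h.pointY, h.centerX, h.centerY, h.powers]

lemma Stored.listed_eq (h : P.Stored σ) (hlisted : σ.listed = (List.range P.n).filter fun i =>
      P.PY i ∈ Set.Icc lo (lo + P.height)) :
    σ.intVar viCount = (P.inStrip lo).card ∧
      (P.strip lo).points = {p | ∃ i < σ.intVar viCount, p = σ.point (σ.intArr aiList i)} := by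
  constructor
  · calc σ.intVar viCount = σ.listed.length := by simp [Store.listed]
      _ = (P.inStrip lo).card := by rw [hlisted]; rfl
  · have hmem : ∀ i, i ∈ P.inStrip lo ↔ ∃ x < σ.intVar viCount, σ.intArr aiList x = i := by
      intro i
      rw [mem_inStrip]
      simpa [hlisted] using (show i ∈ σ.listed ↔ _ by simp [Store.listed])
    ext p
    simp only [strip, hmem, Set.mem_ofPred_eq, Store.point, h.pointX, h.pointY, point]
    grind

lemma openStrip_spec (hP : P.Valid) (h : P.Stored σ) (hlo : σ.realVar vrBot = lo) :
    HaltsWithin openStrip σ (8 * P.n + 8) fun σ' => (P.strip lo).Loaded σ' ∧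
      σ'.intVar viCount = (P.inStrip lo).card ∧ σ'.intVar viStamp = σ.intVar viStamp + 1 ∧
      σ'.realVar vrTop = lo + P.height := by
  have hcollect := collect_spec h.toHasConstants
  rw [h.numPoints, h.height, h.pointY, hlo] at hcollect
  refine hcollect.bind (fun σ₁ h₁ ⟨htop, hlisted⟩ => ?_) (T₂ := 3) (by omega)
  have hS₁ := h.of_eqOff h₁
  obtain ⟨hcount, hpoints⟩ := hS₁.listed_eq hlisted
  refine (HaltsWithin.block (Q := fun σ' => σ'.realVar vrLow = lo - 1 ∧
    σ'.realVar vrHigh = lo + P.height + 1 ∧ σ'.intVar viStamp = σ.intVar viStamp + 1) (by simp)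
    le_rfl ?_).mono le_rfl fun σ₂ h₂ ⟨hlow, hhigh, hstamp⟩ => ?_
  · simp (decide := true) [Instr.exec, htop, hlo, hS₁.realOne, hS₁.one, h₁.real, h₁.int]
  have hS₂ := hS₁.of_eqOff h₂
  have hcount₂ := h₂.int viCount rfl
  refine ⟨⟨hS₂.toHasConstants, ?_, hS₂.numDisks, hS₂.numColors, hS₂.base, hS₂.digits, hS₂.four,
    hS₂.long, hlow, hhigh, hS₂.centerX, hS₂.centerY, ?_, hS₂.powers⟩, hcount₂.trans hcount, hstamp,
    (h₂.real vrTop rfl).trans htop⟩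
  · rw [hS₂.bound]
    exact hP.admissible lo
  · simpa only [hcount₂, h₂.intArr aiList rfl, Store.point, h₂.realArr arPx rfl,
      h₂.realArr arPy rfl] using hpoints

lemma advance_spec (h : P.Stored σ) (hclass : σ.intVar viClass < P.classes)
    (hshift : σ.intVar viShift = σ.intVar viClass * P.k) :
    HaltsWithin advance σ 6 fun σ' => σ'.realVar vrLast = σ.realVar vrTop ∧
      σ'.intVar viClass < P.classes ∧ σ'.intVar viShift = σ'.intVar viClass * P.k ∧
      (σ'.intVar viClass = σ.intVar viClass + 1 ∨
        σ'.intVar viClass = 0 ∧ σ.intVar viClass + 1 = P.classes) := by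
  refine .bind (T₁ := 3) (T₂ := 3) (.block (Q := fun σ' => σ'.realVar vrLast = σ.realVar vrTop ∧
    σ'.intVar viShift = (σ.intVar viClass + 1) * P.k ∧
    σ'.intVar viClass = σ.intVar viClass + 1) (by simp) (by simp)
    (by simp [Instr.exec, h.realOne, h.one, h.numColors, hshift, add_one_mul]))
    (fun σ₁ h₁ ⟨hlast, hshift₁, hclass₁⟩ => ?_) le_rfl
  refine .ite (T₁ := 2) (fun hb => .block (by simp) (by simp) ?_)
    (fun hb => .skip (by simp) ⟨hlast, ?_⟩) le_rfl <;>
    simp only [Test.Holds, (h.of_eqOff h₁).classes, hclass₁] at hb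
  · simp [Instr.exec, hlast]
    omega
  · simpa [hshift₁, hclass₁] using hb

lemma treatStrip_spec (hP : P.Valid) (h : P.Progress last σ) (hlo : P.IsNextBottom last lo)
    (hbot : σ.realVar vrBot = lo) :
    HaltsWithin treatStrip σ (8 * P.n + 14 + P.stripTime (P.inStrip lo).card)
      (P.Progress (lo + P.height)) := by
  refine .bind (T₂ := P.stripTime (P.inStrip lo).card + 6) (openStrip_spec hP h.toStored hbot)
    (fun σ₁ h₁ ⟨hloaded, hcount, hstamp, htop⟩ => ?_) (by omega)
  obtain ⟨s, hs⟩ := hP.solvable lo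
  have hsolve := solveStrip_spec hloaded (fun c => ?_) hs
  · rw [hcount, h₁.int viShift rfl, h₁.intArr aiOut rfl, h.shift,
      (h.toStored.of_eqOff h₁).bound] at hsolve
    refine hsolve.bind (fun σ₂ h₂ ⟨hseen, t, ht, hcovered, hout⟩ => ?_) (T₂ := 6) le_rfl
    have hclass₂ : σ₂.intVar viClass = σ.intVar viClass := by rw [h₂.int _ rfl, h₁.int _ rfl]
    have hS₂ := (h.toStored.of_eqOff h₁).of_eqOff h₂
    refine (advance_spec hS₂ (hclass₂.trans_lt h.class_lt)
      (by rw [h₂.int _ rfl, h₁.int _ rfl, hclass₂, h.shift])).mono le_rfl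
      fun σ₃ h₃ ⟨hlast, hclass, hshift, hnext⟩ => ?_
    have hlast_lt : last < lo := by
      obtain ⟨i, hi, rfl⟩ := hlo.1
      exact hi.2
    have hcolored : P.Colored (lo + P.height) (σ.intVar viClass + 1) (σ₃.intArr aiOut) := by
      rw [h₃.intArr _ rfl]
      exact h.colored.recolor hP h.class_lt hlast_lt (fun i hi hlt => hlo.2 ⟨i, ⟨hi, hlt⟩, rfl⟩) ht
        hcovered hout
    refine ⟨hS₂.of_eqOff h₃, fun c => ?_, by rw [hlast, h₂.real _ rfl, htop], hclass, hshift, ?_⟩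
    · rw [h₃.intArr _ rfl, h₃.int _ rfl, h₂.int _ rfl]
      exact hseen c
    · rw [hclass₂] at hnext
      rcases hnext with hnext | ⟨hnext, hwrap⟩ <;> rw [hnext]
      · exact hcolored
      · exact (hwrap ▸ hcolored).wrap
  · rw [h₁.intArr _ rfl, hstamp]
    exact Nat.lt_succ_of_le (h.seen c)

lemma Progress.findBottom_spec (h : P.Progress last σ) :
    HaltsWithin findBottom σ (7 * P.n + 4) fun σ' => P.Progress last σ' ∧
      IsLeast (insert P.bound (P.PY '' {i | i < P.n ∧ last < P.PY i})) (σ'.realVar vrBot) := by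
  have hfind := CDUDC.findBottom_spec h.toHasConstants
  rw [h.numPoints, h.bound, h.reached, h.pointY] at hfind
  refine hfind.mono le_rfl
    fun σ₁ h₁ hbot => ⟨⟨h.toStored.of_eqOff h₁, ?_, ?_, ?_, ?_, ?_⟩, hbot⟩ <;>
    simp (decide := true) only [h₁.int, h₁.intArr, h₁.real]
  exacts [h.seen, h.reached, h.class_lt, h.shift, h.colored]

lemma nextStrip_spec_of_remaining_eq_zero (h : P.Progress last σ) (hrem : P.remaining last = 0) :
    HaltsWithin nextStrip σ (7 * P.n + 6) fun σ' => σ'.intVar viGo = 0 ∧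
      ∃ cl, P.Colored last cl (σ'.intArr aiOut) := by
  refine h.findBottom_spec.bind (T₂ := 2) (fun σ₁ _ ⟨h, hbot⟩ => ?_) le_rfl
  have hempty : {i | i < P.n ∧ last < P.PY i} = ∅ := by
    ext i
    simpa using Finset.filter_eq_empty_iff.1 (Finset.card_eq_zero.1 hrem) (x := i)
  rw [hempty, Set.image_empty, insert_empty_eq] at hbot
  refine .ite (T₁ := 1) (fun _ => .block (by simp) (by simp) ⟨by simp [Instr.exec], _, h.colored⟩)
    (fun hb => absurd ?_ hb) le_rfl
  exact (h.bound.trans hbot.1.symm).le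

lemma nextStrip_spec_of_isNextBottom (hP : P.Valid) (h : P.Progress last σ)
    (hlo : P.IsNextBottom last lo) :
    HaltsWithin nextStrip σ (15 * P.n + 20 + P.stripTime (P.inStrip lo).card) fun σ' =>
      σ'.intVar viGo = σ.intVar viGo ∧ P.Progress (lo + P.height) σ' := by
  refine h.findBottom_spec.bind (T₂ := 8 * P.n + 15 + P.stripTime (P.inStrip lo).card)
    (fun σ₁ h₁ ⟨h, hbot⟩ => ?_) (by omega)
  have hbound : lo < P.bound := by
    obtain ⟨i, hi, rfl⟩ := hlo.1
    linarith [hP.ordinate i hi.1]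
  replace hbot : σ₁.realVar vrBot = lo := by
    rw [hbot.unique (hlo.insert P.bound), min_eq_right hbound.le]
  refine .ite (T₁ := 8 * P.n + 14 + P.stripTime (P.inStrip lo).card) (fun hb => absurd hb ?_)
    (fun _ => (treatStrip_spec hP h hlo hbot).mono le_rfl fun σ₂ h₂ h => ⟨?_, h⟩) (by omega)
  · rw [Test.Holds, hbot, h.bound]
    exact hbound.not_ge
  · rw [h₂.int _ rfl, h₁.int _ rfl]

lemma stripTime_le (P : Task) {cnt : ℕ} (h : 1 ≤ cnt) : P.stripTime cnt ≤ cnt * P.stripTime 1 := by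
  have htry : tryDiskTime P.k cnt + 2 ≤ cnt * (tryDiskTime P.k 1 + 2) := by
    unfold tryDiskTime
    have : P.k * (56 * P.k + 93) + 17 ≤ cnt * (P.k * (56 * P.k + 93) + 17) :=
      Nat.le_mul_of_pos_left _ h
    linarith
  have hexpand : expandTime P.m P.k cnt + 1 ≤ cnt * (expandTime P.m P.k 1 + 1) := by
    unfold expandTime
    linarith [Nat.mul_le_mul_left (P.m + 1) htry]
  unfold stripTime solveTime searchTime
  set N := (P.m + 1) ^ (P.depth * P.k)
  have : 7 * N + 16 * P.k + 13 ≤ cnt * (7 * N + 16 * P.k + 13) := Nat.le_mul_of_pos_left _ h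
  linarith [Nat.mul_le_mul_left (N + 1) hexpand]

lemma allStrips_spec (hP : P.Valid) (h : P.Progress last σ) (hgo : σ.intVar viGo = 1) :
    HaltsWithin allStrips σ
      (5 * P.m * (15 * P.n + 21) + P.remaining last * P.stripTime 1 + (7 * P.n + 8)) fun σ' =>
      ∃ last' cl, P.remaining last' = 0 ∧ P.Colored last' cl (σ'.intArr aiOut) := by
  refine .loop (fun r σ' =>
    (σ'.intVar viOne = 1 ∧ σ'.intVar viGo = 0 ∧ 1 ≤ r ∧
      ∃ last' cl, P.remaining last' = 0 ∧ P.Colored last' cl (σ'.intArr aiOut)) ∨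
    (σ'.intVar viGo = 1 ∧ ∃ last', P.Progress last' σ' ∧ P.stripsLeft last' * (15 * P.n + 21) +
      P.remaining last' * P.stripTime 1 + (7 * P.n + 8) ≤ r)) (.inr ⟨hgo, last, h, ?_⟩) ?_ ?_
  · gcongr
    exact stripsLeft_le hP last
  · rintro r σ' (⟨-, -, hr, hdone⟩ | ⟨hgo, last', h, -⟩) hb
    · exact ⟨hr, hdone⟩
    · simp [Test.Holds, h.one, hgo] at hb
  · rintro r σ' (⟨hone, hgo, -⟩ | ⟨hgo, last', h, hr⟩) hb
    · simp [Test.Holds, hone, hgo] at hb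
    by_cases hrem : P.remaining last' = 0
    · exact ⟨_, 1, by omega, (nextStrip_spec_of_remaining_eq_zero h hrem).mono le_rfl
        fun σ'' h'' ⟨hgo, hcolored⟩ => .inl ⟨by rw [h''.int _ rfl, h.one], hgo, le_rfl,
          last', hcolored.imp fun _ => .intro hrem⟩⟩
    obtain ⟨lo, hlo⟩ := exists_isNextBottom hrem
    refine ⟨_, _, ?_, (nextStrip_spec_of_isNextBottom hP h hlo).mono le_rfl
      fun σ'' _ ⟨hgo'', h''⟩ => .inr ⟨hgo''.trans hgo, _, h'', le_rfl⟩⟩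
    have hlast : last' < lo := by
      obtain ⟨i, hi, rfl⟩ := hlo.1
      exact hi.2
    have hstrips := Nat.mul_le_mul_right (15 * P.n + 21) (hlo.stripsLeft_add_one_le hP)
    have hpoints := Nat.mul_le_mul_right (P.stripTime 1) (remaining_add_card_inStrip_le hP hlast)
    have htime := P.stripTime_le (Finset.card_pos.2 (hlo.inStrip_nonempty hP))
    rw [add_mul] at hpoints hstrips
    omega

end

end Task

/-! ### From inputs to tasks -/

lemma Strip.exists_solves_of_set (G : Strip) {F : Set (ℕ × ℕ)}
    (heligible : ∀ q ∈ F, G.Eligible q)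
    (hfar : F.Pairwise fun a b => a.2 = b.2 → 4 < sqDist (G.center a.1) (G.center b.1))
    (hcovers : ∀ p ∈ G.points, ∃ q ∈ F, sqDist (G.center q.1) p ≤ 1) : ∃ s, G.Solves s := by
  have hF : F.Finite := ((Set.finite_Iio G.m).prod (Set.finite_Iio G.k)).subset fun q hq =>
    ⟨(heligible q hq).disk, (heligible q hq).color⟩
  let r : ℕ × ℕ → ℕ × ℕ → Prop := fun a b => G.X b.1 ≤ G.X a.1
  have : Std.Total r := ⟨fun _ _ => le_total _ _⟩
  have : IsTrans (ℕ × ℕ) r := ⟨fun _ _ _ hab hbc => hbc.trans hab⟩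
  classical
  have hmem (q) : q ∈ hF.toFinset.toList.insertionSort r ↔ q ∈ F := by simp
  refine ⟨hF.toFinset.toList.insertionSort r, ⟨?_, List.pairwise_insertionSort r _, ?_⟩, ?_⟩
  · simpa only [hmem]
  · have hnodup := (List.perm_insertionSort r _).nodup_iff.2 hF.toFinset.nodup_toList
    exact hnodup.pairwise_of_forall_ne fun a ha b hb => hfar ((hmem a).1 ha) ((hmem b).1 hb)
  · simpa only [hmem]

/-- The coordinates of a point of the plane. -/
def toPair (z : Plane) : ℝ × ℝ := (z 0, z 1)

lemma dist_sq_eq_sqDist (z w : Plane) : dist z w ^ 2 = sqDist (toPair z) (toPair w) := by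
  rw [EuclideanSpace.dist_eq, Real.sq_sqrt (by positivity)]
  simp only [Fin.sum_univ_two, Real.dist_eq, sq_abs, sqDist, toPair]
  ring

lemma mem_unitDisk_iff {c z : Plane} : z ∈ unitDisk c ↔ sqDist (toPair c) (toPair z) ≤ 1 := by
  rw [unitDisk, Metric.mem_closedBall, ← dist_sq_eq_sqDist, sq_le_one_iff₀ dist_nonneg, dist_comm]

lemma disjoint_unitDisk_iff {c c' : Plane} :
    Disjoint (unitDisk c) (unitDisk c') ↔ 4 < sqDist (toPair c) (toPair c') := by
  rw [unitDisk, unitDisk, disjoint_closedBall_closedBall_iff zero_le_one zero_le_one,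
    ← dist_sq_eq_sqDist, show (4 : ℝ) = 2 ^ 2 by norm_num,
    pow_lt_pow_iff_left₀ zero_le_two dist_nonneg two_ne_zero, one_add_one_eq_two]

lemma coords_of_lt {r : ℕ} (f : Fin r → Plane) (i : Fin 2) (j : Fin r) :
    coords f i j = f j i := by
  simp [coords]

/-- The sum of the squares of the first `N` entries, a bound for their absolute values which the
machine can compute without comparisons. -/
def sumSq (f : ℕ → ℝ) (N : ℕ) : ℝ := ∑ i ∈ Finset.range N, f i * f i

lemma sumSq_nonneg (f : ℕ → ℝ) (N : ℕ) : 0 ≤ sumSq f N :=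
  Finset.sum_nonneg fun i _ => mul_self_nonneg (f i)

lemma abs_le_one_add_sumSq (f : ℕ → ℝ) {i N : ℕ} (hi : i < N) : |f i| ≤ 1 + sumSq f N := by
  have hle : f i * f i ≤ sumSq f N :=
    Finset.single_le_sum (fun i _ => mul_self_nonneg (f i)) (Finset.mem_range.2 hi)
  rw [← abs_mul_abs_self] at hle
  nlinarith [sq_nonneg (|f i| - 1), abs_nonneg (f i)]

namespace Input

/-- A bound for the coordinates of the input, with room to spare. -/
def coordBound (I : Input) : ℝ :=
  20 + sumSq (coords I.point 0) I.n + sumSq (coords I.point 1) I.n + sumSq (coords I.center 0) I.m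

variable (I : Input)

lemma abs_point_le (l : Fin 2) {i : ℕ} (hi : i < I.n) :
    |coords I.point l i| ≤ I.coordBound - 19 := by
  have hl := abs_le_one_add_sumSq (coords I.point l) hi
  have h₀ := sumSq_nonneg (coords I.point 0) I.n
  have h₁ := sumSq_nonneg (coords I.point 1) I.n
  have h₂ := sumSq_nonneg (coords I.center 0) I.m
  rw [coordBound]
  fin_cases l <;> dsimp only [Fin.mk_one, Fin.zero_eta] at hl ⊢ <;> linarith

lemma abs_center_le {d : ℕ} (hd : d < I.m) : |coords I.center 0 d| ≤ I.coordBound - 19 := by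
  have h := abs_le_one_add_sumSq (coords I.center 0) hd
  have h₀ := sumSq_nonneg (coords I.point 0) I.n
  have h₁ := sumSq_nonneg (coords I.point 1) I.n
  rw [coordBound]
  linarith

end Input

/-- The task that the program makes of the input `I` at grid width `τ`. The abscissa of the dummy
disk is the entry that follows those of the disks. -/
def taskOf (τ : ℝ) (I : Input) : Task where
  n := I.n
  m := I.m
  k := I.k
  depth := if 2 ≤ τ * τ then 4 else 3
  classes := if 2 ≤ τ * τ then 4 else 9
  X := Function.update (coords I.center 0) I.m (-I.coordBound)
  Y := coords I.center 1
  PX := coords I.point 0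
  PY := coords I.point 1
  height := if 2 ≤ τ * τ then 4 / 3 else 1 / 2
  bound := I.coordBound

section taskOf

variable {τ : ℝ} {I : Input}

lemma taskOf_center (j : Fin I.m) : (taskOf τ I).center j = toPair (I.center j) := by
  simp [Task.center, taskOf, toPair, Function.update_of_ne j.2.ne, coords_of_lt]

lemma taskOf_point (i : Fin I.n) : (taskOf τ I).point i = toPair (I.point i) := by
  simp [Task.point, taskOf, toPair, coords_of_lt]

lemma exists_solves_taskOf_strip (h : I.HasColorableCover I.k) (lo : ℝ) :
    ∃ s, ((taskOf τ I).strip lo).Solves s := by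
  obtain ⟨S, χ, hcover, hcolor, hdisjoint⟩ := h
  set G := (taskOf τ I).strip lo
  have hcenter (j : Fin I.m) : G.center j = toPair (I.center j) := taskOf_center (τ := τ) j
  refine G.exists_solves_of_set (F := {q | G.Eligible q ∧ ∃ j ∈ S, q = ((j : ℕ), χ j - 1)})
    (fun q hq => hq.1) ?_ ?_
  · rintro _ ⟨-, j, hj, rfl⟩ _ ⟨-, j', hj', rfl⟩ hne heq
    rw [hcenter, hcenter, ← disjoint_unitDisk_iff]
    refine hdisjoint j hj j' hj' (fun h => hne (h ▸ rfl)) ?_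
    have := hcolor j hj
    have := hcolor j' hj'
    dsimp only at heq
    omega
  · rintro _ ⟨i, hi, rfl⟩
    obtain ⟨hin, hlo, hhi⟩ := Task.mem_inStrip.1 hi
    obtain ⟨j, hj, hmem⟩ := hcover ⟨i, hin⟩
    have hnear : sqDist (G.center j) ((taskOf τ I).point i) ≤ 1 := by
      rw [hcenter, taskOf_point ⟨i, hin⟩]
      exact mem_unitDisk_iff.1 hmem
    obtain ⟨hlow, hhigh⟩ : -1 ≤ G.Y j - (taskOf τ I).PY i ∧ G.Y j - (taskOf τ I).PY i ≤ 1 :=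
      abs_le.1 (abs_snd_sub_le_one hnear)
    have hχ : χ j - 1 < I.k := by have := hcolor j hj; omega
    refine ⟨_, ⟨⟨j.2, hχ, ?_, ?_⟩, j, hj, rfl⟩, hnear⟩
    · change lo - 1 ≤ G.Y j
      linarith
    · change G.Y j ≤ lo + (taskOf τ I).height + 1
      linarith

lemma taskOf_valid (hk : 1 ≤ I.k) (h : I.HasColorableCover I.k) : (taskOf τ I).Valid where
  k_pos := hk
  strips := by by_cases hτ : 2 ≤ τ * τ <;> simp [taskOf, hτ]
  dummy := by simp [taskOf]
  left d hd := by
    have hX : (taskOf τ I).X d = coords I.center 0 d := Function.update_of_ne hd.ne _ _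
    rw [hX]
    change -I.coordBound + 10 ≤ _
    linarith [(abs_le.1 (I.abs_center_le hd)).1]
  abscissa i hi := by
    have h := abs_le.1 (I.abs_point_le 0 hi)
    constructor <;> simp only [taskOf] <;> linarith
  ordinate i hi := by
    have h := abs_le.1 (I.abs_point_le 1 hi)
    constructor <;> simp only [taskOf] <;> linarith
  solvable := exists_solves_taskOf_strip h

lemma Task.Colored.isColoredCover {last : ℝ} {cl r : ℕ} {σ : Store}
    (h : (taskOf τ I).Colored last cl (σ.intArr aiOut))
    (hremaining : (taskOf τ I).remaining last = 0) (hr : (taskOf τ I).classes ≤ r) :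
    I.IsColoredCover (r * I.k) (outDisks I σ) (outColor I σ) := by
  refine ⟨fun i => ?_, fun j hj => ⟨Nat.one_le_iff_ne_zero.2 hj, ?_⟩, fun j hj j' _ hne heq => ?_⟩
  · have hle : (taskOf τ I).PY i ≤ last := by
      rw [Task.remaining, Finset.card_eq_zero, Finset.filter_eq_empty_iff] at hremaining
      exact not_lt.1 (hremaining (Finset.mem_range.2 i.2))
    obtain ⟨d, hd, hnear⟩ := h.cover i i.2 hle
    have hdm : d < I.m := (h.color d hd).1
    refine ⟨⟨d, hdm⟩, hd, mem_unitDisk_iff.2 ?_⟩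
    rwa [taskOf_point, taskOf_center ⟨d, hdm⟩] at hnear
  · obtain ⟨-, c, hc, i, hi, hcolor, -⟩ := h.color j hj
    calc outColor I σ j = c * I.k + i + 1 := hcolor
      _ ≤ (c + 1) * I.k := by rw [add_one_mul]; exact Nat.add_le_add_left hi _
      _ ≤ r * I.k := Nat.mul_le_mul_right _ (hc.trans_le hr)
  · have hfar := h.far j j' (Fin.val_ne_of_ne hne) hj heq
    rwa [taskOf_center, taskOf_center, ← disjoint_unitDisk_iff] at hfar

end taskOf

/-! ### The program: preparations -/

/-- Set the constants on which all parts of the program rely. -/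
def setConstants : Prog := block [.intConst viOne 1, .realConst vrOne 1]

/-- Give the next disk a colour of its own. -/
def colorStep : Prog :=
  block [.intAdd viTmp viDst viOne, .intStore aiOut viDst viTmp, .intAdd viDst viDst viOne]

/-- Give every disk a colour of its own. -/
def colorAll : Prog :=
  block [.intConst viDst 0, .intAdd viCopyCount viM viZero] ;; repeatN viCopyCount colorStep

lemma colorAll_spec {σ : Store} (hconst : σ.HasConstants) :
    HaltsWithin colorAll σ (5 * σ.intVar viM + 3) fun σ' =>
      ∀ x < σ.intVar viM, σ'.intArr aiOut x = x + 1 := by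
  refine .bind (T₁ := 2) (T₂ := 5 * σ.intVar viM + 1) (.block (Q := fun σ' =>
    σ'.intVar viDst = 0 ∧ σ'.intVar viCopyCount = σ.intVar viM) (by simp) (by simp)
    (by simp [Instr.exec, hconst.zero])) (fun σ₁ h₁ ⟨hdst, hcount⟩ => ?_) (by omega)
  have hconst₁ := hconst.of_eqOff h₁
  refine (HaltsWithin.repeatN (T₁ := 3) (fun i σ' =>
    σ'.intVar viDst = i ∧ ∀ x < i, σ'.intArr aiOut x = x + 1) hconst₁.one hcount rfl rfl
    (by simp [hdst]) (fun i σ v h => by simpa using h)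
    (fun i _ σ₂ h₂ ⟨hdst, hinv⟩ => .block (by simp) (by simp) ⟨?_, fun x hx => ?_⟩)
    (by omega)).mono le_rfl fun _ _ h => h.2
  · simp [Instr.exec, hdst, (hconst₁.of_eqOff h₂).one]
  · rcases Nat.lt_succ_iff_lt_or_eq.1 hx with hlt | rfl
    · simp [Instr.exec, setEntry_apply, hdst, hlt.ne, hinv x hlt]
    · simp [Instr.exec, setEntry_apply, hdst, (hconst₁.of_eqOff h₂).one]

/-- Add the square of the next entry of the real array `a` to `vrBound`. -/
def addSquare (a : ℕ) : Prog :=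
  block [.realLoad vrX a viDst, .realMul vrX vrX vrX, .realAdd vrBound vrBound vrX,
    .intAdd viDst viDst viOne]

/-- Add the squares of the entries of the real array `a` to `vrBound`, where the integer variable
`c` holds the number of entries. -/
def addSquares (a c : ℕ) : Prog :=
  block [.intAdd viCopyCount c viZero, .intConst viDst 0] ;; repeatN viCopyCount (addSquare a)

/-- Compute `Input.coordBound`. -/
def computeBound : Prog :=
  block [.realConst vrBound 20] ;;
  addSquares arPx viN ;; addSquares arPy viN ;; addSquares arCx viM

lemma addSquares_spec {σ : Store} (a : ℕ) {c N : ℕ} (hconst : σ.HasConstants)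
    (hc : σ.intVar c = N) :
    HaltsWithin (addSquares a c) σ (6 * N + 3) fun σ' =>
      σ'.realVar vrBound = σ.realVar vrBound + sumSq (σ.realArr a) N := by
  refine .bind (T₁ := 2) (T₂ := 6 * N + 1) (.block (Q := fun σ' =>
    σ'.intVar viCopyCount = N ∧ σ'.intVar viDst = 0) (by simp) (by simp)
    (by simp [Instr.exec, hconst.zero, hc])) (fun σ₁ h₁ ⟨hcount, hdst⟩ => ?_) (by omega)
  have hone : σ₁.intVar viOne = 1 := (h₁.int viOne rfl).trans hconst.one
  refine (HaltsWithin.repeatN (T₁ := 4) (fun i σ' => σ'.intVar viDst = i ∧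
    σ'.realVar vrBound = σ.realVar vrBound + sumSq (σ.realArr a) i) hone hcount rfl rfl
    (by simp [hdst, h₁.real vrBound rfl, sumSq]) (fun i σ v h => by simpa using h)
    (fun i _ σ₂ h₂ ⟨hdst, hinv⟩ => .block (by simp) (by simp) ⟨?_, ?_⟩)
    (by omega)).mono le_rfl fun _ _ h => h.2
  · simp [Instr.exec, hdst, h₂.int viOne rfl, hone]
  · simp [Instr.exec, hdst, hinv, h₂.realArr a rfl, h₁.realArr a rfl, sumSq, Finset.sum_range_succ,
      add_assoc]

lemma computeBound_spec {σ : Store} {n m : ℕ} (hconst : σ.HasConstants) (hn : σ.intVar viN = n)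
    (hm : σ.intVar viM = m) :
    HaltsWithin computeBound σ (12 * n + 6 * m + 10) fun σ' =>
      σ'.realVar vrBound = 20 + sumSq (σ.realArr arPx) n + sumSq (σ.realArr arPy) n +
        sumSq (σ.realArr arCx) m := by
  refine .bind (T₁ := 1) (T₂ := 12 * n + 6 * m + 9) (.block (Q := fun σ' =>
    σ'.realVar vrBound = 20) (by simp) (by simp) (by simp [Instr.exec])) (fun σ₁ h₁ hbound₁ => ?_)
    (by omega)
  have hconst₁ := hconst.of_eqOff h₁
  refine (addSquares_spec arPx hconst₁ ((h₁.int _ rfl).trans hn)).bind (T₂ := 6 * n + 6 * m + 6)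
    (fun σ₂ h₂ hbound₂ => ?_) (by omega)
  have hconst₂ := hconst₁.of_eqOff h₂
  have hn₂ : σ₂.intVar viN = n := by rw [h₂.int _ rfl, h₁.int _ rfl, hn]
  refine (addSquares_spec arPy hconst₂ hn₂).bind (T₂ := 6 * m + 3)
    (fun σ₃ h₃ hbound₃ => ?_) (by omega)
  have hm₃ : σ₃.intVar viM = m := by rw [h₃.int _ rfl, h₂.int _ rfl, h₁.int _ rfl, hm]
  refine (addSquares_spec arCx (hconst₂.of_eqOff h₃) hm₃).mono le_rfl fun σ₄ _ hbound₄ => ?_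
  simp (decide := true) only [hbound₄, hbound₃, hbound₂, hbound₁, h₃.realArr, h₂.realArr,
    h₁.realArr]

/-- Enter the next multiple of `viCode` into the table `aiPow`. -/
def tabulate : Prog :=
  block [.intStore aiPow viRow viTmp, .intAdd viTmp viTmp viCode, .intAdd viRow viRow viOne]

/-- Enter the `viBase` least multiples of `viCode` into the table `aiPow`, and multiply `viCode` by
`viBase`. -/
def tabulateMultiples : Prog :=
  block [.intConst viTmp 0, .intAdd viNearCount viBase viZero] ;; repeatN viNearCount tabulate ;;
  block [.intAdd viCode viTmp viZero]

/-- Fill the table `aiPow` as described in `Store.HasPowers`. -/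
def tabulatePowers : Prog :=
  block [.intConst viRow 0, .intConst viCode 1, .intAdd viCopyCount viDigits viZero] ;;
  repeatN viCopyCount tabulateMultiples

lemma tabulateMultiples_spec {σ : Store} {M r c : ℕ} (hconst : σ.HasConstants)
    (hbase : σ.intVar viBase = M) (hrow : σ.intVar viRow = r) (hcode : σ.intVar viCode = c) :
    HaltsWithin tabulateMultiples σ (5 * M + 4) fun σ' =>
      σ'.intVar viRow = r + M ∧ σ'.intVar viCode = M * c ∧
      (∀ v < M, σ'.intArr aiPow (r + v) = v * c) ∧
      ∀ x < r, σ'.intArr aiPow x = σ.intArr aiPow x := by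
  refine .bind (T₁ := 2) (T₂ := 5 * M + 2) (.block (Q := fun σ' =>
    σ'.intVar viTmp = 0 ∧ σ'.intVar viNearCount = M) (by simp) (by simp)
    (by simp [Instr.exec, hconst.zero, hbase])) (fun σ₁ h₁ ⟨htmp, hcount⟩ => ?_) (by omega)
  have hconst₁ := hconst.of_eqOff h₁
  refine (HaltsWithin.repeatN (T₁ := 3) (T := 5 * M + 1) (fun i σ' =>
    σ'.intVar viRow = r + i ∧ σ'.intVar viTmp = i * c ∧
    (∀ v < i, σ'.intArr aiPow (r + v) = v * c) ∧
    ∀ x < r, σ'.intArr aiPow x = σ.intArr aiPow x) hconst₁.one hcount rfl rfl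
    (by simp (decide := true) [htmp, h₁.int, h₁.intArr, hrow]) (fun i σ v h => by simpa using h)
    (fun i _ σ₂ h₂ ⟨hrow, htmp, hnew, hold⟩ => ?_) (by omega)).bind (T₂ := 1)
    (fun σ₃ h₃ ⟨hrow, htmp, hnew, hold⟩ => .block (by simp) (by simp) ⟨?_, ?_, hnew, hold⟩) le_rfl
  · have hcode₂ : σ₂.intVar viCode = c := by rw [h₂.int _ rfl, h₁.int _ rfl, hcode]
    refine .block (by simp) (by simp) ⟨?_, ?_, fun v hv => ?_, fun x hx => ?_⟩
    · simp [Instr.exec, hrow, (hconst₁.of_eqOff h₂).one, add_assoc]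
    · simp [Instr.exec, htmp, hcode₂, add_one_mul]
    · rcases Nat.lt_succ_iff_lt_or_eq.1 hv with hlt | rfl
      · simp [Instr.exec, setEntry_apply, hrow, hlt.ne, hnew v hlt]
      · simp [Instr.exec, setEntry_apply, hrow, htmp]
    · simp [Instr.exec, setEntry_apply, hrow, (hx.trans_le (Nat.le_add_right _ i)).ne, hold x hx]
  · simpa [Instr.exec] using hrow
  · simp [Instr.exec, htmp, (hconst₁.of_eqOff h₃).zero]

lemma tabulatePowers_spec {σ : Store} {M L : ℕ} (hconst : σ.HasConstants)
    (hbase : σ.intVar viBase = M) (hdigits : σ.intVar viDigits = L) :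
    HaltsWithin tabulatePowers σ (L * (5 * M + 6) + 4) fun σ' => σ'.HasPowers M L := by
  refine .bind (T₁ := 3) (T₂ := L * (5 * M + 6) + 1) (.block (Q := fun σ' =>
    σ'.intVar viRow = 0 ∧ σ'.intVar viCode = 1 ∧ σ'.intVar viCopyCount = L) (by simp) (by simp)
    (by simp [Instr.exec, hconst.zero, hdigits])) (fun σ₁ h₁ ⟨hrow, hcode, hcount⟩ => ?_)
    (by omega)
  have hconst₁ := hconst.of_eqOff h₁
  refine (HaltsWithin.repeatN (T₁ := 5 * M + 4) (fun i σ' => σ'.intVar viRow = i * M ∧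
    σ'.intVar viCode = M ^ i ∧ σ'.HasPowers M i) hconst₁.one hcount rfl rfl
    (by simp [hrow, hcode, Store.HasPowers]) (fun i σ v h => by simpa [Store.HasPowers] using h)
    (fun i _ σ₂ h₂ ⟨hrow, hcode, hinv⟩ => ?_) le_rfl).mono le_rfl fun _ _ h => h.2.2
  have hbase₂ : σ₂.intVar viBase = M := by rw [h₂.int _ rfl, h₁.int _ rfl, hbase]
  refine (tabulateMultiples_spec (hconst₁.of_eqOff h₂) hbase₂ hrow hcode).mono le_rfl
    fun σ₃ _ ⟨hrow, hcode, hnew, hold⟩ => ⟨by rw [hrow, add_one_mul], by rw [hcode, pow_succ'],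
      fun i' hi' v hv => ?_⟩
  rcases Nat.lt_succ_iff_lt_or_eq.1 hi' with hlt | rfl
  · rw [hold, hinv i' hlt v hv]
    calc i' * M + v < (i' + 1) * M := by rw [add_one_mul]; omega
      _ ≤ i * M := Nat.mul_le_mul_right _ hlt
  · exact hnew v hv

/-- Set the parameters of the task `taskOf τ I`. -/
def setParams : Prog :=
  block [.intAdd viBase viM viOne, .intAdd viDigits viK viK, .intAdd viDigits viDigits viDigits,
    .intConst viFour 4, .intConst viGo 1, .realMul vrX vrTau vrTau, .realConst vrY 2] ;;
  .ite (.realLe vrY vrX)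
    (block [.realConst vrHeight (4 / 3), .intConst viClasses 4, .intConst viLong 1])
    (block [.realConst vrHeight (1 / 2), .intConst viClasses 9, .intConst viLong 0])

/-- Start below all points, and enter the dummy disk. -/
def setStart : Prog :=
  block [.realConst vrX 0, .realSub vrX vrX vrBound, .realStore arCx viM vrX,
    .realMul vrLast vrX vrOne]

/-- Turn the input into a task. -/
def prepare : Prog := setParams ;; computeBound ;; setStart ;; tabulatePowers

lemma setParams_spec {σ : Store} {τ : ℝ} {m k : ℕ} (hone : σ.intVar viOne = 1)
    (hτ : σ.realVar vrTau = τ) (hm : σ.intVar viM = m) (hk : σ.intVar viK = k) :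
    HaltsWithin setParams σ 11 fun σ' => σ'.intVar viBase = m + 1 ∧ σ'.intVar viDigits = 4 * k ∧
      σ'.intVar viFour = 4 ∧ σ'.intVar viGo = 1 ∧
      σ'.realVar vrHeight = (if 2 ≤ τ * τ then 4 / 3 else 1 / 2) ∧
      σ'.intVar viClasses = (if 2 ≤ τ * τ then 4 else 9) ∧
      (1 ≤ σ'.intVar viLong ↔ (if 2 ≤ τ * τ then 4 else 3) = 4) := by
  refine .bind (T₁ := 7) (T₂ := 4) (.block (Q := fun σ' => σ'.intVar viBase = m + 1 ∧
    σ'.intVar viDigits = 4 * k ∧ σ'.intVar viFour = 4 ∧ σ'.intVar viGo = 1 ∧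
    σ'.realVar vrX = τ * τ ∧ σ'.realVar vrY = 2) (by simp) (by simp) ?_)
    (fun σ₁ _ ⟨hbase, hdigits, hfour, hgo, hx, hy⟩ => ?_) le_rfl
  · simp only [List.foldl, Instr.exec]
    simp [hone, hτ, hm, hk]
    omega
  · refine .ite (T₁ := 3) (fun hb => .block (by simp) (by simp) ?_)
      (fun hb => .block (by simp) (by simp) ?_) le_rfl <;>
      rw [Test.Holds, hx, hy] at hb <;>
      simp [Instr.exec, hbase, hdigits, hfour, hgo, hb]

lemma taskOf_colored {τ : ℝ} {I : Input} (hk : 1 ≤ I.k) (h : I.HasColorableCover I.k) :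
    (taskOf τ I).Colored (-I.coordBound) 0 0 where
  color d hd := absurd rfl hd
  far d d' _ hd := absurd rfl hd
  cover i hi hle := by
    have hi' : -I.coordBound + 10 ≤ (taskOf τ I).PY i := ((taskOf_valid hk h).ordinate i hi).1
    linarith

lemma Task.Stored.progress_of_eqOff_prepare {τ : ℝ} {I : Input} {σ : Store}
    (hstored : (taskOf τ I).Stored σ) (hk : 1 ≤ I.k) (h : I.HasColorableCover I.k)
    (hσ : EqOff (.seq setConstants prepare) (initStore τ I) σ)
    (hlast : σ.realVar vrLast = -I.coordBound) : (taskOf τ I).Progress (-I.coordBound) σ := by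
  have hclass : σ.intVar viClass = 0 := hσ.int _ rfl
  have hshift : σ.intVar viShift = 0 := hσ.int _ rfl
  have hseen : σ.intArr aiSeen = 0 := hσ.intArr _ rfl
  have hout : σ.intArr aiOut = 0 := hσ.intArr _ rfl
  refine ⟨hstored, fun c => ?_, hlast, ?_, ?_, ?_⟩
  · simp [hseen]
  · rw [hclass]
    rcases (taskOf_valid (τ := τ) hk h).strips with ⟨-, -, hc⟩ | ⟨-, -, hc⟩ <;> rw [hc] <;> omega
  · rw [hshift, hclass, zero_mul]
  · rw [hclass, hout]
    exact taskOf_colored hk h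

lemma setStart_spec {σ : Store} {b : ℝ} {m : ℕ} (hone : σ.realVar vrOne = 1)
    (hb : σ.realVar vrBound = b) (hm : σ.intVar viM = m) :
    HaltsWithin setStart σ 4 fun σ' => σ'.realVar vrLast = -b ∧
      σ'.realArr arCx = Function.update (σ.realArr arCx) m (-b) :=
  .block (by simp) (by simp) (by simp [Instr.exec, setEntry, hone, hb, hm])

lemma prepare_spec {τ : ℝ} {I : Input} {σ : Store} (hk : 1 ≤ I.k) (h : I.HasColorableCover I.k)
    (hσ : EqOff setConstants (initStore τ I) σ) (hconst : σ.HasConstants) :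
    HaltsWithin prepare σ (12 * I.n + 6 * I.m + 4 * I.k * (5 * I.m + 11) + 29) fun σ' =>
      (taskOf τ I).Progress (-I.coordBound) σ' ∧ σ'.intVar viGo = 1 := by
  refine HaltsWithin.mono (P := fun σ' => EqOff prepare σ σ' →
    (taskOf τ I).Progress (-I.coordBound) σ' ∧ σ'.intVar viGo = 1) ?_ le_rfl
    fun σ' hprepare h => h hprepare
  have hn : σ.intVar viN = I.n := hσ.int _ rfl
  have hm : σ.intVar viM = I.m := hσ.int _ rfl
  refine (setParams_spec (τ := τ) (k := I.k) hconst.one (hσ.real _ rfl) hm (hσ.int _ rfl)).bind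
    (T₂ := 12 * I.n + 6 * I.m + 4 * I.k * (5 * I.m + 11) + 18)
    (fun σ₁ h₁ ⟨hbase, hdigits, hfour, hgo, hheight, hclasses, hlong⟩ => ?_) (by omega)
  have hconst₁ := hconst.of_eqOff h₁
  refine (computeBound_spec hconst₁ ((h₁.int _ rfl).trans hn) ((h₁.int _ rfl).trans hm)).bind
    (T₂ := 4 * I.k * (5 * I.m + 11) + 8) (fun σ₂ h₂ hbound => ?_) (by omega)
  have hconst₂ := hconst₁.of_eqOff h₂
  replace hbound : σ₂.realVar vrBound = I.coordBound := by
    simp (decide := true) only [hbound, h₁.realArr, hσ.realArr]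
    rfl
  refine (setStart_spec hconst₂.realOne hbound
    (m := I.m) (by rw [h₂.int _ rfl, h₁.int _ rfl, hm])).bind (T₂ := 4 * I.k * (5 * I.m + 11) + 4)
    (fun σ₃ h₃ ⟨hlast, hcenterX⟩ => ?_) (by omega)
  have hconst₃ := hconst₂.of_eqOff h₃
  refine (tabulatePowers_spec (M := I.m + 1) (L := 4 * I.k) hconst₃
    (by rw [h₃.int _ rfl, h₂.int _ rfl, hbase]) (by rw [h₃.int _ rfl, h₂.int _ rfl, hdigits])).mono
    (by ring_nf; rfl) fun σ₄ h₄ hpowers hprepare => ?_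
  have hinit := (hσ.mono (q := setConstants ;; prepare) fun c hc => (Bool.or_eq_false_iff.1 hc).1)
    |>.trans (hprepare.mono fun c hc => (Bool.or_eq_false_iff.1 hc).2)
  have hstored : (taskOf τ I).Stored σ₄ := by
    refine ⟨hconst₃.of_eqOff h₄, hinit.int _ rfl, hinit.int _ rfl, hinit.int _ rfl, ?_, ?_, ?_, ?_,
      ?_, ?_, ?_, hinit.realArr _ rfl, hinit.realArr _ rfl, ?_, hinit.realArr _ rfl, hpowers⟩ <;>
      simp (decide := true) only [h₄.int, h₃.int, h₂.int, h₄.real, h₃.real, h₂.real, h₄.realArr,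
        h₂.realArr, h₁.realArr, hσ.realArr, hbase, hdigits, hfour, hclasses, hlong, hheight,
        hbound, hcenterX, taskOf]
    rfl
  exact ⟨hstored.progress_of_eqOff_prepare hk h hinit ((h₄.real _ rfl).trans hlast),
    by rw [h₄.int _ rfl, h₃.int _ rfl, h₂.int _ rfl, hgo]⟩

/-! ### The exponent and the approximation factor -/

lemma sqrt_two_le_iff {τ : ℝ} (h : 0 ≤ τ) : √2 ≤ τ ↔ 2 ≤ τ * τ := by
  rw [Real.sqrt_le_left h, sq]

lemma IsPackingNumber.le {τ : ℝ} {a c : ℕ} (h : IsPackingNumber τ a) (f g : Fin c → Plane)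
    (hf : Pairwise fun i j => 4 < sqDist (toPair (f i)) (toPair (f j)))
    (hg : ∀ i, sqDist (toPair (f i)) (toPair (g i)) ≤ 1) (hcell : ∀ i, g i ∈ cell τ) : c ≤ a := by
  have hinj : Function.Injective f := fun i j hij => by
    by_contra hne
    have := hf hne
    simp [hij, sqDist] at this
    linarith
  refine h.2 ⟨Finset.univ.map ⟨f, hinj⟩, by simp, ?_, ?_⟩
  · simp only [Finset.coe_map, Function.Embedding.coeFn_mk, Finset.coe_univ, Set.image_univ]
    rintro _ ⟨i, rfl⟩ _ ⟨j, rfl⟩ hne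
    exact disjoint_unitDisk_iff.2 (hf fun hij => hne (by rw [hij]))
  · simp only [Finset.mem_map, Finset.mem_univ, Function.Embedding.coeFn_mk, true_and]
    rintro _ ⟨i, rfl⟩
    exact ⟨g i, mem_unitDisk_iff.2 (hg i), hcell i⟩

lemma IsPackingNumber.four_le {τ : ℝ} {a : ℕ} (h : IsPackingNumber τ a) (hτ : 1 ≤ τ) : 4 ≤ a := by
  refine h.le ![!₂[-1, τ / 2], !₂[τ + 1, τ / 2], !₂[τ / 2, -1], !₂[τ / 2, τ + 1]]
    ![!₂[0, τ / 2], !₂[τ, τ / 2], !₂[τ / 2, 0], !₂[τ / 2, τ]] (fun i j hij => ?_) (fun i => ?_)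
    fun i => ?_
  · fin_cases i <;> fin_cases j <;> simp [sqDist, toPair] at hij ⊢ <;> nlinarith
  · fin_cases i <;> simp [sqDist, toPair]
  · fin_cases i <;> simp [cell, Fin.forall_fin_two] <;> grind

lemma IsPackingNumber.five_le {τ : ℝ} {a : ℕ} (h : IsPackingNumber τ a) (hτ : 8 / 5 ≤ τ) :
    5 ≤ a := by
  refine h.le ![!₂[τ / 2, τ / 2], !₂[-(3 / 5), -(4 / 5)], !₂[τ + 3 / 5, -(4 / 5)],
    !₂[-(3 / 5), τ + 4 / 5], !₂[τ + 3 / 5, τ + 4 / 5]]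
    ![!₂[τ / 2, τ / 2], !₂[0, 0], !₂[τ, 0], !₂[0, τ], !₂[τ, τ]] (fun i j hij => ?_) (fun i => ?_)
    fun i => ?_
  · fin_cases i <;> fin_cases j <;> simp [sqDist, toPair] at hij ⊢ <;> nlinarith
  · fin_cases i <;> simp [sqDist, toPair] <;> norm_num
  · fin_cases i <;> simp [cell, Fin.forall_fin_two] <;> grind

lemma IsExponent.le {τ : ℝ} {α : ℕ} (h : IsExponent τ α) (hτ : 1 ≤ τ) :
    (if 2 ≤ τ * τ then 5 else 4) ≤ α := by
  split_ifs with h2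
  · rcases h with ⟨rfl, -⟩ | ⟨-, -, rfl⟩ | ⟨-, rfl⟩ | ⟨-, rfl⟩ | ⟨-, rfl⟩ | ⟨-, rfl⟩ | ⟨ht, h⟩
    · norm_num at h2
    all_goals try norm_num
    refine h.five_le ?_
    by_contra! hcon
    exact ht (.inr (.inl ⟨(sqrt_two_le_iff (by linarith)).2 h2, hcon.le⟩))
  · rcases h with ⟨-, rfl⟩ | ⟨-, -, rfl⟩ | ⟨-, rfl⟩ | ⟨-, rfl⟩ | ⟨-, rfl⟩ | ⟨-, rfl⟩ | ⟨-, h⟩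
    all_goals try norm_num
    exact h.four_le hτ

lemma le_rho {τ : ℝ} (hτ : 1 ≤ τ) : (if 2 ≤ τ * τ then 4 else 9) ≤ rho τ := by
  have hsqrt := sqrt_two_le_iff (zero_le_one.trans hτ)
  unfold rho
  split_ifs <;> try norm_num
  · nlinarith
  · nlinarith
  · exact absurd (hsqrt.1 ‹√2 ≤ τ›) ‹_›

/-! ### The running time -/

lemma succ_pow_le {m k : ℕ} (h : k ≤ m) : (m + 1) ^ k ≤ 3 * m ^ k := by
  rcases Nat.eq_zero_or_pos m with rfl | hm
  · simp [Nat.le_zero.1 h]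
  have hm' : (0 : ℝ) < m := Nat.cast_pos.2 hm
  have hfactor : (1 + 1 / (m : ℝ)) ^ k ≤ 3 := calc
    (1 + 1 / (m : ℝ)) ^ k ≤ Real.exp (1 / m) ^ k := by
      gcongr
      rw [add_comm]
      exact Real.add_one_le_exp _
    _ ≤ Real.exp (1 / m) ^ m := pow_le_pow_right₀ (Real.one_le_exp (by positivity)) h
    _ = Real.exp 1 := by rw [← Real.exp_nat_mul, mul_one_div_cancel hm'.ne']
    _ ≤ 3 := by linarith [Real.exp_one_lt_d9]
  have : ((m : ℝ) + 1) ^ k ≤ 3 * (m : ℝ) ^ k := calc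
    ((m : ℝ) + 1) ^ k = (1 + 1 / (m : ℝ)) ^ k * (m : ℝ) ^ k := by
      rw [← mul_pow]
      field_simp
    _ ≤ 3 * (m : ℝ) ^ k := by gcongr
  exact_mod_cast this

lemma mul_sq_le_two_mul_pow {m k : ℕ} (h : k < m) (hk : 1 ≤ k) : m * (k * k) ≤ 2 * m ^ k := by
  obtain rfl | rfl | hk : k = 1 ∨ k = 2 ∨ 3 ≤ k := by omega
  · simp only [mul_one, pow_one]
    omega
  · nlinarith
  · calc m * (k * k) ≤ m * (m * m) := by gcongr
      _ = m ^ 3 := by ring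
      _ ≤ m ^ k := Nat.pow_le_pow_right (by omega) hk
      _ ≤ 2 * m ^ k := by omega

lemma expandTime_one_le {m k : ℕ} (hm : 1 ≤ m) (hk : 1 ≤ k) :
    expandTime m k 1 + 1 ≤ 500 * (m * (k * k)) := by
  have hkk : k ≤ k * k := Nat.le_mul_of_pos_left _ hk
  calc expandTime m k 1 + 1 = (m + 1) * (1 * (52 * k + 16) + k * (56 * k + 93) + 17) + 1 := rfl
    _ ≤ (2 * m) * (234 * (k * k)) + 1 := by gcongr <;> linarith
    _ ≤ 500 * (m * (k * k)) := by nlinarith [Nat.mul_pos hm (Nat.mul_pos hk hk)]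

lemma solveTime_one_le {m k depth : ℕ} (h : k < m) (hk : 1 ≤ k) (hdepth : depth ≤ 4) :
    solveTime ((m + 1) ^ (depth * k)) m k 1 ≤ 163000 * m ^ ((depth + 1) * k) := by
  set N := (m + 1) ^ (depth * k)
  have hN : N ≤ 81 * m ^ (depth * k) := calc
    N = ((m + 1) ^ k) ^ depth := by rw [← pow_mul, mul_comm]
    _ ≤ (3 * m ^ k) ^ depth := Nat.pow_le_pow_left (succ_pow_le h.le) _
    _ = 3 ^ depth * m ^ (depth * k) := by rw [mul_pow, ← pow_mul, mul_comm k]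
    _ ≤ 3 ^ 4 * m ^ (depth * k) := by gcongr; norm_num
  have hN₁ : 1 ≤ N := Nat.one_le_pow _ _ (by omega)
  have hexpand : expandTime m k 1 + 1 ≤ 1000 * m ^ k :=
    (expandTime_one_le (by omega) hk).trans (by linarith [mul_sq_le_two_mul_pow h hk])
  have hm : m ≤ m ^ k := Nat.le_self_pow (by omega) m
  have hpow : 1 ≤ m ^ (depth * k) := Nat.one_le_pow _ _ (by omega)
  have hproduct : (N + 1) * (expandTime m k 1 + 1) ≤ (162 * m ^ (depth * k)) * (1000 * m ^ k) := by
    gcongr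
    omega
  have hpow₁ : m ^ (depth * k) ≤ m ^ (depth * k) * m ^ k := Nat.le_mul_of_pos_right _ (by omega)
  have hpow₂ : m ^ k ≤ m ^ (depth * k) * m ^ k := Nat.le_mul_of_pos_left _ hpow
  rw [add_one_mul, pow_add]
  unfold solveTime searchTime
  linarith

lemma total_time_le {n m k depth : ℕ} (hkm : k < m) (hk : 1 ≤ k) (hn : 1 ≤ n) (hdepth : 1 ≤ depth)
    (hdepth' : depth ≤ 4) :
    12 * n + 6 * m + 4 * k * (5 * m + 11) + 29 + (5 * m * (15 * n + 21) +
      n * solveTime ((m + 1) ^ (depth * k)) m k 1 + (7 * n + 8)) + 3 ≤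
        164000 * (m ^ ((depth + 1) * k) * n) := by
  have hsolve := Nat.mul_le_mul_left n (solveTime_one_le hkm hk hdepth')
  set W := m ^ ((depth + 1) * k)
  have hsq : m * m ≤ W := by
    rw [← sq]
    exact Nat.pow_le_pow_right (by omega) (by nlinarith)
  have hm : m ≤ m * m := Nat.le_mul_of_pos_left _ (by omega)
  have hkm' : k * m ≤ m * m := Nat.mul_le_mul_right _ hkm.le
  have hW : W ≤ W * n := Nat.le_mul_of_pos_right _ hn
  have hmn : m * n ≤ W * n := Nat.mul_le_mul_right _ (by omega)
  have hn' : n ≤ W * n := Nat.le_mul_of_pos_left _ (by omega)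
  linarith

/-! ### The algorithm -/

/-- The whole algorithm. With at most `k` disks there is nothing to search for, and the bound for
the running time leaves no room for treating strips. -/
def algorithm : Prog := setConstants ;; .ite (.intLe viM viK) colorAll (prepare ;; allStrips)

section

variable {I : Input} {c : ℕ}

lemma Input.IsColoredCover.mono {c' : ℕ} {S : Set (Fin I.m)} {χ : Fin I.m → ℕ}
    (h : I.IsColoredCover c S χ) (hc : c ≤ c') : I.IsColoredCover c' S χ :=
  ⟨h.1, fun j hj => ⟨(h.2.1 j hj).1, (h.2.1 j hj).2.trans hc⟩, h.2.2⟩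

lemma Input.HasColorableCover.one_le (h : I.HasColorableCover c) (hn : 1 ≤ I.n) :
    1 ≤ I.m ∧ 1 ≤ c := by
  obtain ⟨S, χ, hcover, hcolor, -⟩ := h
  obtain ⟨j, hj, -⟩ := hcover ⟨0, hn⟩
  exact ⟨j.pos, (hcolor j hj).1.trans (hcolor j hj).2⟩

lemma Input.HasColorableCover.isColoredCover_of_distinct {σ : Store} (h : I.HasColorableCover c)
    (hσ : ∀ x < I.m, σ.intArr aiOut x = x + 1) :
    I.IsColoredCover I.m (outDisks I σ) (outColor I σ) := by
  have hout (j : Fin I.m) : outColor I σ j = j + 1 := hσ j j.2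
  refine ⟨fun i => ?_, fun j _ => ?_, fun j _ j' _ hne heq => ?_⟩
  · obtain ⟨S, χ, hcover, -⟩ := h
    obtain ⟨j, -, hj⟩ := hcover i
    exact ⟨j, (hout j).trans_ne (Nat.succ_ne_zero _), hj⟩
  · rw [hout]
    exact ⟨Nat.le_add_left _ _, j.2⟩
  · rw [hout, hout] at heq
    exact absurd (Fin.ext (Nat.succ_injective heq)) hne

lemma setConstants_spec (σ : Store) (hzero : σ.intVar viZero = 0) :
    HaltsWithin setConstants σ 2 Store.HasConstants :=
  .block (by simp) (by simp) ⟨rfl, hzero, Rat.cast_one⟩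

lemma prepare_allStrips_spec {τ : ℝ} {σ : Store} (hk : 1 ≤ I.k) (h : I.HasColorableCover I.k)
    (hσ : EqOff setConstants (initStore τ I) σ) (hconst : σ.HasConstants) :
    HaltsWithin (prepare ;; allStrips) σ
      (12 * I.n + 6 * I.m + 4 * I.k * (5 * I.m + 11) + 29 + (5 * I.m * (15 * I.n + 21) +
        I.n * (taskOf τ I).stripTime 1 + (7 * I.n + 8))) fun σ' =>
      I.IsColoredCover ((if 2 ≤ τ * τ then 4 else 9) * I.k) (outDisks I σ') (outColor I σ') := by
  refine (prepare_spec hk h hσ hconst).bind (fun σ₁ _ ⟨hprogress, hgo⟩ => ?_) le_rfl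
  refine (Task.allStrips_spec (taskOf_valid hk h) hprogress hgo).mono ?_
    fun σ₂ _ ⟨last, cl, hremaining, hcolored⟩ => hcolored.isColoredCover hremaining le_rfl
  have hremaining : (taskOf τ I).remaining (-I.coordBound) ≤ I.n :=
    (Finset.card_filter_le _ _).trans_eq (Finset.card_range _)
  change 5 * I.m * (15 * I.n + 21) + _ + (7 * I.n + 8) ≤ _
  gcongr

lemma algorithm_spec (τ : ℝ) (hn : 1 ≤ I.n) (h : I.HasColorableCover I.k) :
    HaltsWithin algorithm (initStore τ I)
      (164000 * (I.m ^ ((if 2 ≤ τ * τ then 5 else 4) * I.k) * I.n)) fun σ =>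
      I.IsColoredCover ((if 2 ≤ τ * τ then 4 else 9) * I.k) (outDisks I σ) (outColor I σ) := by
  obtain ⟨hm, hk⟩ := h.one_le hn
  have hdepth : 1 ≤ (taskOf τ I).depth ∧ (taskOf τ I).depth ≤ 4 := by
    rcases (taskOf_valid (τ := τ) hk h).strips with ⟨h, -⟩ | ⟨h, -⟩ <;> omega
  have hexponent : (if 2 ≤ τ * τ then 5 else 4) = (taskOf τ I).depth + 1 := by
    simp only [taskOf]
    split_ifs <;> rfl
  rw [hexponent]
  set W := I.m ^ (((taskOf τ I).depth + 1) * I.k)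
  have hmW : I.m ≤ W := Nat.le_self_pow (Nat.mul_pos (Nat.succ_pos _) hk).ne' _
  have hW : W ≤ W * I.n := Nat.le_mul_of_pos_right _ hn
  refine (setConstants_spec (initStore τ I) rfl).bind (T₂ := 164000 * (W * I.n) - 2)
    (fun σ h₁ hconst => .ite (T₁ := 164000 * (W * I.n) - 3) (fun hb => ?_) (fun hb => ?_)
    (by omega)) (by omega) <;>
    simp (decide := true) only [Test.Holds, h₁.int] at hb
  · have hm₁ : σ.intVar viM = I.m := h₁.int _ rfl
    refine (colorAll_spec hconst).mono (by omega) fun σ' _ hσ' => ?_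
    rw [hm₁] at hσ'
    refine (h.isColoredCover_of_distinct hσ').mono (hb.trans (Nat.le_mul_of_pos_left _ ?_))
    split_ifs <;> norm_num
  · exact (prepare_allStrips_spec hk h h₁ hconst).mono
      (Nat.le_sub_of_add_le (total_time_le (not_le.1 hb) hk hn hdepth.1 hdepth.2)) fun _ _ h => h

end

lemma IsExponent.time_le {τ : ℝ} {α C m n k t : ℕ} (h : IsExponent τ α) (hτ : 1 ≤ τ) (hm : 1 ≤ m)
    (hk : 1 ≤ k) (ht : t ≤ C * (m ^ ((if 2 ≤ τ * τ then 5 else 4) * k) * n)) :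
    (t : ℝ) ≤ 2 * C * ((m : ℝ) ^ (α * k) * n * Real.log ((k : ℝ) + 1)) := by
  have hlog : 1 ≤ 2 * Real.log ((k : ℝ) + 1) := by
    have hk' : (2 : ℝ) ≤ k + 1 := by exact_mod_cast Nat.succ_le_succ hk
    linarith [Real.log_le_log two_pos hk', Real.log_two_gt_d9]
  have ht' : t ≤ C * (m ^ (α * k) * n) := ht.trans (by gcongr; exact h.le hτ)
  calc (t : ℝ) ≤ C * ((m : ℝ) ^ (α * k) * n) := by exact_mod_cast ht'
    _ ≤ C * ((m : ℝ) ^ (α * k) * n) * (2 * Real.log ((k : ℝ) + 1)) :=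
      le_mul_of_one_le_right (by positivity) hlog
    _ = 2 * C * ((m : ℝ) ^ (α * k) * n * Real.log ((k : ℝ) + 1)) := by ring

end CDUDC

end

theorem mainTheorem3_general :
    ∃ (prog : CDUDC.Prog) (C : ℕ),
      ∀ (τ : ℝ) (I : CDUDC.Input), 1 ≤ I.n → I.HasColorableCover I.k →
        ∃ (t : ℕ) (σ : CDUDC.Store),
          CDUDC.Runs prog (CDUDC.initStore τ I) t σ ∧
          t ≤ C * (I.m ^ ((if 2 ≤ τ * τ then 5 else 4) * I.k) * I.n) ∧
          I.IsColoredCover ((if 2 ≤ τ * τ then 4 else 9) * I.k) (CDUDC.outDisks I σ)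
            (CDUDC.outColor I σ) := by
  refine ⟨CDUDC.algorithm, 164000, fun τ I hn hcover => ?_⟩
  obtain ⟨t, σ, ht, hrun, hσ⟩ := CDUDC.algorithm_spec τ hn hcover
  exact ⟨t, σ, hrun, ht, hσ⟩

theorem mainTheorem3 :
    ∃ (prog : CDUDC.Prog) (C : ℝ),
      ∀ (τ : ℝ) (α : ℕ), 1 ≤ τ → τ ≤ 5 → CDUDC.IsExponent τ α →
      ∀ I : CDUDC.Input, 1 ≤ I.n → 1 ≤ I.k → I.HasColorableCover I.k →
        ∃ (t : ℕ) (σ : CDUDC.Store),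
          CDUDC.Runs prog (CDUDC.initStore τ I) t σ ∧
          (t : ℝ) ≤ C * ((I.m : ℝ) ^ (α * I.k) * (I.n : ℝ) * Real.log ((I.k : ℝ) + 1)) ∧
          I.IsColoredCover (CDUDC.rho τ * I.k) (CDUDC.outDisks I σ) (CDUDC.outColor I σ) := by
  obtain ⟨prog, C, hprog⟩ := mainTheorem3_general
  refine ⟨prog, 2 * C, fun τ α hτ _ hα I hn hk hcover => ?_⟩
  obtain ⟨t, σ, hrun, ht, hσ⟩ := hprog τ I hn hcover
  exact ⟨t, σ, hrun, hα.time_le hτ (hcover.one_le hn).1 hk ht,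
    hσ.mono (Nat.mul_le_mul_right _ (CDUDC.le_rho hτ))⟩
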